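/- Let $K=\{(x,y,z): x,y,z>0,\ x+y+z<1\}$ be the reference tetrahedron and let $k\ge 0$ be an integer. For $d\in\{2,3\}$ let $\mathcal P_p$ denote the real polynomials of total degree at most $p$ in $d$ variables, $\widetilde{\mathcal P}_p$ the homogeneous ones of degree $p$ (together with $0$), and $\boldsymbol{\mathcal P}_p=\mathcal P_p^d$, $\widetilde{\boldsymbol{\mathcal P}}_p=\widetilde{\mathcal P}_p^d$. With $\boldsymbol x=(x,y,z)^t$, consider on $K$ $$S_1:\quad \mathcal P_{k+3}\xrightarrow{\nabla}\boldsymbol{\mathcal P}_{k+2}\xrightarrow{\nabla\times}\boldsymbol{\mathcal P}_{k+1}\xrightarrow{\nabla\cdot}\mathcal P_k ,$$ $$S_2:\quad \mathcal P_{k+1}\xrightarrow{\nabla}\boldsymbol{\mathcal P}_k\oplus\boldsymbol x\times\widetilde{\boldsymbol{\mathcal P}}_k\xrightarrow{\nabla\times}\boldsymbol{\mathcal P}_k\oplus\boldsymbol x\,\widetilde{\mathcal P}_k\xrightarrow{\nabla\cdot}\mathcal P_k .$$ Write such a sequence as $H\to E\to V\to W$. For a face $f$ of $K$ with outward unit normal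 $n$, let $\mathrm{tr}^f$ be its trace sequence $H|_f\xrightarrow{\nabla}(n\times(E\times n))|_f\xrightarrow{\nabla\times}(V\cdot n)|_f$, written in Cartesian coordinates $(s_1,s_2)$ of the plane of $f$ (any origin, any orthonormal tangent vectors $t_1,t_2$ with $t_1\times t_2=n$). For an edge $e$ with unit tangent $t$, let $\mathrm{tr}^e$ be the trace sequence $H|_e\to(E\cdot t)|_e$, in the arc length of $e$; edge traces of a planar sequence $H\to E\to W$ are defined likewise. **Claim.** The sums in $S_2$ and in (b) below are direct, and both $S_1$ and $S_2$ are commuting exact sequences, that is, the following hold for each of them. 1. *Exactness:* $0\to\mathbb R\to H\to E\to V\to W\to 0$ is exact. 2. *Compatibility.* Here $\mathring{\ }$ denotes the subspace with zero trace (restriction for $H$-spaces, tangential trace for $E$-spaces) on the boundary of the cell. * For every face $f$, the sequence $\mathrm{tr}^f=(H_2(f)\to E_2(f)\to W_2(f))$ is a compatible exact sequence on the triangle $f$. This means: $0\to\mathbb R\to H_2(f)\to E_2(f)\to W_2(f)\to0$ is exact; for each edge $e$ of $f$ its edge trace $H_1(e)\to W_1(e)$ has $0\to\mathbb R\to H_1(e)\to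 W_1(e)\to0$ exact, and the restriction of $H_1(e)$ to the two end points of $e$ has dimension $2$; $\dim H_2(f)|_{\partial f}=3+\sum_{e\subset f}\dim\mathring H_1(e)$; and the tangential trace of $E_2(f)$ on $\partial f$ has dimension $\sum_{e\subset f}\dim W_1(e)$. * With sums over the six edges $e$, with $\mathrm{tr}^e=(H_1(e)\to W_1(e))$, and over the four faces $f$ of $K$, the space $H|_{\partial K}$ has dimension $4+\sum_e\dim\mathring H_1(e)+\sum_f\dim\mathring H_2(f)$, the tangential trace of $E$ on $\partial K$ has dimension $\sum_e\dim W_1(e)+\sum_f\dim\mathring E_2(f)$, and the normal trace of $V$ on $\partial K$ has dimension $\sum_f\dim W_2(f)$. 3. *Commuting diagram.* There are linear projections $\Pi_H,\Pi_E,\Pi_V,\Pi_W$ of the smooth scalar fields (for $H,W$) and smooth vector fields (for $E,V$) on $\overline K$ onto $H,E,V,W$ with $$\nabla\Pi_Hu=\Pi_E\nabla u,\qquad \nabla\times\Pi_Eu=\Pi_V\nabla\times u,\qquad \nabla\cdot\Pi_Vu=\Pi_W\nabla\cdot u$$ for all smooth $u$, and these are compatible with traces: on each face the trace of $\Pi_Hu$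 and the tangential trace of $\Pi_Eu$ and the normal trace of $\Pi_Vu$ depend only on the same trace of $u$ on that face; on each edge the trace of $\Pi_Hu$ and the tangential trace of $\Pi_Eu$ depend only on the same trace of $u$ on that edge; and $\Pi_Hu=u$ at the vertices. Moreover, for every face $f$ the trace sequence $\mathrm{tr}^f$ is: * (a) for $S_1$: $\ \mathcal P_{k+3}(s_1,s_2)\xrightarrow{\nabla}\boldsymbol{\mathcal P}_{k+2}(s_1,s_2)\xrightarrow{\nabla\times}\mathcal P_{k+1}(s_1,s_2)$; * (b) for $S_2$: $\ \mathcal P_{k+1}(s_1,s_2)\xrightarrow{\nabla}\boldsymbol{\mathcal P}_k(s_1,s_2)\oplus(s_2,-s_1)^t\,\widetilde{\mathcal P}_k(s_1,s_2)\xrightarrow{\nabla\times}\mathcal P_k(s_1,s_2)$. -/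

import Mathlib

open scoped ContDiff Matrix

noncomputable section

namespace FES

/-! ### Differential operators

`D i` is the partial derivative in the `i`-th coordinate, acting on scalar fields `M`
(polynomials or smooth functions); a vector field is the tuple of its components. -/

section Operators

variable {M : Type*} [AddCommGroup M] [Module ℝ M]

/-- The gradient `(∂₁ v, …, ∂_d v)`. -/
def gradOf {d : ℕ} (D : Fin d → M →ₗ[ℝ] M) : M →ₗ[ℝ] (Fin d → M) := LinearMap.pi D

/-- `∂_i v_j`. -/
def partialOf {d : ℕ} (D : Fin d → M →ₗ[ℝ] M) (i j : Fin d) : (Fin d → M) →ₗ[ℝ] M :=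
  D i ∘ₗ LinearMap.proj j

/-- The scalar curl `-∂₂ v₁ + ∂₁ v₂` in the plane. -/
def curl2Of (D : Fin 2 → M →ₗ[ℝ] M) : (Fin 2 → M) →ₗ[ℝ] M :=
  -partialOf D 1 0 + partialOf D 0 1

/-- The curl of a vector field in space. -/
def curl3Of (D : Fin 3 → M →ₗ[ℝ] M) : (Fin 3 → M) →ₗ[ℝ] (Fin 3 → M) :=
  LinearMap.pi ![-partialOf D 2 1 + partialOf D 1 2,
    -partialOf D 0 2 + partialOf D 2 0,
    -partialOf D 1 0 + partialOf D 0 1]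

/-- The divergence `∂₁ v₁ + ∂₂ v₂ + ∂₃ v₃`. -/
def div3Of (D : Fin 3 → M →ₗ[ℝ] M) : (Fin 3 → M) →ₗ[ℝ] M :=
  ∑ i, partialOf D i i

end Operators

/-! ### Polynomial fields

A polynomial function on a segment, triangle or tetrahedron (a set with nonempty interior) is
identified with the polynomial; its derivatives are then the formal ones. -/

/-- Scalar polynomial fields in `d` variables. -/
abbrev Poly (d : ℕ) := MvPolynomial (Fin d) ℝ

/-- Polynomial vector fields in `d` variables. -/
abbrev PolyVec (d : ℕ) := Fin d → MvPolynomial (Fin d) ℝ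

/-- Partial derivatives of polynomials. -/
def polyD {d : ℕ} (i : Fin d) : Poly d →ₗ[ℝ] Poly d := (MvPolynomial.pderiv i).toLinearMap

def grad (d : ℕ) : Poly d →ₗ[ℝ] PolyVec d := gradOf polyD
def curl2 : PolyVec 2 →ₗ[ℝ] Poly 2 := curl2Of polyD
def curl3 : PolyVec 3 →ₗ[ℝ] PolyVec 3 := curl3Of polyD
def div3 : PolyVec 3 →ₗ[ℝ] Poly 3 := div3Of polyD

/-- The constants, i.e. the image of `ℝ` under the inclusion map. -/
def constants (d : ℕ) : Submodule ℝ (Poly d) := LinearMap.range (Algebra.linearMap ℝ (Poly d))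

/-- `𝓟_p`: polynomials of total degree at most `p`. -/
def P (d p : ℕ) : Submodule ℝ (Poly d) := MvPolynomial.restrictTotalDegree (Fin d) ℝ p

/-- Vector fields with all components in `𝓟_p`. -/
def PVec (d p : ℕ) : Submodule ℝ (PolyVec d) := Submodule.pi Set.univ fun _ => P d p

/-- Homogeneous polynomials of total degree `p`. -/
def Phom (d p : ℕ) : Submodule ℝ (Poly d) := MvPolynomial.homogeneousSubmodule (Fin d) ℝ p

/-- Vector fields with all components homogeneous of degree `p`. -/
def PhomVec (d p : ℕ) : Submodule ℝ (PolyVec d) := Submodule.pi Set.univ fun _ => Phom d p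

/-- `q ↦ x × q` for vector fields `q` in space. -/
def xCross3 : PolyVec 3 →ₗ[ℝ] PolyVec 3 :=
  (crossProduct (fun i : Fin 3 => (MvPolynomial.X i : Poly 3))).restrictScalars ℝ

/-- `p ↦ x p = (x p, y p, z p)` for scalar `p` in space. -/
def xMul3 : Poly 3 →ₗ[ℝ] PolyVec 3 :=
  LinearMap.pi fun i => LinearMap.mulLeft ℝ (MvPolynomial.X i)

/-- `p ↦ x × p = (y p, -x p)` for scalar `p` in the plane. -/
def xCross2 : Poly 2 →ₗ[ℝ] PolyVec 2 :=
  LinearMap.pi ![LinearMap.mulLeft ℝ (MvPolynomial.X 1 : Poly 2),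
    -LinearMap.mulLeft ℝ (MvPolynomial.X 0 : Poly 2)]

/-! ### Edges -/

/-- Length of the segment from `p` to `q`. -/
def edgeLen {d : ℕ} (p q : Fin d → ℝ) : ℝ := √((q - p) ⬝ᵥ (q - p))

/-- Unit tangent of the segment from `p` to `q`. -/
def edgeDir {d : ℕ} (p q : Fin d → ℝ) : Fin d → ℝ := (edgeLen p q)⁻¹ • (q - p)

/-- Trace of a scalar field on the edge `[p, q]`, as a polynomial in the arc length
`s ∈ [0, edgeLen p q]`: the restriction `s ↦ v (p + s t)` with `t` the unit tangent. -/
def edgeTrH {d : ℕ} (p q : Fin d → ℝ) : Poly d →ₗ[ℝ] Polynomial ℝ :=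
  (MvPolynomial.aeval fun i =>
    Polynomial.C (p i) + Polynomial.C (edgeDir p q i) * Polynomial.X).toLinearMap

/-- Tangential trace `v · t` of a vector field on the edge `[p, q]`, in the arc length. -/
def edgeTrE {d : ℕ} (p q : Fin d → ℝ) : PolyVec d →ₗ[ℝ] Polynomial ℝ :=
  ∑ i, edgeDir p q i • (edgeTrH p q ∘ₗ LinearMap.proj i)

/-! ### One dimension: sequences on a segment `[0, L]` -/

/-- The spaces of a sequence `H → W` on a segment. -/
@[ext] structure Seq1 where
  H : Submodule ℝ (Polynomial ℝ)
  W : Submodule ℝ (Polynomial ℝ)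

namespace Seq1

/-- Exactness of `0 → ℝ → H → W → 0`. -/
structure IsExact (S : Seq1) : Prop where
  ker_grad : LinearMap.range (Algebra.linearMap ℝ (Polynomial ℝ)) =
    S.H ⊓ LinearMap.ker Polynomial.derivative
  range_grad : S.H.map Polynomial.derivative = S.W

/-- Trace of a function on `[0, L]` on the two end points. -/
def bdryTrH (L : ℝ) : Polynomial ℝ →ₗ[ℝ] ℝ × ℝ := (Polynomial.leval 0).prod (Polynomial.leval L)

/-- Functions in `H` that vanish at both end points of `[0, L]`. -/
def bubbleH (S : Seq1) (L : ℝ) : Submodule ℝ (Polynomial ℝ) := S.H ⊓ LinearMap.ker (bdryTrH L)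

/-- One-dimensional compatible exact sequences on `[0, L]`. -/
structure IsCompatible (S : Seq1) (L : ℝ) : Prop where
  finH : FiniteDimensional ℝ S.H
  finW : FiniteDimensional ℝ S.W
  exact : S.IsExact
  dim_trH : Module.finrank ℝ (S.H.map (bdryTrH L)) = 2

end Seq1

/-! ### Two dimensions: sequences on a triangle -/

/-- The spaces of a sequence `H → E → W` in the plane. -/
@[ext] structure Seq2 where
  H : Submodule ℝ (Poly 2)
  E : Submodule ℝ (PolyVec 2)
  W : Submodule ℝ (Poly 2)

namespace Seq2

/-- Exactness of `0 → ℝ → H → E → W → 0`. -/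
structure IsExact (S : Seq2) : Prop where
  ker_grad : constants 2 = S.H ⊓ LinearMap.ker (grad 2)
  range_grad : S.H.map (grad 2) = S.E ⊓ LinearMap.ker curl2
  range_curl : S.E.map curl2 = S.W

/-- Trace of a sequence on the edge `[p, q]`. -/
def edgeTrace (S : Seq2) (p q : Fin 2 → ℝ) : Seq1 where
  H := S.H.map (edgeTrH p q)
  W := S.E.map (edgeTrE p q)

/-- Trace of scalar fields on the whole boundary of the triangle with vertices `T`.
The edge with index `j` joins `T (j + 1)` and `T (j + 2)`. -/
def bdryTrH (T : Fin 3 → Fin 2 → ℝ) : Poly 2 →ₗ[ℝ] (Fin 3 → Polynomial ℝ) :=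
  LinearMap.pi fun j => edgeTrH (T (j + 1)) (T (j + 2))

/-- Tangential trace of vector fields on the whole boundary of the triangle. -/
def bdryTrE (T : Fin 3 → Fin 2 → ℝ) : PolyVec 2 →ₗ[ℝ] (Fin 3 → Polynomial ℝ) :=
  LinearMap.pi fun j => edgeTrE (T (j + 1)) (T (j + 2))

/-- Scalar fields in `H` with vanishing trace on the boundary of the triangle. -/
def bubbleH (S : Seq2) (T : Fin 3 → Fin 2 → ℝ) : Submodule ℝ (Poly 2) :=
  S.H ⊓ LinearMap.ker (bdryTrH T)

/-- Vector fields in `E` with vanishing tangential trace on the boundary of the triangle. -/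
def bubbleE (S : Seq2) (T : Fin 3 → Fin 2 → ℝ) : Submodule ℝ (PolyVec 2) :=
  S.E ⊓ LinearMap.ker (bdryTrE T)

/-- Two-dimensional compatible exact sequences on the triangle with vertices `T`. -/
structure IsCompatible (S : Seq2) (T : Fin 3 → Fin 2 → ℝ) : Prop where
  finH : FiniteDimensional ℝ S.H
  finE : FiniteDimensional ℝ S.E
  finW : FiniteDimensional ℝ S.W
  exact : S.IsExact
  edge : ∀ j : Fin 3, (S.edgeTrace (T (j + 1)) (T (j + 2))).IsCompatible
    (edgeLen (T (j + 1)) (T (j + 2)))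
  dim_trH : Module.finrank ℝ (S.H.map (bdryTrH T)) =
    (∑ _v : Fin 3, 1) +
    ∑ j : Fin 3, Module.finrank ℝ ((S.edgeTrace (T (j + 1)) (T (j + 2))).bubbleH
      (edgeLen (T (j + 1)) (T (j + 2))))
  dim_trE : Module.finrank ℝ (S.E.map (bdryTrE T)) =
    ∑ j : Fin 3, Module.finrank ℝ (S.edgeTrace (T (j + 1)) (T (j + 2))).W

end Seq2

/-! ### The reference tetrahedron -/

/-- The reference tetrahedron `{x, y, z > 0, x + y + z < 1}`. -/
def refTet : Set (Fin 3 → ℝ) := {x | (∀ i, 0 < x i) ∧ ∑ i, x i < 1}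

/-- The four vertices `0, e₁, e₂, e₃`. -/
def vertex : Fin 4 → Fin 3 → ℝ := ![0, Pi.single 0 1, Pi.single 1 1, Pi.single 2 1]

/-- The (closed) face opposite to the vertex `i`. -/
def face (i : Fin 4) : Set (Fin 3 → ℝ) := convexHull ℝ (vertex '' {i}ᶜ)

/-- The six edges, as increasing pairs of vertices. -/
abbrev Edge := {e : Fin 4 × Fin 4 // e.1 < e.2}

/-- First and second end point of an edge. -/
def Edge.p (e : Edge) : Fin 3 → ℝ := vertex e.1.1
def Edge.q (e : Edge) : Fin 3 → ℝ := vertex e.1.2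

/-- Isometric coordinates on the plane of the face opposite to the vertex `i`: the point with
coordinates `(s₁, s₂)` is `origin + s₁ t₁ + s₂ t₂`, where `t₁, t₂` is an orthonormal basis of the
directions of the plane such that `t₁ × t₂` is the outward unit normal. -/
structure FaceChart (i : Fin 4) where
  origin : Fin 3 → ℝ
  t₁ : Fin 3 → ℝ
  t₂ : Fin 3 → ℝ
  t₁_unit : t₁ ⬝ᵥ t₁ = 1
  t₂_unit : t₂ ⬝ᵥ t₂ = 1
  t₁_t₂ : t₁ ⬝ᵥ t₂ = 0
  in_plane : ∀ j, j ≠ i → (vertex j - origin) ⬝ᵥ (t₁ ⨯₃ t₂) = 0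
  outward : (vertex i - origin) ⬝ᵥ (t₁ ⨯₃ t₂) < 0

/-- Every face has isometric coordinates. -/
instance (i : Fin 4) : Nonempty (FaceChart i) := by
  have h2 : (√2 : ℝ) * √2 = 2 := Real.mul_self_sqrt (by norm_num)
  have h6 : (√6 : ℝ) * √6 = 6 := Real.mul_self_sqrt (by norm_num)
  have p2 : (0 : ℝ) < √2 := Real.sqrt_pos.2 (by norm_num)
  have p6 : (0 : ℝ) < √6 := Real.sqrt_pos.2 (by norm_num)
  fin_cases i
  · refine ⟨⟨![1, 0, 0], ![-√2 / 2, √2 / 2, 0], ![-√6 / 6, -√6 / 6, √6 / 3], ?_, ?_, ?_, ?_, ?_⟩⟩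
    · simp [dotProduct, Fin.sum_univ_succ]; linarith
    · simp [dotProduct, Fin.sum_univ_succ]; linarith
    · simp [dotProduct, Fin.sum_univ_succ]; ring
    · intro j hj
      fin_cases j <;>
        simp [vertex, dotProduct, Fin.sum_univ_succ, cross_apply, Pi.single_apply] at hj ⊢ <;> ring
    · simp [vertex, dotProduct, Fin.sum_univ_succ, cross_apply]
  · refine ⟨⟨0, ![0, 0, 1], ![0, 1, 0], ?_, ?_, ?_, ?_, ?_⟩⟩
    · simp
    · simp
    · simp
    · intro j hj
      fin_cases j <;>
        simp [vertex, dotProduct, Fin.sum_univ_succ, cross_apply, Pi.single_apply] at hj ⊢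
    · simp [vertex, dotProduct, Fin.sum_univ_succ, cross_apply]
  · refine ⟨⟨0, ![1, 0, 0], ![0, 0, 1], ?_, ?_, ?_, ?_, ?_⟩⟩
    · simp
    · simp
    · simp
    · intro j hj
      fin_cases j <;>
        simp [vertex, dotProduct, Fin.sum_univ_succ, cross_apply, Pi.single_apply] at hj ⊢
    · simp [vertex, dotProduct, Fin.sum_univ_succ, cross_apply]
  · refine ⟨⟨0, ![0, 1, 0], ![1, 0, 0], ?_, ?_, ?_, ?_, ?_⟩⟩
    · simp
    · simp
    · simp
    · intro j hj
      fin_cases j <;>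
        simp [vertex, dotProduct, Fin.sum_univ_succ, cross_apply, Pi.single_apply] at hj ⊢
    · simp [vertex, dotProduct, Fin.sum_univ_succ, cross_apply]

namespace FaceChart

variable {i : Fin 4} (c : FaceChart i)

/-- The outward unit normal of the face. -/
def n : Fin 3 → ℝ := c.t₁ ⨯₃ c.t₂

/-- Coordinates of a point of the plane of the face. -/
def coord (x : Fin 3 → ℝ) : Fin 2 → ℝ := ![(x - c.origin) ⬝ᵥ c.t₁, (x - c.origin) ⬝ᵥ c.t₂]

/-- The face in coordinates: the three vertices of a triangle in the plane. -/
def triangle : Fin 3 → Fin 2 → ℝ := fun j => c.coord (vertex (i.succAbove j))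

/-- Trace of a scalar field on the face, in the coordinates of the face. -/
def trH : Poly 3 →ₗ[ℝ] Poly 2 :=
  (MvPolynomial.aeval fun m =>
    MvPolynomial.C (c.origin m) + MvPolynomial.C (c.t₁ m) * MvPolynomial.X 0 +
      MvPolynomial.C (c.t₂ m) * MvPolynomial.X 1).toLinearMap

/-- Restriction to the face of the component `v · a` of a vector field along a vector `a`. -/
def trDot (a : Fin 3 → ℝ) : PolyVec 3 →ₗ[ℝ] Poly 2 := ∑ m, a m • (c.trH ∘ₗ LinearMap.proj m)

/-- Tangential trace `n × (v × n)` on the face. It is the tangential part of `v`,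
so its components in the basis `t₁, t₂` are `v · t₁` and `v · t₂`. -/
def trE : PolyVec 3 →ₗ[ℝ] PolyVec 2 := LinearMap.pi ![c.trDot c.t₁, c.trDot c.t₂]

/-- Normal trace `v · n` on the face. -/
def trV : PolyVec 3 →ₗ[ℝ] Poly 2 := c.trDot c.n

end FaceChart

/-! ### Three dimensions: sequences on the reference tetrahedron -/

/-- The spaces of a sequence `H → E → V → W` in space. -/
@[ext] structure Seq3 where
  H : Submodule ℝ (Poly 3)
  E : Submodule ℝ (PolyVec 3)
  V : Submodule ℝ (PolyVec 3)
  W : Submodule ℝ (Poly 3)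

namespace Seq3

/-- Exactness of `0 → ℝ → H → E → V → W → 0`. -/
structure IsExact (S : Seq3) : Prop where
  ker_grad : constants 3 = S.H ⊓ LinearMap.ker (grad 3)
  range_grad : S.H.map (grad 3) = S.E ⊓ LinearMap.ker curl3
  range_curl : S.E.map curl3 = S.V ⊓ LinearMap.ker div3
  range_div : S.V.map div3 = S.W

/-- Trace of a sequence on a face, in the coordinates of the face. -/
def faceTrace (S : Seq3) {i : Fin 4} (c : FaceChart i) : Seq2 where
  H := S.H.map c.trH
  E := S.E.map c.trE
  W := S.V.map c.trV

/-- Trace of a sequence on an edge. -/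
def edgeTrace (S : Seq3) (e : Edge) : Seq1 where
  H := S.H.map (edgeTrH e.p e.q)
  W := S.E.map (edgeTrE e.p e.q)

/-- Traces on the whole boundary, given by their values on the four faces. -/
def bdryTrH (c : ∀ i, FaceChart i) : Poly 3 →ₗ[ℝ] (Fin 4 → Poly 2) :=
  LinearMap.pi fun i => (c i).trH

def bdryTrE (c : ∀ i, FaceChart i) : PolyVec 3 →ₗ[ℝ] (Fin 4 → PolyVec 2) :=
  LinearMap.pi fun i => (c i).trE

def bdryTrV (c : ∀ i, FaceChart i) : PolyVec 3 →ₗ[ℝ] (Fin 4 → Poly 2) :=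
  LinearMap.pi fun i => (c i).trV

/-- Three-dimensional compatible exact sequences on the reference tetrahedron. -/
structure IsCompatible (S : Seq3) (c : ∀ i, FaceChart i) : Prop where
  finH : FiniteDimensional ℝ S.H
  finE : FiniteDimensional ℝ S.E
  finV : FiniteDimensional ℝ S.V
  finW : FiniteDimensional ℝ S.W
  exact : S.IsExact
  face : ∀ i, (S.faceTrace (c i)).IsCompatible (c i).triangle
  dim_trH : Module.finrank ℝ (S.H.map (bdryTrH c)) =
    (∑ _v : Fin 4, 1) +
    (∑ e : Edge, Module.finrank ℝ ((S.edgeTrace e).bubbleH (edgeLen e.p e.q))) +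
    ∑ i : Fin 4, Module.finrank ℝ ((S.faceTrace (c i)).bubbleH (c i).triangle)
  dim_trE : Module.finrank ℝ (S.E.map (bdryTrE c)) =
    (∑ e : Edge, Module.finrank ℝ (S.edgeTrace e).W) +
    ∑ i : Fin 4, Module.finrank ℝ ((S.faceTrace (c i)).bubbleE (c i).triangle)
  dim_trV : Module.finrank ℝ (S.V.map (bdryTrV c)) =
    ∑ i : Fin 4, Module.finrank ℝ (S.faceTrace (c i)).W

end Seq3

/-! ### Smooth fields and commuting diagrams -/

/-- Smooth scalar fields on space. -/
def SmoothScalar : Submodule ℝ ((Fin 3 → ℝ) → ℝ) where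
  carrier := {u | ContDiff ℝ ∞ u}
  add_mem' := fun {_ _} hu hv => ContDiff.add (n := ∞) (𝕜 := ℝ) hu hv
  zero_mem' := contDiff_const (𝕜 := ℝ) (n := ∞) (c := (0 : ℝ))
  smul_mem' := fun a _ hu => ContDiff.smul (n := ∞) (contDiff_const (𝕜 := ℝ) (c := a)) hu

/-- Smooth vector fields on space, given by their components. -/
abbrev SmoothVec := Fin 3 → SmoothScalar

/-- The value of a smooth vector field at a point. -/
def SmoothVec.value (u : SmoothVec) (x : Fin 3 → ℝ) : Fin 3 → ℝ := fun m => (u m).1 x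

/-- Partial derivatives of smooth functions. -/
def smoothD (i : Fin 3) : SmoothScalar →ₗ[ℝ] SmoothScalar where
  toFun u := ⟨fun x => fderiv ℝ u.1 x (Pi.single i 1), by
    have h : ContDiff ℝ ∞ u.1 := u.2
    exact (h.fderiv_right (m := ∞) (by simp)).clm_apply contDiff_const⟩
  map_add' u v := by
    have hu : ContDiff ℝ ∞ u.1 := u.2
    have hv : ContDiff ℝ ∞ v.1 := v.2
    ext x
    have := fderiv_add (hu.differentiable (by simp) x) (hv.differentiable (by simp) x)
    simp [this]
  map_smul' a u := by
    have hu : ContDiff ℝ ∞ u.1 := u.2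
    ext x
    have := fderiv_const_smul (hu.differentiable (by simp) x) a
    simp [this]

/-- A polynomial as a smooth function. -/
def toSmooth : Poly 3 →ₗ[ℝ] SmoothScalar where
  toFun p := ⟨fun x => MvPolynomial.eval x p,
    show ContDiff ℝ ∞ fun x => MvPolynomial.eval x p from
      (AnalyticOnNhd.eval_mvPolynomial p).contDiff⟩
  map_add' p q := by ext x; simp
  map_smul' a p := by ext x; simp

/-- A polynomial vector field as a smooth vector field. -/
def toSmoothVec : PolyVec 3 →ₗ[ℝ] SmoothVec := LinearMap.pi fun m => toSmooth ∘ₗ LinearMap.proj m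

/-- Commuting diagrams for `S` on the reference tetrahedron: linear projections from smooth fields
onto the spaces of `S` which commute with the differential operators and are compatible with
traces. The latter means that the trace of the projected field on the tetrahedron itself, on
a face, on an edge or at a vertex depends only on the corresponding trace of the field, so that the
projections induce projections of the trace sequences on all faces, edges and vertices. (For the
tetrahedron itself this says that the projections are defined on the fields that are smooth on the
closed tetrahedron; at a vertex the induced projection of `ℝ` onto `ℝ` is the identity.) -/
structure IsCommutingDiagram (S : Seq3) (c : ∀ i, FaceChart i)
    (piH : SmoothScalar →ₗ[ℝ] S.H) (piE : SmoothVec →ₗ[ℝ] S.E)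
    (piV : SmoothVec →ₗ[ℝ] S.V) (piW : SmoothScalar →ₗ[ℝ] S.W) : Prop where
  projH : ∀ p : S.H, piH (toSmooth p) = p
  projE : ∀ p : S.E, piE (toSmoothVec p) = p
  projV : ∀ p : S.V, piV (toSmoothVec p) = p
  projW : ∀ p : S.W, piW (toSmooth p) = p
  comm_grad : ∀ u, grad 3 (piH u) = piE (gradOf smoothD u)
  comm_curl : ∀ u, curl3 (piE u) = piV (curl3Of smoothD u)
  comm_div : ∀ u, div3 (piV u) = piW (div3Of smoothD u)
  cellH : ∀ u : SmoothScalar, (∀ x ∈ refTet, u.1 x = 0) → piH u = 0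
  cellE : ∀ u : SmoothVec, (∀ x ∈ refTet, u.value x = 0) → piE u = 0
  cellV : ∀ u : SmoothVec, (∀ x ∈ refTet, u.value x = 0) → piV u = 0
  cellW : ∀ u : SmoothScalar, (∀ x ∈ refTet, u.1 x = 0) → piW u = 0
  faceH : ∀ i, ∀ u : SmoothScalar, (∀ x ∈ face i, u.1 x = 0) → (c i).trH (piH u) = 0
  faceE : ∀ i, ∀ u : SmoothVec, (∀ x ∈ face i, (c i).n ⨯₃ (u.value x ⨯₃ (c i).n) = 0) →
    (c i).trE (piE u) = 0
  faceV : ∀ i, ∀ u : SmoothVec, (∀ x ∈ face i, u.value x ⬝ᵥ (c i).n = 0) → (c i).trV (piV u) = 0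
  edgeH : ∀ e : Edge, ∀ u : SmoothScalar, (∀ x ∈ segment ℝ e.p e.q, u.1 x = 0) →
    edgeTrH e.p e.q (piH u) = 0
  edgeE : ∀ e : Edge, ∀ u : SmoothVec, (∀ x ∈ segment ℝ e.p e.q, u.value x ⬝ᵥ edgeDir e.p e.q = 0) →
    edgeTrE e.p e.q (piE u) = 0
  vertexH : ∀ v : Fin 4, ∀ u : SmoothScalar,
    MvPolynomial.eval (vertex v) (piH u : Poly 3) = u.1 (vertex v)

/-- The sequence `S` admits a commuting diagram. -/
def AdmitsCommutingDiagram (S : Seq3) (c : ∀ i, FaceChart i) : Prop :=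
  ∃ piH piE piV piW, IsCommutingDiagram S c piH piE piV piW

/-! ### The sequences -/

/-- `𝓟_{k+2} → 𝓟_{k+1}² → 𝓟_k` on a triangle. -/
def S1tri (k : ℕ) : Seq2 where
  H := P 2 (k + 2)
  E := PVec 2 (k + 1)
  W := P 2 k

/-- `𝓟_{k+1} → 𝓟_k² ⊕ x × 𝓟̃_k → 𝓟_k` on a triangle. -/
def S2tri (k : ℕ) : Seq2 where
  H := P 2 (k + 1)
  E := PVec 2 k ⊔ (Phom 2 k).map xCross2
  W := P 2 k

/-- `𝓟_{k+3} → 𝓟_{k+2}³ → 𝓟_{k+1}³ → 𝓟_k` on the tetrahedron. -/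
def S1tet (k : ℕ) : Seq3 where
  H := P 3 (k + 3)
  E := PVec 3 (k + 2)
  V := PVec 3 (k + 1)
  W := P 3 k

/-- `𝓟_{k+1} → 𝓟_k³ ⊕ x × 𝓟̃_k³ → 𝓟_k³ ⊕ x 𝓟̃_k → 𝓟_k` on the tetrahedron. -/
def S2tet (k : ℕ) : Seq3 where
  H := P 3 (k + 1)
  E := PVec 3 k ⊔ (PhomVec 3 k).map xCross3
  V := PVec 3 k ⊔ (Phom 3 k).map xMul3
  W := P 3 k

end FES

end

noncomputable section

namespace FES

open MvPolynomial

/-! ### Degrees -/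

/-! Exactness is the Poincaré lemma with explicit homotopies. The potentials `x · ∫₀¹ v(tx) dt`, `-x
× ∫₀¹ t v(tx) dt` and `x ∫₀¹ t² f(tx) dt` make sense for polynomials: the integrals divide the part
of degree `n` by `n + 1`, `n + 2`, `n + 3` (`eulerInv`). A potential raises the degree by at most
one, which settles `S₁`. For `S₂` the direct sums are replaced by degree conditions: `E` consists of
the fields of degree at most `k + 1` for which `x · v` also has degree at most `k + 1`, and `V` of
those for which `x × v` has (`mem_nedelec3`, `mem_raviartThomas`). The potentials respect these
conditions, and the conditions do not depend on the origin, which is what identifies the face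
traces.

Compatibility is a dimension count. Scalar traces split into vertex values, edge bubbles and face
bubbles, because bubbles factor through barycentric coordinates and therefore extend; normal traces
extend one face at a time. For tangential traces only the upper bound is proved directly. Equality
is forced by exactness once the number of bubbles is controlled: on a face, curls of bubbles have
zero flux by Stokes, so they form a proper subspace of `W`; on the tetrahedron, divergences of
`V`-bubbles have codimension at most one in `W`. The latter comes from the fields `A ∇q` with `A =
diag(x) - x xᵗ`, which have no normal component on the boundary and whose divergence multiplies the
leading part of `q`, of degree `n`, by `-n(n + 3)` (`div3_simplexFlux_eq_zero`). The same counts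
show that the sequences of bubbles are exact up to the constants in the last space
(`HasExactBubbles`).

The projections interpolate degrees of freedom of two kinds: vertex values, circulations, fluxes and
the total integral; and retractions of traces onto the derivatives of bubbles. Exactness of the
bubble sequences makes them unisolvent. If the degrees of freedom of `u` vanish, so do those of its
derivative, by Stokes and because consecutive operators compose to zero; hence interpolation
commutes with the operators. Each functional sees only one trace, and those attached to a face, its
edges and its vertices determine the trace of the interpolant there; this gives locality. -/

lemma mem_P {d p : ℕ} {f : Poly d} : f ∈ P d p ↔ f.totalDegree ≤ p :=
  mem_restrictTotalDegree _ _ _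

lemma mem_PVec {d p : ℕ} {v : PolyVec d} : v ∈ PVec d p ↔ ∀ i, v i ∈ P d p := by
  simp [PVec]

lemma mem_Phom {d p : ℕ} {f : Poly d} : f ∈ Phom d p ↔ f.IsHomogeneous p :=
  mem_homogeneousSubmodule _ _

lemma mem_PhomVec {d p : ℕ} {v : PolyVec d} : v ∈ PhomVec d p ↔ ∀ i, v i ∈ Phom d p := by
  simp [PhomVec]

lemma P_mono {d p q : ℕ} (h : p ≤ q) : P d p ≤ P d q := fun _ hf =>
  mem_P.2 ((mem_P.1 hf).trans h)

lemma Phom_le_P (d p : ℕ) : Phom d p ≤ P d p := fun _ hf => mem_P.2 (mem_Phom.1 hf).totalDegree_le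

lemma mul_mem_P {d p q : ℕ} {f g : Poly d} (hf : f ∈ P d p) (hg : g ∈ P d q) :
    f * g ∈ P d (p + q) :=
  mem_P.2 ((totalDegree_mul f g).trans (add_le_add (mem_P.1 hf) (mem_P.1 hg)))

lemma C_mem_P {d : ℕ} (p : ℕ) (a : ℝ) : C a ∈ P d p := mem_P.2 (by simp)

lemma one_mem_P {d : ℕ} (p : ℕ) : (1 : Poly d) ∈ P d p := mem_P.2 (by simp)

lemma X_mem_P {d : ℕ} (i : Fin d) : (X i : Poly d) ∈ P d 1 := mem_P.2 (by simp)

lemma C_mul_mem_P {d p : ℕ} {f : Poly d} (a : ℝ) (hf : f ∈ P d p) : C a * f ∈ P d p := by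
  simpa using mul_mem_P (C_mem_P 0 a) hf

lemma X_mul_mem_P {d p : ℕ} {f : Poly d} (i : Fin d) (hf : f ∈ P d p) : X i * f ∈ P d (p + 1) := by
  simpa [add_comm] using mul_mem_P (X_mem_P i) hf

lemma mem_P_iff_support {d p : ℕ} {f : Poly d} :
    f ∈ P d p ↔ ∀ m : Fin d →₀ ℕ, p < m.degree → coeff m f = 0 := by
  rw [mem_P, totalDegree, Finset.sup_le_iff]
  refine forall_congr' fun m => ?_
  rw [mem_support_iff, ← not_imp_not, not_le, not_not]
  rfl

lemma P_le_of_monomial {d p : ℕ} {N : Submodule ℝ (Poly d)}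
    (h : ∀ m : Fin d →₀ ℕ, m.degree ≤ p → monomial m 1 ∈ N) : P d p ≤ N := by
  intro f hf
  rw [f.as_sum]
  refine N.sum_mem fun m hm => ?_
  have : monomial m (coeff m f) = coeff m f • (monomial m 1 : Poly d) := by
    simp [smul_monomial]
  rw [this]
  refine N.smul_mem _ (h m ?_)
  by_contra hlt
  exact (mem_support_iff.1 hm) (mem_P_iff_support.1 hf m (not_le.1 hlt))

lemma pderiv_mem_P {d p : ℕ} {f : Poly d} (i : Fin d) (hf : f ∈ P d (p + 1)) :
    pderiv i f ∈ P d p := by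
  rw [mem_P_iff_support] at hf ⊢
  intro m hm
  rw [coeff_pderiv, hf _ (by simp [map_add]; omega)]
  simp

lemma pderiv_mem_Phom {d p : ℕ} {f : Poly d} (i : Fin d) (hf : f ∈ Phom d (p + 1)) :
    pderiv i f ∈ Phom d p := by
  simpa using mem_Phom.2 ((mem_Phom.1 hf).pderiv (i := i))

lemma X_mul_mem_Phom {d p : ℕ} {f : Poly d} (i : Fin d) (hf : f ∈ Phom d p) :
    X i * f ∈ Phom d (p + 1) := by
  rw [mem_Phom, add_comm]
  exact (isHomogeneous_X ℝ i).mul (mem_Phom.1 hf)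

lemma P_inf_Phom {d p q : ℕ} (h : p < q) {f : Poly d} (hf : f ∈ P d p) (hf' : f ∈ Phom d q) :
    f = 0 := by
  by_contra hne
  have := (mem_Phom.1 hf').totalDegree hne
  have := mem_P.1 hf
  omega

lemma exists_split {d p : ℕ} {f : Poly d} (hf : f ∈ P d (p + 1)) :
    ∃ a ∈ P d p, ∃ b ∈ Phom d (p + 1), f = a + b := by
  refine ⟨f - homogeneousComponent (p + 1) f, ?_, homogeneousComponent (p + 1) f,
    mem_Phom.2 (homogeneousComponent_isHomogeneous _ _), by ring⟩
  rw [mem_P_iff_support] at hf ⊢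
  intro m hm
  rw [coeff_sub, coeff_homogeneousComponent]
  split_ifs with h
  · ring
  · rw [hf m (by omega)]; ring

lemma aeval_mem_P {d d' p : ℕ} {f : Fin d → Poly d'} (hf : ∀ i, f i ∈ P d' 1) {g : Poly d}
    (hg : g ∈ P d p) : aeval f g ∈ P d' p := by
  suffices P d p ≤ (P d' p).comap (aeval f : Poly d →ₐ[ℝ] Poly d').toLinearMap from this hg
  refine P_le_of_monomial fun m hm => ?_
  rw [Submodule.mem_comap, AlgHom.toLinearMap_apply, aeval_monomial]
  rw [mem_P, map_one, one_mul, Finsupp.prod]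
  refine (totalDegree_finsetProd _ _).trans (le_trans (Finset.sum_le_sum fun i _ => ?_) hm)
  refine (totalDegree_pow _ _).trans ?_
  simpa using Nat.mul_le_mul_left (m i) (mem_P.1 (hf i))

instance {d p : ℕ} : FiniteDimensional ℝ (P d p) :=
  inferInstanceAs (Module.Finite ℝ (restrictTotalDegree (Fin d) ℝ p))

/-! ### The inverse of the shifted Euler operator -/

/-- The inverse of `f ↦ ∑ x_i ∂_i f + c f`: multiplies monomials of degree `n` by `(n + c)⁻¹`. -/
def eulerInv {d : ℕ} (c : ℕ) : Poly d →ₗ[ℝ] Poly d :=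
  (basisMonomials (Fin d) ℝ).constr ℝ fun m => monomial m ((m.degree + c : ℝ)⁻¹)

lemma eulerInv_monomial {d : ℕ} (c : ℕ) (m : Fin d →₀ ℕ) (a : ℝ) :
    eulerInv c (monomial m a) = monomial m (a * (m.degree + c : ℝ)⁻¹) := by
  have h : monomial m a = a • (basisMonomials (Fin d) ℝ m) := by simp [smul_monomial]
  rw [h, map_smul, eulerInv, Module.Basis.constr_basis, smul_monomial, smul_eq_mul]

lemma coeff_eulerInv {d : ℕ} (c : ℕ) (m : Fin d →₀ ℕ) (f : Poly d) :
    coeff m (eulerInv c f) = coeff m f * (m.degree + c : ℝ)⁻¹ := by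
  induction f using MvPolynomial.induction_on' with
  | monomial u a =>
    rw [eulerInv_monomial, coeff_monomial, coeff_monomial]
    split_ifs with h
    · rw [h]
    · simp
  | add p q hp hq => rw [map_add, coeff_add, hp, hq, coeff_add, add_mul]

lemma eulerInv_mem_P {d c p : ℕ} {f : Poly d} (hf : f ∈ P d p) : eulerInv c f ∈ P d p := by
  rw [mem_P_iff_support] at hf ⊢
  intro m hm
  rw [coeff_eulerInv, hf m hm, zero_mul]

lemma eulerInv_mem_Phom {d c p : ℕ} {f : Poly d} (hf : f ∈ Phom d p) :
    eulerInv c f ∈ Phom d p := by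
  rw [mem_Phom] at hf ⊢
  intro m hm
  refine hf fun h => hm ?_
  rw [coeff_eulerInv, h, zero_mul]

/-- For `c > 0` the operator is `f ↦ ∫₀¹ t^(c-1) f(tx) dt`, and differentiating under the integral
produces one more factor `t`. -/
lemma pderiv_eulerInv {d : ℕ} (c : ℕ) (i : Fin d) (f : Poly d) :
    pderiv i (eulerInv c f) = eulerInv (c + 1) (pderiv i f) := by
  ext m
  rw [coeff_pderiv, coeff_eulerInv, coeff_eulerInv, coeff_pderiv]
  simp only [map_add, Finsupp.degree_single]
  push_cast
  ring

/-- Multiplication by a coordinate raises the degree by one, so the shift drops by one. The case `c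
= 0` is included: there the constant coefficient is multiplied by `0⁻¹ = 0`, but `X i * f` has none.
-/
lemma X_mul_eulerInv {d : ℕ} (c : ℕ) (i : Fin d) (f : Poly d) :
    X i * eulerInv (c + 1) f = eulerInv c (X i * f) := by
  classical
  ext m
  rw [coeff_eulerInv, coeff_X_mul', coeff_X_mul']
  split_ifs with h
  · rw [coeff_eulerInv]
    have hm : m - Finsupp.single i 1 + Finsupp.single i 1 = m := by
      refine tsub_add_cancel_of_le ?_
      rw [Finsupp.single_le_iff]
      exact Nat.one_le_iff_ne_zero.2 (Finsupp.mem_support_iff.1 h)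
    have := congrArg Finsupp.degree hm
    simp only [map_add, Finsupp.degree_single] at this
    rw [← this]
    push_cast
    ring
  · ring

/-- Euler's identity turns the operator on the left into multiplication by `n + c` in degree `n`;
positivity of `c` is needed for `n = 0`. -/
lemma eulerInv_spec {d : ℕ} (c : ℕ) (hc : 0 < c) (f : Poly d) :
    ∑ i, X i * pderiv i (eulerInv c f) + (c : Poly d) * eulerInv c f = f := by
  induction f using MvPolynomial.induction_on' with
  | monomial u a =>
    rw [eulerInv_monomial, (isHomogeneous_monomial _ rfl).sum_X_mul_pderiv]
    have h : (u.degree + c : ℝ) ≠ 0 := by positivity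
    rw [nsmul_eq_mul, ← add_mul, ← Nat.cast_add, ← map_natCast (C : ℝ →+* Poly d),
      C_mul_monomial]
    push_cast
    congr 1
    field_simp
  | add p q hp hq =>
    conv_rhs => rw [← hp, ← hq]
    simp only [map_add, mul_add, Finset.sum_add_distrib]
    ring

/-! ### The operators in coordinates -/

@[simp] lemma grad_apply {d : ℕ} (f : Poly d) (i : Fin d) : grad d f i = pderiv i f := rfl

lemma curl2_apply (v : PolyVec 2) : curl2 v = pderiv 0 (v 1) - pderiv 1 (v 0) := by
  have : curl2 v = -pderiv 1 (v 0) + pderiv 0 (v 1) := rfl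
  rw [this]; ring

lemma curl3_apply (v : PolyVec 3) : curl3 v = ![pderiv 1 (v 2) - pderiv 2 (v 1),
    pderiv 2 (v 0) - pderiv 0 (v 2), pderiv 0 (v 1) - pderiv 1 (v 0)] := by
  have h0 : curl3 v 0 = -pderiv 2 (v 1) + pderiv 1 (v 2) := rfl
  have h1 : curl3 v 1 = -pderiv 0 (v 2) + pderiv 2 (v 0) := rfl
  have h2 : curl3 v 2 = -pderiv 1 (v 0) + pderiv 0 (v 1) := rfl
  funext i
  fin_cases i <;> simp [h0, h1, h2] <;> ring

lemma div3_apply (v : PolyVec 3) :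
    div3 v = pderiv 0 (v 0) + pderiv 1 (v 1) + pderiv 2 (v 2) := by
  have : div3 v = ∑ i, partialOf polyD i i v := by simp [div3, div3Of]
  rw [this, Fin.sum_univ_three]; rfl

lemma xCross3_apply (v : PolyVec 3) : xCross3 v = ![X 1 * v 2 - X 2 * v 1,
    X 2 * v 0 - X 0 * v 2, X 0 * v 1 - X 1 * v 0] := by
  simp [xCross3, cross_apply]

@[simp] lemma xMul3_apply (f : Poly 3) (i : Fin 3) : xMul3 f i = X i * f := rfl

lemma xCross2_apply (f : Poly 2) : xCross2 f = ![X 1 * f, -(X 0 * f)] := by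
  funext i
  fin_cases i <;> rfl

lemma pderiv_comm {d : ℕ} (i j : Fin d) (f : Poly d) :
    pderiv i (pderiv j f) = pderiv j (pderiv i f) := by
  ext m
  simp only [coeff_pderiv]
  rw [add_right_comm m (Finsupp.single i 1)]
  by_cases h : i = j
  · subst h; rfl
  · simp [h, Ne.symm h]; ring

lemma curl2_grad (f : Poly 2) : curl2 (grad 2 f) = 0 := by
  rw [curl2_apply, grad_apply, grad_apply, pderiv_comm]; ring

lemma curl3_grad (f : Poly 3) : curl3 (grad 3 f) = 0 := by
  rw [curl3_apply]
  simp only [grad_apply, pderiv_comm 2 1 f, pderiv_comm 0 2 f, pderiv_comm 1 0 f, sub_self]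
  funext i; fin_cases i <;> rfl

lemma div3_curl3 (v : PolyVec 3) : div3 (curl3 v) = 0 := by
  rw [div3_apply, curl3_apply]
  simp only [Matrix.cons_val, map_sub, pderiv_comm 1 0, pderiv_comm 2 0, pderiv_comm 2 1]
  ring

lemma ker_grad_eq_constants (d : ℕ) : LinearMap.ker (grad d) = constants d := by
  ext f
  constructor
  · intro h
    have h' : ∀ i, pderiv i f = 0 := fun i => congrFun h i
    refine ⟨coeff 0 f, ?_⟩
    ext m
    rw [Algebra.linearMap_apply, algebraMap_eq, coeff_C]
    split_ifs with hm
    · rw [hm]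
    · obtain ⟨i, hi⟩ := Finsupp.ne_iff.1 (Ne.symm hm)
      have h1 : m - Finsupp.single i 1 + Finsupp.single i 1 = m := by
        refine tsub_add_cancel_of_le ?_
        rw [Finsupp.single_le_iff]
        exact Nat.one_le_iff_ne_zero.2 (by simpa using hi)
      have := congrArg (coeff (m - Finsupp.single i 1)) (h' i)
      rw [coeff_pderiv, h1, coeff_zero] at this
      rcases mul_eq_zero.1 this with h2 | h2
      · exact h2.symm
      · exfalso; norm_cast at h2
  · rintro ⟨a, rfl⟩
    funext i
    simp [algebraMap_eq]

lemma constants_le_P (d p : ℕ) : constants d ≤ P d p := by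
  rintro _ ⟨a, rfl⟩
  exact C_mem_P p a

/-! ### Potentials -/

/-- The potential is the line integral of `v` from the origin to `x`. Vanishing curl makes the
Jacobian of `v` symmetric, and the gradient becomes `(x · ∇ + 1)` applied to `eulerInv 1 (v i)`. -/
lemma grad_potential3 {v : PolyVec 3} (h : curl3 v = 0) :
    grad 3 (∑ i, X i * eulerInv 1 (v i)) = v := by
  rw [curl3_apply] at h
  have h0 : pderiv 1 (v 2) = pderiv 2 (v 1) := sub_eq_zero.1 (congrFun h 0)
  have h1 : pderiv 2 (v 0) = pderiv 0 (v 2) := sub_eq_zero.1 (congrFun h 1)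
  have h2 : pderiv 0 (v 1) = pderiv 1 (v 0) := sub_eq_zero.1 (congrFun h 2)
  have e (i : Fin 3) := eulerInv_spec 1 one_pos (v i)
  simp only [Fin.sum_univ_three, pderiv_eulerInv] at e
  funext i
  rw [grad_apply, ← e i, Fin.sum_univ_three]
  fin_cases i <;>
  · simp only [map_add, pderiv_mul, pderiv_eulerInv, pderiv_X, Fin.isValue, Pi.single_apply, h0,
      h1, h2, Fin.mk_one, Fin.zero_eta, Fin.reduceFinMk, Fin.reduceEq, if_true, if_false]
    push_cast
    ring

/-- For `u = eulerInv 2 v` one has `curl (-x × u) = (x · ∇ + 2) u - x div u`. The first term is `v`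
by `eulerInv_spec`, and `div u` is `eulerInv 3` of `div v`, hence zero. -/
lemma curl_potential3 {v : PolyVec 3} (h : div3 v = 0) :
    curl3 (-xCross3 fun i => eulerInv 2 (v i)) = v := by
  rw [div3_apply] at h
  have h' := congrArg (eulerInv 3) h
  simp only [map_add, map_zero] at h'
  have e (i : Fin 3) := eulerInv_spec 2 two_pos (v i)
  simp only [Fin.sum_univ_three, pderiv_eulerInv] at e
  funext i
  rw [← e i, curl3_apply, xCross3_apply]
  fin_cases i <;>
  simp only [map_neg, map_sub, pderiv_mul, pderiv_eulerInv, pderiv_X, Fin.isValue,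
      Pi.single_apply, Matrix.cons_val, Pi.neg_apply,
      Fin.mk_one, Fin.zero_eta, Fin.reduceFinMk, Fin.reduceEq, if_true, if_false] <;>
  push_cast
  · linear_combination (-X 0) * h'
  · linear_combination (-X 1) * h'
  · linear_combination (-X 2) * h'

/-- The shift `3` is the dimension: `div (x g) = (x · ∇ + 3) g`. -/
lemma div_potential3 (f : Poly 3) : div3 (xMul3 (eulerInv 3 f)) = f := by
  have e := eulerInv_spec 3 three_pos f
  conv_rhs => rw [← e]
  rw [div3_apply, Fin.sum_univ_three]
  simp only [xMul3_apply, pderiv_mul, pderiv_X_self]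
  push_cast
  ring

lemma grad_potential2 {v : PolyVec 2} (h : curl2 v = 0) :
    grad 2 (∑ i, X i * eulerInv 1 (v i)) = v := by
  rw [curl2_apply] at h
  have h2 : pderiv 0 (v 1) = pderiv 1 (v 0) := sub_eq_zero.1 h
  have e (i : Fin 2) := eulerInv_spec 1 one_pos (v i)
  simp only [Fin.sum_univ_two, pderiv_eulerInv] at e
  funext i
  rw [grad_apply, ← e i, Fin.sum_univ_two]
  fin_cases i <;>
  · simp only [map_add, pderiv_mul, pderiv_eulerInv, pderiv_X, Fin.isValue, Pi.single_apply,
      h2, Fin.mk_one, Fin.zero_eta, Fin.reduceEq, if_true, if_false]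
    push_cast
    ring

lemma curl_potential2 (f : Poly 2) : curl2 (-xCross2 (eulerInv 2 f)) = f := by
  have e := eulerInv_spec 2 two_pos f
  conv_rhs => rw [← e]
  rw [curl2_apply, xCross2_apply, Fin.sum_univ_two]
  simp
  ring

/-! ### First kind spaces -/

/-- `𝓟_p³ ⊕ x × 𝓟̃_p³` consists of the fields of degree `p + 1` such that `x · v` has
degree `p + 1`. -/
lemma mem_nedelec3 {p : ℕ} {v : PolyVec 3} :
    v ∈ PVec 3 p ⊔ (PhomVec 3 p).map xCross3 ↔
      v ∈ PVec 3 (p + 1) ∧ ∑ i, X i * v i ∈ P 3 (p + 1) := by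
  constructor
  · intro h
    obtain ⟨a, ha, _, ⟨b, hb, rfl⟩, rfl⟩ := Submodule.mem_sup.1 h
    rw [mem_PVec] at ha
    have hb' := mem_PhomVec.1 hb
    have hX (i j : Fin 3) : X i * b j ∈ P 3 (p + 1) := X_mul_mem_P i (Phom_le_P _ _ (hb' j))
    constructor
    · rw [mem_PVec]
      intro i
      refine Submodule.add_mem _ (P_mono p.le_succ (ha i)) ?_
      rw [xCross3_apply]
      fin_cases i <;> exact Submodule.sub_mem _ (hX _ _) (hX _ _)
    · have : ∑ i, X i * (a + xCross3 b) i = ∑ i, X i * a i := by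
        rw [xCross3_apply, Fin.sum_univ_three, Fin.sum_univ_three]
        simp
        ring
      rw [this]
      exact Submodule.sum_mem _ fun i _ => X_mul_mem_P i (ha i)
  · rintro ⟨hv, hx⟩
    rw [mem_PVec] at hv
    -- Only the part `w` of degree `p + 1` matters. The product `x · w` would be the part of degree
    -- `p + 2` of `x · v`, so it vanishes.
    choose a ha w hw hvw using fun i => exists_split (hv i)
    have hxw : ∑ i, X i * w i = 0 := by
      refine P_inf_Phom (Nat.lt_succ_self (p + 1)) ?_
        (Submodule.sum_mem _ fun i _ => X_mul_mem_Phom i (hw i))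
      have : ∑ i, X i * w i = ∑ i, X i * v i - ∑ i, X i * a i := by
        rw [← Finset.sum_sub_distrib]
        refine Finset.sum_congr rfl fun i _ => ?_
        rw [hvw]; ring
      rw [this]
      exact Submodule.sub_mem _ hx (Submodule.sum_mem _ fun i _ => X_mul_mem_P i (ha i))
    set u : PolyVec 3 := fun i => eulerInv 1 (w i) with hu
    have hu' : ∀ i, u i ∈ Phom 3 (p + 1) := fun i => eulerInv_mem_Phom (hw i)
    -- Orthogonality to `x` survives the rescaling, since `x · w` is homogeneous. It enters through
    -- `x × curl u = ∇(x · u) - (x · ∇ + 1) u`, whose right side is then `-w`.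
    have hxu : X 0 * u 0 + X 1 * u 1 + X 2 * u 2 = 0 := by
      have := congrArg (eulerInv 0) hxw
      simpa only [Fin.sum_univ_three, map_add, map_zero, ← X_mul_eulerInv] using this
    have hb : -curl3 u ∈ PhomVec 3 p := by
      refine Submodule.neg_mem _ (mem_PhomVec.2 fun i => ?_)
      rw [curl3_apply]
      fin_cases i <;>
        exact Submodule.sub_mem _ (pderiv_mem_Phom _ (hu' _)) (pderiv_mem_Phom _ (hu' _))
    have hw' : w = xCross3 (-curl3 u) := by
      funext i
      have e := eulerInv_spec 1 one_pos (w i)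
      have hd := congrArg (pderiv i) hxu
      rw [← e, Fin.sum_univ_three, xCross3_apply, curl3_apply]
      fin_cases i <;>
      · simp only [map_add, pderiv_mul, pderiv_X, Fin.isValue, Pi.single_apply,
          Fin.mk_one, Fin.zero_eta, Fin.reduceFinMk, Fin.reduceEq, if_true, if_false, map_zero,
          Matrix.cons_val, Pi.neg_apply] at hd ⊢
        push_cast
        linear_combination hd
    refine Submodule.mem_sup.2 ⟨a, mem_PVec.2 ha, w, ⟨_, hb, hw'.symm⟩, ?_⟩
    funext i
    exact (hvw i).symm

/-- `𝓟_p³ ⊕ x 𝓟̃_p` consists of the fields of degree `p + 1` such that `x × v` has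
degree `p + 1`. -/
lemma mem_raviartThomas {p : ℕ} {v : PolyVec 3} :
    v ∈ PVec 3 p ⊔ (Phom 3 p).map xMul3 ↔
      v ∈ PVec 3 (p + 1) ∧ ∀ i j, X i * v j - X j * v i ∈ P 3 (p + 1) := by
  constructor
  · intro h
    obtain ⟨a, ha, _, ⟨b, hb, rfl⟩, rfl⟩ := Submodule.mem_sup.1 h
    rw [mem_PVec] at ha
    have hb' := Phom_le_P _ _ hb
    constructor
    · rw [mem_PVec]
      intro i
      exact Submodule.add_mem _ (P_mono p.le_succ (ha i)) (X_mul_mem_P i hb')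
    · intro i j
      have : X i * (a + xMul3 b) j - X j * (a + xMul3 b) i = X i * a j - X j * a i := by
        simp only [Pi.add_apply, xMul3_apply]
        ring
      rw [this]
      exact Submodule.sub_mem _ (X_mul_mem_P _ (ha _)) (X_mul_mem_P _ (ha _))
  · rintro ⟨hv, hx⟩
    rw [mem_PVec] at hv
    choose a ha w hw hvw using fun i => exists_split (hv i)
    have hxw (i j : Fin 3) : X i * w j - X j * w i = 0 := by
      refine P_inf_Phom (Nat.lt_succ_self (p + 1)) ?_
        (Submodule.sub_mem _ (X_mul_mem_Phom i (hw j)) (X_mul_mem_Phom j (hw i)))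
      have : X i * w j - X j * w i = (X i * v j - X j * v i) - (X i * a j - X j * a i) := by
        rw [hvw, hvw]; ring
      rw [this]
      exact Submodule.sub_mem _ (hx i j)
        (Submodule.sub_mem _ (X_mul_mem_P i (ha j)) (X_mul_mem_P j (ha i)))
    -- The shift is `2` because summing `∂_j (x_j u_i - x_i u_j) = 0` over `j` gives `(x · ∇ + 2)
    -- u_i = x_i div u`.
    set u : PolyVec 3 := fun i => eulerInv 2 (w i) with hu
    have hu' : ∀ i, u i ∈ Phom 3 (p + 1) := fun i => eulerInv_mem_Phom (hw i)
    have hxu (i j : Fin 3) : X i * u j - X j * u i = 0 := by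
      have := congrArg (eulerInv 1) (hxw i j)
      simpa only [map_sub, map_zero, ← X_mul_eulerInv] using this
    have hb : div3 u ∈ Phom 3 p := by
      rw [div3_apply]
      exact Submodule.add_mem _ (Submodule.add_mem _ (pderiv_mem_Phom _ (hu' _))
        (pderiv_mem_Phom _ (hu' _))) (pderiv_mem_Phom _ (hu' _))
    have hw' : w = xMul3 (div3 u) := by
      funext i
      have e := eulerInv_spec 2 two_pos (w i)
      have h0 := congrArg (pderiv 0) (hxu 0 i)
      have h1 := congrArg (pderiv 1) (hxu 1 i)
      have h2 := congrArg (pderiv 2) (hxu 2 i)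
      rw [← e, Fin.sum_univ_three, xMul3_apply, div3_apply]
      fin_cases i <;>
      · simp only [map_sub, pderiv_mul, pderiv_X, Fin.isValue, Pi.single_apply,
          Fin.mk_one, Fin.zero_eta, Fin.reduceFinMk, Fin.reduceEq, if_true, if_false, map_zero]
          at h0 h1 h2 ⊢
        push_cast
        linear_combination h0 + h1 + h2
    refine Submodule.mem_sup.2 ⟨a, mem_PVec.2 ha, w, ⟨_, hb, hw'.symm⟩, ?_⟩
    funext i
    exact (hvw i).symm

/-- `𝓟_p² ⊕ x × 𝓟̃_p` consists of the plane fields of degree `p + 1` such that `x · v` has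
degree `p + 1`. -/
lemma mem_nedelec2 {p : ℕ} {v : PolyVec 2} :
    v ∈ PVec 2 p ⊔ (Phom 2 p).map xCross2 ↔
      v ∈ PVec 2 (p + 1) ∧ ∑ i, X i * v i ∈ P 2 (p + 1) := by
  constructor
  · intro h
    obtain ⟨a, ha, _, ⟨b, hb, rfl⟩, rfl⟩ := Submodule.mem_sup.1 h
    rw [mem_PVec] at ha
    have hX (i : Fin 2) : X i * b ∈ P 2 (p + 1) := X_mul_mem_P i (Phom_le_P _ _ hb)
    constructor
    · rw [mem_PVec]
      intro i
      refine Submodule.add_mem _ (P_mono p.le_succ (ha i)) ?_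
      rw [xCross2_apply]
      fin_cases i
      · exact hX 1
      · exact Submodule.neg_mem _ (hX 0)
    · have : ∑ i, X i * (a + xCross2 b) i = ∑ i, X i * a i := by
        rw [xCross2_apply, Fin.sum_univ_two, Fin.sum_univ_two]
        simp
        ring
      rw [this]
      exact Submodule.sum_mem _ fun i _ => X_mul_mem_P i (ha i)
  · rintro ⟨hv, hx⟩
    rw [mem_PVec] at hv
    choose a ha w hw hvw using fun i => exists_split (hv i)
    have hxw : ∑ i, X i * w i = 0 := by
      refine P_inf_Phom (Nat.lt_succ_self (p + 1)) ?_
        (Submodule.sum_mem _ fun i _ => X_mul_mem_Phom i (hw i))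
      have : ∑ i, X i * w i = ∑ i, X i * v i - ∑ i, X i * a i := by
        rw [← Finset.sum_sub_distrib]
        refine Finset.sum_congr rfl fun i _ => ?_
        rw [hvw]; ring
      rw [this]
      exact Submodule.sub_mem _ hx (Submodule.sum_mem _ fun i _ => X_mul_mem_P i (ha i))
    set u : PolyVec 2 := fun i => eulerInv 1 (w i) with hu
    have hu' : ∀ i, u i ∈ Phom 2 (p + 1) := fun i => eulerInv_mem_Phom (hw i)
    have hxu : X 0 * u 0 + X 1 * u 1 = 0 := by
      have := congrArg (eulerInv 0) hxw
      simpa only [Fin.sum_univ_two, map_add, map_zero, ← X_mul_eulerInv] using this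
    have hb : -curl2 u ∈ Phom 2 p := by
      rw [curl2_apply]
      exact Submodule.neg_mem _
        (Submodule.sub_mem _ (pderiv_mem_Phom _ (hu' _)) (pderiv_mem_Phom _ (hu' _)))
    have hw' : w = xCross2 (-curl2 u) := by
      funext i
      have e := eulerInv_spec 1 one_pos (w i)
      have hd := congrArg (pderiv i) hxu
      rw [← e, Fin.sum_univ_two, xCross2_apply, curl2_apply]
      fin_cases i <;>
      · simp only [map_add, pderiv_mul, pderiv_X, Fin.isValue, Pi.single_apply,
          Fin.mk_one, Fin.zero_eta, Fin.reduceEq, if_true, if_false, map_zero,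
          Matrix.cons_val] at hd ⊢
        push_cast
        linear_combination hd
    refine Submodule.mem_sup.2 ⟨a, mem_PVec.2 ha, w, ⟨_, hb, hw'.symm⟩, ?_⟩
    funext i
    exact (hvw i).symm

end FES

namespace FES

open MvPolynomial

/-! ### Exactness -/

lemma disjoint_of_degrees {d p : ℕ} {M : Type*} [AddCommGroup M] [Module ℝ M]
    {N : Submodule ℝ M} {f : M →ₗ[ℝ] PolyVec d}
    (hf : ∀ q ∈ N, f q ∈ PhomVec d (p + 1)) : Disjoint (PVec d p) (N.map f) := by
  rw [Submodule.disjoint_def]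
  rintro _ hv ⟨q, hq, rfl⟩
  funext i
  exact P_inf_Phom p.lt_succ_self (mem_PVec.1 hv i) (mem_PhomVec.1 (hf q hq) i)

lemma xCross3_mem_PhomVec {p : ℕ} {v : PolyVec 3} (hv : v ∈ PhomVec 3 p) :
    xCross3 v ∈ PhomVec 3 (p + 1) := by
  rw [mem_PhomVec] at hv ⊢
  intro i
  rw [xCross3_apply]
  fin_cases i <;> exact Submodule.sub_mem _ (X_mul_mem_Phom _ (hv _)) (X_mul_mem_Phom _ (hv _))

lemma xMul3_mem_PhomVec {p : ℕ} {f : Poly 3} (hf : f ∈ Phom 3 p) :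
    xMul3 f ∈ PhomVec 3 (p + 1) :=
  mem_PhomVec.2 fun i => X_mul_mem_Phom i hf

lemma xCross2_mem_PhomVec {p : ℕ} {f : Poly 2} (hf : f ∈ Phom 2 p) :
    xCross2 f ∈ PhomVec 2 (p + 1) := by
  rw [mem_PhomVec]
  intro i
  rw [xCross2_apply]
  fin_cases i
  · exact X_mul_mem_Phom _ hf
  · exact Submodule.neg_mem _ (X_mul_mem_Phom _ hf)

lemma grad_mem_PVec {d p : ℕ} {f : Poly d} (hf : f ∈ P d (p + 1)) : grad d f ∈ PVec d p :=
  mem_PVec.2 fun i => pderiv_mem_P i hf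

lemma curl3_mem_PVec {p : ℕ} {v : PolyVec 3} (hv : v ∈ PVec 3 (p + 1)) :
    curl3 v ∈ PVec 3 p := by
  rw [mem_PVec] at hv ⊢
  intro i
  rw [curl3_apply]
  fin_cases i <;> exact Submodule.sub_mem _ (pderiv_mem_P _ (hv _)) (pderiv_mem_P _ (hv _))

lemma div3_mem_P {p : ℕ} {v : PolyVec 3} (hv : v ∈ PVec 3 (p + 1)) : div3 v ∈ P 3 p := by
  rw [mem_PVec] at hv
  rw [div3_apply]
  exact Submodule.add_mem _ (Submodule.add_mem _ (pderiv_mem_P _ (hv _)) (pderiv_mem_P _ (hv _)))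
    (pderiv_mem_P _ (hv _))

lemma curl2_mem_P {p : ℕ} {v : PolyVec 2} (hv : v ∈ PVec 2 (p + 1)) : curl2 v ∈ P 2 p := by
  rw [mem_PVec] at hv
  rw [curl2_apply]
  exact Submodule.sub_mem _ (pderiv_mem_P _ (hv _)) (pderiv_mem_P _ (hv _))

lemma eulerInv_comp_mem_PVec {d c p : ℕ} {v : PolyVec d} (hv : v ∈ PVec d p) :
    (fun i => eulerInv c (v i)) ∈ PVec d p :=
  mem_PVec.2 fun i => eulerInv_mem_P (mem_PVec.1 hv i)

lemma eulerInv_dot {d p c : ℕ} {v : PolyVec d} (hx : ∑ i, X i * v i ∈ P d p) :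
    ∑ i, X i * eulerInv (c + 1) (v i) ∈ P d p := by
  simp_rw [X_mul_eulerInv, ← map_sum]
  exact eulerInv_mem_P hx

lemma PVec_dot {d p : ℕ} {v : PolyVec d} (hv : v ∈ PVec d p) : ∑ i, X i * v i ∈ P d (p + 1) :=
  Submodule.sum_mem _ fun i _ => X_mul_mem_P i (mem_PVec.1 hv i)

lemma PVec_cross {p : ℕ} {v : PolyVec 3} (hv : v ∈ PVec 3 p) : xCross3 v ∈ PVec 3 (p + 1) := by
  rw [mem_PVec] at hv ⊢
  intro i
  rw [xCross3_apply]
  fin_cases i <;> exact Submodule.sub_mem _ (X_mul_mem_P _ (hv _)) (X_mul_mem_P _ (hv _))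

lemma x_dot_xCross3 (v : PolyVec 3) : ∑ i, X i * xCross3 v i = 0 := by
  rw [xCross3_apply, Fin.sum_univ_three]
  simp
  ring

/-- Each operator lowers the degree by one and each explicit potential raises it by one, so the
potentials never leave the sequence. -/
theorem S1tet_isExact (k : ℕ) : (S1tet k).IsExact where
  ker_grad := by
    rw [ker_grad_eq_constants]
    exact (inf_eq_right.2 (constants_le_P 3 _)).symm
  range_grad := by
    ext v
    constructor
    · rintro ⟨f, hf, rfl⟩
      exact ⟨grad_mem_PVec hf, curl3_grad f⟩
    · rintro ⟨hv, hc⟩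
      exact ⟨_, PVec_dot (eulerInv_comp_mem_PVec hv), grad_potential3 hc⟩
  range_curl := by
    ext v
    constructor
    · rintro ⟨f, hf, rfl⟩
      exact ⟨curl3_mem_PVec hf, div3_curl3 f⟩
    · rintro ⟨hv, hc⟩
      exact ⟨_, Submodule.neg_mem _ (PVec_cross (eulerInv_comp_mem_PVec hv)), curl_potential3 hc⟩
  range_div := by
    ext f
    constructor
    · rintro ⟨v, hv, rfl⟩
      exact div3_mem_P hv
    · intro hf
      exact ⟨_, mem_PVec.2 fun i => X_mul_mem_P i (eulerInv_mem_P hf), div_potential3 f⟩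

/-- The degree conditions are exactly what the potentials need. For `v` in `E` the potential is a
rescaling of `x · v`, of degree `k + 1` instead of `k + 2`; for `v` in `V` it is a rescaling of `x ×
v`, again of degree `k + 1`, and it is orthogonal to `x`. -/
theorem S2tet_isExact (k : ℕ) : (S2tet k).IsExact where
  ker_grad := by
    rw [ker_grad_eq_constants]
    exact (inf_eq_right.2 (constants_le_P 3 _)).symm
  range_grad := by
    ext v
    constructor
    · rintro ⟨f, hf, rfl⟩
      exact ⟨Submodule.mem_sup_left (grad_mem_PVec hf), curl3_grad f⟩
    · rintro ⟨hv, hc⟩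
      exact ⟨_, eulerInv_dot (mem_nedelec3.1 hv).2, grad_potential3 hc⟩
  range_curl := by
    ext v
    constructor
    · rintro ⟨f, hf, rfl⟩
      exact ⟨Submodule.mem_sup_left (curl3_mem_PVec (mem_nedelec3.1 hf).1), div3_curl3 f⟩
    · rintro ⟨hv, hc⟩
      obtain ⟨hv, hx⟩ := mem_raviartThomas.1 hv
      refine ⟨_, mem_nedelec3.2 ⟨mem_PVec.2 fun i => Submodule.neg_mem _ ?_, ?_⟩,
        curl_potential3 hc⟩
      · have (i j : Fin 3) : X i * eulerInv 2 (v j) - X j * eulerInv 2 (v i) ∈ P 3 (k + 1) := by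
          simp_rw [X_mul_eulerInv, ← map_sub]
          exact eulerInv_mem_P (hx i j)
        rw [xCross3_apply]
        fin_cases i <;> exact this _ _
      · simp_rw [mul_neg, Finset.sum_neg_distrib]
        rw [x_dot_xCross3, neg_zero]
        exact Submodule.zero_mem _
  range_div := by
    ext f
    constructor
    · rintro ⟨v, hv, rfl⟩
      exact div3_mem_P (mem_raviartThomas.1 hv).1
    · intro hf
      refine ⟨_, mem_raviartThomas.2 ⟨mem_PVec.2 fun i => X_mul_mem_P i (eulerInv_mem_P hf),
        fun i j => ?_⟩, div_potential3 f⟩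
      rw [mul_left_comm, sub_self]
      exact Submodule.zero_mem _

theorem S1tri_isExact (k : ℕ) : (S1tri k).IsExact where
  ker_grad := by
    rw [ker_grad_eq_constants]
    exact (inf_eq_right.2 (constants_le_P 2 _)).symm
  range_grad := by
    ext v
    constructor
    · rintro ⟨f, hf, rfl⟩
      exact ⟨grad_mem_PVec hf, curl2_grad f⟩
    · rintro ⟨hv, hc⟩
      exact ⟨_, PVec_dot (eulerInv_comp_mem_PVec hv), grad_potential2 hc⟩
  range_curl := by
    ext f
    constructor
    · rintro ⟨v, hv, rfl⟩
      exact curl2_mem_P hv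
    · intro hf
      refine ⟨_, Submodule.neg_mem _ (mem_PVec.2 fun i => ?_), curl_potential2 f⟩
      rw [xCross2_apply]
      fin_cases i
      · exact X_mul_mem_P _ (eulerInv_mem_P hf)
      · exact Submodule.neg_mem _ (X_mul_mem_P _ (eulerInv_mem_P hf))

theorem S2tri_isExact (k : ℕ) : (S2tri k).IsExact where
  ker_grad := by
    rw [ker_grad_eq_constants]
    exact (inf_eq_right.2 (constants_le_P 2 _)).symm
  range_grad := by
    ext v
    constructor
    · rintro ⟨f, hf, rfl⟩
      exact ⟨Submodule.mem_sup_left (grad_mem_PVec hf), curl2_grad f⟩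
    · rintro ⟨hv, hc⟩
      exact ⟨_, eulerInv_dot (mem_nedelec2.1 hv).2, grad_potential2 hc⟩
  range_curl := by
    ext f
    constructor
    · rintro ⟨v, hv, rfl⟩
      exact curl2_mem_P (mem_nedelec2.1 hv).1
    · intro hf
      have hX (i : Fin 2) : X i * eulerInv 2 f ∈ P 2 (k + 1) := X_mul_mem_P i (eulerInv_mem_P hf)
      refine ⟨_, Submodule.neg_mem _ (mem_nedelec2.2 ⟨mem_PVec.2 fun i => ?_, ?_⟩),
        curl_potential2 f⟩
      · rw [xCross2_apply]
        fin_cases i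
        · exact hX 1
        · exact Submodule.neg_mem _ (hX 0)
      · have : ∑ i, X i * xCross2 (eulerInv 2 f) i = 0 := by
          rw [xCross2_apply, Fin.sum_univ_two]
          simp
          ring
        rw [this]
        exact Submodule.zero_mem _

/-! ### Weighted diffusion on the simplex

The fields `A ∇q` with `A = diag(x) - x xᵗ` have vanishing normal trace on the boundary of the
reference tetrahedron, and their divergence determines `q` up to constants. -/

/-- The field `A ∇q` with `A = diag(x) - x xᵗ`. -/
def simplexFlux : Poly 3 →ₗ[ℝ] PolyVec 3 where
  toFun q i := X i * pderiv i q - X i * ∑ j, X j * pderiv j q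
  map_add' p q := by
    funext i
    simp only [map_add, mul_add, Finset.sum_add_distrib, Pi.add_apply]
    ring
  map_smul' a q := by
    funext i
    simp only [Derivation.map_smul, mul_smul_comm, ← Finset.smul_sum, ← smul_sub, Pi.smul_apply,
      RingHom.id_apply]

lemma simplexFlux_apply (q : Poly 3) (i : Fin 3) :
    simplexFlux q i = X i * pderiv i q - X i * ∑ j, X j * pderiv j q := rfl

lemma X_mul_pderiv_mem_P {d p : ℕ} {q : Poly d} (i : Fin d) (hq : q ∈ P d p) :
    X i * pderiv i q ∈ P d p := by
  rw [mem_P_iff_support] at hq ⊢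
  classical
  intro m hm
  rw [coeff_X_mul']
  split_ifs with h
  · rw [coeff_pderiv]
    have h1 : m - Finsupp.single i 1 + Finsupp.single i 1 = m := by
      refine tsub_add_cancel_of_le ?_
      rw [Finsupp.single_le_iff]
      exact Nat.one_le_iff_ne_zero.2 (Finsupp.mem_support_iff.1 h)
    rw [h1, hq m hm, zero_mul]
  · rfl

/-- The only part of degree `p + 1` comes from `-x (x · ∇q)`, which is parallel to `x` and cancels
in `x × v`. -/
lemma simplexFlux_mem {p : ℕ} {q : Poly 3} (hq : q ∈ P 3 p) :
    simplexFlux q ∈ PVec 3 p ⊔ (Phom 3 p).map xMul3 := by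
  have hE : ∑ j, X j * pderiv j q ∈ P 3 p :=
    Submodule.sum_mem _ fun j _ => X_mul_pderiv_mem_P j hq
  refine mem_raviartThomas.2 ⟨mem_PVec.2 fun i => Submodule.sub_mem _
    (P_mono p.le_succ (X_mul_pderiv_mem_P i hq)) (X_mul_mem_P i hE), fun i j => ?_⟩
  have : X i * simplexFlux q j - X j * simplexFlux q i =
      X i * (X j * pderiv j q) - X j * (X i * pderiv i q) := by
    simp only [simplexFlux_apply]
    ring
  rw [this]
  exact Submodule.sub_mem _ (X_mul_mem_P _ (X_mul_pderiv_mem_P _ hq))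
    (X_mul_mem_P _ (X_mul_pderiv_mem_P _ hq))

lemma euler_eq_coeff {d : ℕ} (q : Poly d) (m : Fin d →₀ ℕ) :
    coeff m (∑ j, X j * pderiv j q) = m.degree * coeff m q := by
  classical
  induction q using MvPolynomial.induction_on' with
  | monomial u a =>
    rw [(isHomogeneous_monomial a rfl).sum_X_mul_pderiv, nsmul_eq_mul,
      ← map_natCast (C : ℝ →+* Poly d), coeff_C_mul, coeff_monomial]
    split_ifs with h
    · rw [h]
    · simp
  | add p q hp hq =>
    simp only [map_add, mul_add, Finset.sum_add_distrib, coeff_add] at *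
    rw [hp, hq]

lemma div3_simplexFlux (q : Poly 3) :
    div3 (simplexFlux q) = ∑ i, pderiv i (X i * pderiv i q) -
      (∑ i, X i * pderiv i (∑ j, X j * pderiv j q) + C 3 * ∑ j, X j * pderiv j q) := by
  rw [div3_apply]
  simp only [simplexFlux_apply, map_sub, Fin.sum_univ_three]
  have : (C 3 : Poly 3) = 3 := map_ofNat C 3
  rw [this]
  generalize X 0 * pderiv 0 q + X 1 * pderiv 1 q + X 2 * pderiv 2 q = g
  simp only [pderiv_mul (f := X _) (g := g), pderiv_X_self]
  ring

/-- The degree is lowered step by step. On a monomial of degree `n + 1`, the top degree of `q`, the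
term `∑ ∂_i (x_i ∂_i q)` does not contribute and the rest is multiplication by `-((n + 1)² + 3 (n +
1)) = -(n + 1)(n + 4) ≠ 0`. -/
lemma div3_simplexFlux_eq_zero {q : Poly 3} (h : div3 (simplexFlux q) = 0) :
    q ∈ constants 3 := by
  have key : ∀ n, q ∈ P 3 n → q ∈ P 3 0 := by
    intro n
    induction n with
    | zero => exact id
    | succ n ih =>
      intro hq
      refine ih ?_
      rw [mem_P_iff_support]
      intro m hm
      by_cases hm' : n + 1 < m.degree
      · exact mem_P_iff_support.1 hq m hm'
      have hmn : m.degree = n + 1 := by omega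
      have hc := congrArg (coeff m) h
      have h1 : ∑ i, pderiv i (X i * pderiv i q) ∈ P 3 n :=
        Submodule.sum_mem _ fun i _ => pderiv_mem_P i (X_mul_pderiv_mem_P i hq)
      rw [div3_simplexFlux, coeff_sub, mem_P_iff_support.1 h1 m hm, coeff_add, coeff_C_mul,
        euler_eq_coeff, euler_eq_coeff, coeff_zero, hmn] at hc
      have h2 : ((n : ℝ) + 1) * (n + 4) * coeff m q = 0 := by
        push_cast at hc
        linear_combination -hc
      rcases mul_eq_zero.1 h2 with h3 | h3
      · exact absurd h3 (by positivity)
      · exact h3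
  have h0 := key q.totalDegree (mem_P.2 le_rfl)
  rw [mem_P, Nat.le_zero, totalDegree_eq_zero_iff_eq_C] at h0
  exact ⟨_, h0.symm⟩

end FES

namespace FES

open MvPolynomial

/-! ### Edge traces -/

/-- Polynomials in one variable of degree at most `r`. -/
def P1 (r : ℕ) : Submodule ℝ (Polynomial ℝ) := Polynomial.degreeLE ℝ r

lemma mem_P1 {r : ℕ} {f : Polynomial ℝ} : f ∈ P1 r ↔ f.natDegree ≤ r := by
  rw [P1, Polynomial.mem_degreeLE, Polynomial.natDegree_le_iff_degree_le]

section Edge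

variable {d : ℕ} (p q : Fin d → ℝ)

/-- The trace on an edge as a homomorphism of algebras. -/
def edgeAlg : Poly d →ₐ[ℝ] Polynomial ℝ :=
  MvPolynomial.aeval fun i =>
    Polynomial.C (p i) + Polynomial.C (edgeDir p q i) * Polynomial.X

lemma edgeTrH_apply (f : Poly d) : edgeTrH p q f = edgeAlg p q f := rfl

lemma edgeTrE_apply (v : PolyVec d) :
    edgeTrE p q v = ∑ i, Polynomial.C (edgeDir p q i) * edgeAlg p q (v i) := by
  simp [edgeTrE, edgeTrH_apply, Polynomial.smul_eq_C_mul]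

lemma edgeAlg_X (i : Fin d) : edgeAlg p q (X i) =
    Polynomial.C (p i) + Polynomial.C (edgeDir p q i) * Polynomial.X := by
  simp [edgeAlg]

lemma edgeAlg_C (a : ℝ) : edgeAlg p q (C a) = Polynomial.C a := by
  simp [edgeAlg]

lemma eval_edgeTrH (s : ℝ) (f : Poly d) :
    (edgeTrH p q f).eval s = eval (p + s • edgeDir p q) f := by
  rw [edgeTrH_apply]
  induction f using MvPolynomial.induction_on with
  | C a => simp
  | add f g hf hg => simp [hf, hg]
  | mul_X f i hf =>
    rw [map_mul, Polynomial.eval_mul, hf, map_mul, eval_X, edgeAlg_X]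
    simp only [Polynomial.eval_add, Polynomial.eval_C, Polynomial.eval_mul, Polynomial.eval_X,
      Pi.add_apply, Pi.smul_apply, smul_eq_mul]
    ring

lemma eval_edgeTrE (s : ℝ) (v : PolyVec d) :
    (edgeTrE p q v).eval s = (fun i => eval (p + s • edgeDir p q) (v i)) ⬝ᵥ edgeDir p q := by
  simp only [edgeTrE_apply, Polynomial.eval_finsetSum, Polynomial.eval_mul, Polynomial.eval_C,
    dotProduct, ← edgeTrH_apply, eval_edgeTrH]
  exact Finset.sum_congr rfl fun i _ => mul_comm _ _

variable {p q}

lemma dotProduct_self_pos {v : Fin d → ℝ} (h : v ≠ 0) : 0 < v ⬝ᵥ v := by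
  refine lt_of_le_of_ne (Finset.sum_nonneg fun i _ => mul_self_nonneg _) fun h0 => h ?_
  exact dotProduct_self_eq_zero.1 h0.symm

lemma edgeLen_pos (h : p ≠ q) : 0 < edgeLen p q :=
  Real.sqrt_pos.2 (dotProduct_self_pos (sub_ne_zero.2 h.symm))

lemma edgeLen_mul_self (p q : Fin d → ℝ) : edgeLen p q * edgeLen p q = (q - p) ⬝ᵥ (q - p) :=
  Real.mul_self_sqrt (Finset.sum_nonneg fun _ _ => mul_self_nonneg _)

lemma edgeLen_smul_edgeDir (h : p ≠ q) : edgeLen p q • edgeDir p q = q - p := by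
  rw [edgeDir, smul_smul, mul_inv_cancel₀ (edgeLen_pos h).ne', one_smul]

lemma edgeDir_unit (h : p ≠ q) : edgeDir p q ⬝ᵥ edgeDir p q = 1 := by
  have := (edgeLen_pos h).ne'
  rw [edgeDir, smul_dotProduct, dotProduct_smul, ← edgeLen_mul_self, smul_eq_mul, smul_eq_mul]
  field_simp

lemma edge_end (h : p ≠ q) : p + edgeLen p q • edgeDir p q = q := by
  rw [edgeLen_smul_edgeDir h, add_sub_cancel]

lemma edgeLen_symm (p q : Fin d → ℝ) : edgeLen q p = edgeLen p q := by
  have : p - q = -(q - p) := by abel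
  rw [edgeLen, edgeLen, this, neg_dotProduct, dotProduct_neg, neg_neg]

lemma edgeDir_symm (p q : Fin d → ℝ) : edgeDir q p = -edgeDir p q := by
  rw [edgeDir, edgeDir, edgeLen_symm, ← smul_neg, neg_sub]

lemma bdryTrH_edgeTrH (h : p ≠ q) (f : Poly d) :
    Seq1.bdryTrH (edgeLen p q) (edgeTrH p q f) = (eval p f, eval q f) := by
  have h0 := eval_edgeTrH p q 0 f
  have h1 := eval_edgeTrH p q (edgeLen p q) f
  rw [zero_smul, add_zero] at h0
  rw [edge_end h] at h1
  rw [← h0, ← h1]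
  rfl

lemma edgeTrH_mem_P1 {r : ℕ} {f : Poly d} (hf : f ∈ P d r) : edgeTrH p q f ∈ P1 r := by
  suffices P d r ≤ (P1 r).comap (edgeTrH p q) from this hf
  refine P_le_of_monomial fun m hm => ?_
  rw [Submodule.mem_comap, mem_P1, edgeTrH_apply, edgeAlg, aeval_monomial, map_one, one_mul,
    Finsupp.prod]
  refine (Polynomial.natDegree_prod_le _ _).trans (le_trans (Finset.sum_le_sum fun i _ => ?_) hm)
  refine Polynomial.natDegree_pow_le.trans ?_
  have : (Polynomial.C (p i) + Polynomial.C (edgeDir p q i) * Polynomial.X).natDegree ≤ 1 := by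
    rw [add_comm]; exact Polynomial.natDegree_linear_le
  simpa using Nat.mul_le_mul_left (m i) this

variable (p q) in
/-- The arc length coordinate of the edge, as an affine function on the whole space. -/
def arcPoly : Poly d := ∑ i, C (edgeDir p q i) * (X i - C (p i))

variable (p q) in
/-- Extension of a polynomial on an edge to the whole space, constant on the planes normal to the
edge. -/
def edgeLift : Polynomial ℝ →ₐ[ℝ] Poly d := Polynomial.aeval (arcPoly p q)

lemma arcPoly_mem (p q : Fin d → ℝ) : arcPoly p q ∈ P d 1 :=
  Submodule.sum_mem _ fun i _ => C_mul_mem_P _ (Submodule.sub_mem _ (X_mem_P i) (C_mem_P _ _))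

lemma edgeLift_mem {r : ℕ} {g : Polynomial ℝ} (hg : g ∈ P1 r) : edgeLift p q g ∈ P d r := by
  rw [edgeLift, Polynomial.aeval_eq_sum_range]
  refine Submodule.sum_mem _ fun i hi => Submodule.smul_mem _ _ (mem_P.2 ?_)
  refine (totalDegree_pow _ _).trans ?_
  have h1 := mem_P.1 (arcPoly_mem p q)
  have h2 := mem_P1.1 hg
  have h3 := Finset.mem_range.1 hi
  nlinarith

lemma edgeAlg_arcPoly (h : p ≠ q) : edgeAlg p q (arcPoly p q) = Polynomial.X := by
  simp only [arcPoly, map_sum, map_mul (edgeAlg p q), map_sub, edgeAlg_C, edgeAlg_X, add_sub_cancel_left,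
    ← mul_assoc, ← Polynomial.C_mul]
  rw [← Finset.sum_mul, ← map_sum]
  have := edgeDir_unit h
  rw [dotProduct] at this
  rw [this, Polynomial.C_1, one_mul]

lemma edgeAlg_edgeLift (h : p ≠ q) (g : Polynomial ℝ) : edgeAlg p q (edgeLift p q g) = g := by
  rw [edgeLift, ← Polynomial.aeval_algHom_apply, edgeAlg_arcPoly h, Polynomial.aeval_X_left_apply]

lemma map_edgeTrH_P (h : p ≠ q) (r : ℕ) : (P d r).map (edgeTrH p q) = P1 r := by
  ext g
  constructor
  · rintro ⟨f, hf, rfl⟩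
    exact edgeTrH_mem_P1 hf
  · intro hg
    exact ⟨edgeLift p q g, edgeLift_mem hg, edgeAlg_edgeLift h g⟩

lemma map_edgeTrE_eq (h : p ≠ q) {r : ℕ} {E : Submodule ℝ (PolyVec d)}
    (h1 : ∀ v ∈ E, edgeTrE p q v ∈ P1 r) (h2 : PVec d r ≤ E) :
    E.map (edgeTrE p q) = P1 r := by
  ext g
  constructor
  · rintro ⟨f, hf, rfl⟩
    exact h1 f hf
  · intro hg
    refine ⟨fun i => C (edgeDir p q i) * edgeLift p q g, h2 (mem_PVec.2 fun i =>
      C_mul_mem_P _ (edgeLift_mem hg)), ?_⟩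
    simp only [edgeTrE_apply, map_mul (edgeAlg p q), edgeAlg_C, edgeAlg_edgeLift h, ← mul_assoc,
      ← Polynomial.C_mul]
    rw [← Finset.sum_mul, ← map_sum]
    have := edgeDir_unit h
    rw [dotProduct] at this
    rw [this, Polynomial.C_1, one_mul]

lemma edgeTrE_mem_P1_of_PVec {r : ℕ} {v : PolyVec d} (hv : v ∈ PVec d r) :
    edgeTrE p q v ∈ P1 r := by
  rw [edgeTrE_apply]
  refine Submodule.sum_mem _ fun i _ => ?_
  rw [← Polynomial.smul_eq_C_mul]
  exact Submodule.smul_mem _ _ (edgeTrH_mem_P1 (mem_PVec.1 hv i))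

/-- On the edge `x - p` equals `s` times the unit tangent, so `(x - p) · v` restricts to `s (v ·
t)`. Its degree is at most `r + 1`, and the factor `s` accounts for one of these. -/
lemma edgeTrE_mem_P1_of_dot {r : ℕ} {v : PolyVec d} (hv : v ∈ PVec d (r + 1))
    (hx : ∑ i, X i * v i ∈ P d (r + 1)) : edgeTrE p q v ∈ P1 r := by
  have h1 : ∑ i, (X i - C (p i)) * v i ∈ P d (r + 1) := by
    simp_rw [sub_mul, Finset.sum_sub_distrib]
    exact Submodule.sub_mem _ hx (Submodule.sum_mem _ fun i _ => C_mul_mem_P _ (mem_PVec.1 hv i))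
  have h2 := mem_P1.1 (edgeTrH_mem_P1 (p := p) (q := q) h1)
  have h3 : edgeTrH p q (∑ i, (X i - C (p i)) * v i) = edgeTrE p q v * Polynomial.X := by
    simp only [edgeTrH_apply, edgeTrE_apply, map_sum, map_mul, map_sub, edgeAlg_C, edgeAlg_X,
      add_sub_cancel_left, Finset.sum_mul]
    exact Finset.sum_congr rfl fun i _ => by ring
  rw [h3] at h2
  rw [mem_P1]
  by_cases h0 : edgeTrE p q v = 0
  · simp [h0]
  · rw [Polynomial.natDegree_mul_X h0] at h2
    omega

lemma derivative_edgeTrH (f : Poly d) :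
    Polynomial.derivative (edgeTrH p q f) = edgeTrE p q (grad d f) := by
  simp only [edgeTrH_apply, edgeTrE_apply, grad_apply]
  induction f using MvPolynomial.induction_on with
  | C a => simp
  | add f g hf hg => simp [hf, hg, mul_add, Finset.sum_add_distrib]
  | mul_X f i hf =>
    have h (x : Fin d) : edgeAlg p q (pderiv x (f * X i)) =
        edgeAlg p q (pderiv x f) * edgeAlg p q (X i) + edgeAlg p q f * (if i = x then 1 else 0) := by
      rw [pderiv_mul, map_add, map_mul, map_mul, pderiv_X, Pi.single_apply]
      split_ifs <;> simp
    simp_rw [h, mul_add, Finset.sum_add_distrib, ← mul_assoc, ← Finset.sum_mul]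
    rw [map_mul, Polynomial.derivative_mul, hf, edgeAlg_X]
    simp
    ring

lemma edgeAlg_symm (h : p ≠ q) (f : Poly d) :
    edgeAlg q p f = (edgeAlg p q f).comp (Polynomial.C (edgeLen p q) - Polynomial.X) := by
  have : edgeAlg q p = (Polynomial.compRingHom
      (Polynomial.C (edgeLen p q) - Polynomial.X) : Polynomial ℝ →+* Polynomial ℝ).comp
      (edgeAlg p q : Poly d →+* Polynomial ℝ) := by
    refine MvPolynomial.ringHom_ext (fun a => ?_) fun i => ?_
    · simp
    · have := congrFun (edge_end h) i
      simp only [Pi.add_apply, Pi.smul_apply, smul_eq_mul] at this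
      simp [edgeAlg_X, edgeDir_symm p q, ← this]
      ring
  exact RingHom.congr_fun this f

/-- The edges of the tetrahedron are increasing pairs, whereas the cyclic numbering of the edges of
a triangle also runs backwards; vanishing of a trace must not depend on the direction. -/
lemma edgeTrH_symm_eq_zero (h : p ≠ q) {f : Poly d} (hf : edgeTrH p q f = 0) :
    edgeTrH q p f = 0 := by
  rw [edgeTrH_apply] at *
  rw [edgeAlg_symm h, hf, Polynomial.zero_comp]

lemma edgeTrE_symm_eq_zero (h : p ≠ q) {v : PolyVec d} (hv : edgeTrE p q v = 0) :
    edgeTrE q p v = 0 := by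
  have : edgeTrE q p v =
      -Polynomial.compRingHom (Polynomial.C (edgeLen p q) - Polynomial.X) (edgeTrE p q v) := by
    rw [edgeTrE_apply, edgeTrE_apply, map_sum, ← Finset.sum_neg_distrib]
    refine Finset.sum_congr rfl fun i _ => ?_
    rw [map_mul, edgeAlg_symm h, edgeDir_symm p q]
    simp
  rw [this, hv, map_zero, neg_zero]

end Edge

/-! ### Face charts -/

namespace FaceChart

variable {i : Fin 4} (c : FaceChart i)

lemma n_apply : c.n = ![c.t₁ 1 * c.t₂ 2 - c.t₁ 2 * c.t₂ 1, c.t₁ 2 * c.t₂ 0 - c.t₁ 0 * c.t₂ 2,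
    c.t₁ 0 * c.t₂ 1 - c.t₁ 1 * c.t₂ 0] := by
  rw [n, cross_apply]

lemma t₁_sum : c.t₁ 0 * c.t₁ 0 + c.t₁ 1 * c.t₁ 1 + c.t₁ 2 * c.t₁ 2 = 1 := by
  have := c.t₁_unit
  rwa [dotProduct, Fin.sum_univ_three] at this

lemma t₂_sum : c.t₂ 0 * c.t₂ 0 + c.t₂ 1 * c.t₂ 1 + c.t₂ 2 * c.t₂ 2 = 1 := by
  have := c.t₂_unit
  rwa [dotProduct, Fin.sum_univ_three] at this

lemma t₁_t₂_sum : c.t₁ 0 * c.t₂ 0 + c.t₁ 1 * c.t₂ 1 + c.t₁ 2 * c.t₂ 2 = 0 := by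
  have := c.t₁_t₂
  rwa [dotProduct, Fin.sum_univ_three] at this

lemma n_unit : c.n ⬝ᵥ c.n = 1 := by
  rw [n, cross_dot_cross, c.t₁_unit, c.t₂_unit, c.t₁_t₂, dotProduct_comm c.t₂, c.t₁_t₂]
  ring

lemma t₁_n : c.t₁ ⬝ᵥ c.n = 0 := dot_self_cross _ _

lemma t₂_n : c.t₂ ⬝ᵥ c.n = 0 := dot_cross_self _ _

/-- Components in the orthonormal frame of a face. -/
lemma decomp (x : Fin 3 → ℝ) :
    x = (x ⬝ᵥ c.t₁) • c.t₁ + (x ⬝ᵥ c.t₂) • c.t₂ + (x ⬝ᵥ c.n) • c.n := by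
  let M : Matrix (Fin 3) (Fin 3) ℝ := ![c.t₁, c.t₂, c.n]
  have h : M * Mᵀ = 1 := by
    ext a b
    have : (M * Mᵀ) a b = M a ⬝ᵥ M b := rfl
    rw [this]
    fin_cases a <;> fin_cases b <;>
      simp [M, c.t₁_unit, c.t₂_unit, c.t₁_t₂, c.n_unit, c.t₁_n, c.t₂_n,
        dotProduct_comm c.t₂ c.t₁, dotProduct_comm c.n]
  have h' : Mᵀ * M = 1 := mul_eq_one_comm.1 h
  have h2 : Mᵀ *ᵥ (M *ᵥ x) = x := by rw [Matrix.mulVec_mulVec, h', Matrix.one_mulVec]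
  conv_lhs => rw [← h2]
  funext m
  have h0 : (Mᵀ *ᵥ (M *ᵥ x)) m = ∑ a, M a m * (M a ⬝ᵥ x) := rfl
  rw [h0, Fin.sum_univ_three, dotProduct_comm x, dotProduct_comm x, dotProduct_comm x]
  simp [M, mul_comm]

lemma dot_n_eq_zero_iff (x : Fin 3 → ℝ) :
    x ⬝ᵥ c.n = 0 ↔ x = (x ⬝ᵥ c.t₁) • c.t₁ + (x ⬝ᵥ c.t₂) • c.t₂ := by
  constructor
  · intro h
    conv_lhs => rw [c.decomp x, h, zero_smul, add_zero]
  · intro h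
    rw [h, add_dotProduct, smul_dotProduct, smul_dotProduct, t₁_n, t₂_n]
    simp

/-- The point with given coordinates. -/
def point (s : Fin 2 → ℝ) : Fin 3 → ℝ := c.origin + s 0 • c.t₁ + s 1 • c.t₂

lemma point_coord_vertex {j : Fin 4} (hj : j ≠ i) : c.point (c.coord (vertex j)) = vertex j := by
  have h := (c.dot_n_eq_zero_iff _).1 (c.in_plane j hj)
  simp only [point, coord, Matrix.cons_val_zero, Matrix.cons_val_one, add_assoc]
  rw [← h, add_sub_cancel]

/-- The trace of scalar fields as a homomorphism of algebras. -/
def trAlg : Poly 3 →ₐ[ℝ] Poly 2 :=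
  MvPolynomial.aeval fun m =>
    C (c.origin m) + C (c.t₁ m) * X 0 + C (c.t₂ m) * X 1

lemma trH_apply (f : Poly 3) : c.trH f = c.trAlg f := rfl

lemma trAlg_X (m : Fin 3) :
    c.trAlg (X m) = C (c.origin m) + C (c.t₁ m) * X 0 + C (c.t₂ m) * X 1 := by
  simp [trAlg]

lemma trAlg_C (a : ℝ) : c.trAlg (C a) = C a := by
  simp [trAlg]

lemma trDot_apply (a : Fin 3 → ℝ) (v : PolyVec 3) :
    c.trDot a v = C (a 0) * c.trAlg (v 0) + C (a 1) * c.trAlg (v 1) + C (a 2) * c.trAlg (v 2) := by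
  simp [trDot, trH_apply, smul_eq_C_mul, Fin.sum_univ_three]

lemma trE_zero (v : PolyVec 3) : c.trE v 0 = c.trDot c.t₁ v := rfl

lemma trE_one (v : PolyVec 3) : c.trE v 1 = c.trDot c.t₂ v := rfl

lemma trV_apply (v : PolyVec 3) : c.trV v = c.trDot c.n v := rfl

lemma eval_trAlg (s : Fin 2 → ℝ) (f : Poly 3) : eval s (c.trAlg f) = eval (c.point s) f := by
  induction f using MvPolynomial.induction_on with
  | C a => simp
  | add f g hf hg => simp [hf, hg]
  | mul_X f m hf =>
    rw [map_mul, map_mul, hf, map_mul, eval_X, trAlg_X]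
    simp only [map_add, map_mul, eval_C, eval_X, point, Pi.add_apply, Pi.smul_apply, smul_eq_mul]
    ring

lemma eval_trDot (a : Fin 3 → ℝ) (s : Fin 2 → ℝ) (v : PolyVec 3) :
    eval s (c.trDot a v) = (fun m => eval (c.point s) (v m)) ⬝ᵥ a := by
  simp [trDot_apply, eval_trAlg, dotProduct, Fin.sum_univ_three, mul_comm]

lemma trH_mem_P {p : ℕ} {f : Poly 3} (hf : f ∈ P 3 p) : c.trH f ∈ P 2 p :=
  aeval_mem_P (fun _ => Submodule.add_mem _ (Submodule.add_mem _ (C_mem_P _ _)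
    (C_mul_mem_P _ (X_mem_P _))) (C_mul_mem_P _ (X_mem_P _))) hf

lemma trDot_mem_P (a : Fin 3 → ℝ) {p : ℕ} {v : PolyVec 3} (hv : v ∈ PVec 3 p) :
    c.trDot a v ∈ P 2 p := by
  rw [trDot_apply]
  rw [mem_PVec] at hv
  exact Submodule.add_mem _ (Submodule.add_mem _ (C_mul_mem_P _ (c.trH_mem_P (hv 0)))
    (C_mul_mem_P _ (c.trH_mem_P (hv 1)))) (C_mul_mem_P _ (c.trH_mem_P (hv 2)))

/-- The coordinates of the orthogonal projection to the plane of the face. -/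
def coordPoly : Fin 2 → Poly 3 :=
  ![C (c.t₁ 0) * (X 0 - C (c.origin 0)) + C (c.t₁ 1) * (X 1 - C (c.origin 1)) +
      C (c.t₁ 2) * (X 2 - C (c.origin 2)),
    C (c.t₂ 0) * (X 0 - C (c.origin 0)) + C (c.t₂ 1) * (X 1 - C (c.origin 1)) +
      C (c.t₂ 2) * (X 2 - C (c.origin 2))]

/-- Extension of a polynomial on a face, constant along the normal. -/
def lift : Poly 2 →ₐ[ℝ] Poly 3 := MvPolynomial.aeval c.coordPoly

lemma lift_mem_P {p : ℕ} {g : Poly 2} (hg : g ∈ P 2 p) : c.lift g ∈ P 3 p := by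
  have h (m : Fin 3) (a b : ℝ) : C a * (X m - C b) ∈ P 3 1 :=
    C_mul_mem_P _ (Submodule.sub_mem _ (X_mem_P _) (C_mem_P _ _))
  refine aeval_mem_P (fun j => ?_) hg
  fin_cases j <;> exact Submodule.add_mem _ (Submodule.add_mem _ (h _ _ _) (h _ _ _)) (h _ _ _)

lemma C_t₁_sum : (C (c.t₁ 0) * C (c.t₁ 0) + C (c.t₁ 1) * C (c.t₁ 1) + C (c.t₁ 2) * C (c.t₁ 2) :
    Poly 2) = 1 := by
  simp only [← C_mul, ← C_add, c.t₁_sum, C_1]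

lemma C_t₂_sum : (C (c.t₂ 0) * C (c.t₂ 0) + C (c.t₂ 1) * C (c.t₂ 1) + C (c.t₂ 2) * C (c.t₂ 2) :
    Poly 2) = 1 := by
  simp only [← C_mul, ← C_add, c.t₂_sum, C_1]

lemma C_t₁_t₂_sum : (C (c.t₁ 0) * C (c.t₂ 0) + C (c.t₁ 1) * C (c.t₂ 1) +
    C (c.t₁ 2) * C (c.t₂ 2) : Poly 2) = 0 := by
  simp only [← C_mul, ← C_add, c.t₁_t₂_sum, C_0]

lemma C_n_sum : (C (c.n 0) * C (c.n 0) + C (c.n 1) * C (c.n 1) + C (c.n 2) * C (c.n 2) :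
    Poly 2) = 1 := by
  have := c.n_unit
  rw [dotProduct, Fin.sum_univ_three] at this
  simp only [← C_mul, ← C_add, this, C_1]

lemma trAlg_lift (g : Poly 2) : c.trAlg (c.lift g) = g := by
  have h1 := c.C_t₁_sum
  have h2 := c.C_t₂_sum
  have h3 := c.C_t₁_t₂_sum
  have : c.trAlg.comp c.lift = AlgHom.id ℝ (Poly 2) := by
    refine MvPolynomial.algHom_ext fun j => ?_
    fin_cases j <;> simp [lift, coordPoly, trAlg_X]
    · linear_combination X 0 * h1 + X 1 * h3
    · linear_combination X 0 * h3 + X 1 * h2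
  exact AlgHom.congr_fun this g

/-- Extension of a plane field on a face to a field in space. -/
def liftE (w : PolyVec 2) : PolyVec 3 := fun m =>
  C (c.t₁ m) * c.lift (w 0) + C (c.t₂ m) * c.lift (w 1)

lemma trE_liftE (w : PolyVec 2) : c.trE (c.liftE w) = w := by
  have h1 := c.C_t₁_sum
  have h2 := c.C_t₂_sum
  have h3 := c.C_t₁_t₂_sum
  funext j
  fin_cases j <;>
    simp only [Fin.mk_one, Fin.zero_eta, trE_zero, trE_one, trDot_apply, liftE, map_add, map_mul,
      trAlg_C, trAlg_lift]
  · linear_combination w 0 * h1 + w 1 * h3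
  · linear_combination w 0 * h3 + w 1 * h2

/-- Extension of a scalar on a face to a field in space along the normal. -/
def liftV (g : Poly 2) : PolyVec 3 := fun m => C (c.n m) * c.lift g

lemma trV_liftV (g : Poly 2) : c.trV (c.liftV g) = g := by
  have h := c.C_n_sum
  simp only [trV_apply, trDot_apply, liftV, map_mul, trAlg_C, trAlg_lift]
  linear_combination g * h

lemma pderiv_trAlg (f : Poly 3) :
    pderiv 0 (c.trAlg f) = c.trDot c.t₁ (grad 3 f) ∧
      pderiv 1 (c.trAlg f) = c.trDot c.t₂ (grad 3 f) := by
  simp only [trDot_apply, grad_apply]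
  induction f using MvPolynomial.induction_on with
  | C a => simp
  | add f g hf hg =>
    simp only [map_add, hf.1, hf.2, hg.1, hg.2]
    constructor <;> ring
  | mul_X f m hf =>
    simp only [map_mul, pderiv_mul, map_add, hf.1, hf.2]
    simp only [trAlg_X, map_add, pderiv_mul, pderiv_C, pderiv_X, Pi.single_apply]
    fin_cases m <;> constructor <;> simp <;> ring

lemma grad_trH (f : Poly 3) : grad 2 (c.trH f) = c.trE (grad 3 f) := by
  funext j
  fin_cases j
  · exact (c.pderiv_trAlg f).1
  · exact (c.pderiv_trAlg f).2

/-- Only derivatives along the plane occur, and `n = t₁ × t₂` collects them into the normal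
component of the curl. -/
lemma curl_trE (v : PolyVec 3) : curl2 (c.trE v) = c.trV (curl3 v) := by
  rw [curl2_apply, trE_zero, trE_one, trV_apply]
  simp only [trDot_apply, map_add, pderiv_C_mul, c.n_apply, curl3_apply, Matrix.cons_val, map_sub,
    (c.pderiv_trAlg _).1, (c.pderiv_trAlg _).2, grad_apply, C_mul]
  ring

/-! ### Trace sequences -/

lemma map_trH_P (p : ℕ) : (P 3 p).map c.trH = P 2 p := by
  ext g
  constructor
  · rintro ⟨f, hf, rfl⟩
    exact c.trH_mem_P hf
  · intro hg
    exact ⟨c.lift g, c.lift_mem_P hg, c.trAlg_lift g⟩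

lemma liftE_mem_PVec {p : ℕ} {w : PolyVec 2} (hw : w ∈ PVec 2 p) : c.liftE w ∈ PVec 3 p := by
  rw [mem_PVec] at *
  exact fun m => Submodule.add_mem _ (C_mul_mem_P _ (c.lift_mem_P (hw 0)))
    (C_mul_mem_P _ (c.lift_mem_P (hw 1)))

lemma trE_mem_PVec {p : ℕ} {v : PolyVec 3} (hv : v ∈ PVec 3 p) : c.trE v ∈ PVec 2 p := by
  rw [mem_PVec]
  intro j
  fin_cases j <;> exact c.trDot_mem_P _ hv

lemma map_trE_PVec (p : ℕ) : (PVec 3 p).map c.trE = PVec 2 p := by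
  ext w
  constructor
  · rintro ⟨v, hv, rfl⟩
    exact c.trE_mem_PVec hv
  · intro hw
    exact ⟨_, c.liftE_mem_PVec hw, c.trE_liftE w⟩

lemma liftV_mem_PVec {p : ℕ} {g : Poly 2} (hg : g ∈ P 2 p) : c.liftV g ∈ PVec 3 p :=
  mem_PVec.2 fun _ => C_mul_mem_P _ (c.lift_mem_P hg)

lemma map_trV_PVec (p : ℕ) : (PVec 3 p).map c.trV = P 2 p := by
  ext g
  constructor
  · rintro ⟨v, hv, rfl⟩
    exact c.trDot_mem_P _ hv
  · intro hg
    exact ⟨_, c.liftV_mem_PVec hg, c.trV_liftV g⟩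

/-- Both inclusions rest on the degree conditions. On the plane `x - o = s₁ t₁ + s₂ t₂` with `o` the
origin of the chart, so `s · trE v` is the restriction of `x · v - o · v`. Conversely, for `liftE w`
the product `x · v` is the lift of `s · w` up to terms of the degree of `w`. -/
lemma map_trE_nedelec (p : ℕ) : (PVec 3 p ⊔ (PhomVec 3 p).map xCross3).map c.trE =
    PVec 2 p ⊔ (Phom 2 p).map xCross2 := by
  ext w
  rw [mem_nedelec2]
  constructor
  · rintro ⟨v, hv, rfl⟩
    obtain ⟨hv, hx⟩ := mem_nedelec3.1 hv
    refine ⟨c.trE_mem_PVec hv, ?_⟩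
    have h1 : ∑ m, X m * v m - ∑ m, C (c.origin m) * v m ∈ P 3 (p + 1) :=
      Submodule.sub_mem _ hx (Submodule.sum_mem _ fun i _ => C_mul_mem_P _ (mem_PVec.1 hv i))
    have h2 := c.trH_mem_P h1
    convert h2 using 1
    simp only [Fin.sum_univ_three, Fin.sum_univ_two, trE_zero, trE_one, trDot_apply, trH_apply,
      map_sub, map_add, map_mul, trAlg_X, trAlg_C]
    ring
  · rintro ⟨hw, hx⟩
    refine ⟨c.liftE w, mem_nedelec3.2 ⟨c.liftE_mem_PVec hw, ?_⟩, c.trE_liftE w⟩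
    have h1 := c.lift_mem_P hx
    rw [mem_PVec] at hw
    have h2 : C (c.t₁ 0 * c.origin 0 + c.t₁ 1 * c.origin 1 + c.t₁ 2 * c.origin 2) *
        c.lift (w 0) ∈ P 3 (p + 1) := C_mul_mem_P _ (c.lift_mem_P (hw 0))
    have h3 : C (c.t₂ 0 * c.origin 0 + c.t₂ 1 * c.origin 1 + c.t₂ 2 * c.origin 2) *
        c.lift (w 1) ∈ P 3 (p + 1) := C_mul_mem_P _ (c.lift_mem_P (hw 1))
    convert Submodule.add_mem _ (Submodule.add_mem _ h1 h2) h3 using 1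
    have hX0 : c.lift (X 0) = c.coordPoly 0 := by simp [lift]
    have hX1 : c.lift (X 1) = c.coordPoly 1 := by simp [lift]
    simp only [Fin.sum_univ_three, Fin.sum_univ_two, liftE, map_add, map_mul, hX0, hX1]
    simp only [coordPoly, Matrix.cons_val_zero, Matrix.cons_val_one]
    ring

/-- On the plane `t₁ · ((x - o) × v) = s₂ (v · n)`. The left side has degree at most `p + 1` by the
degree condition, so `v · n` has degree at most `p`. -/
lemma map_trV_raviartThomas (p : ℕ) : (PVec 3 p ⊔ (Phom 3 p).map xMul3).map c.trV = P 2 p := by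
  ext g
  constructor
  · rintro ⟨v, hv, rfl⟩
    obtain ⟨hv, hx⟩ := mem_raviartThomas.1 hv
    have hv' := mem_PVec.1 hv
    have h1 (i j : Fin 3) : (X i - C (c.origin i)) * v j - (X j - C (c.origin j)) * v i ∈
        P 3 (p + 1) := by
      have : (X i - C (c.origin i)) * v j - (X j - C (c.origin j)) * v i =
          (X i * v j - X j * v i) - (C (c.origin i) * v j - C (c.origin j) * v i) := by ring
      rw [this]
      exact Submodule.sub_mem _ (hx i j)
        (Submodule.sub_mem _ (C_mul_mem_P _ (hv' j)) (C_mul_mem_P _ (hv' i)))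
    have h2 := c.trH_mem_P (Submodule.add_mem _ (Submodule.add_mem _
      (C_mul_mem_P (c.t₁ 0) (h1 1 2)) (C_mul_mem_P (c.t₁ 1) (h1 2 0)))
      (C_mul_mem_P (c.t₁ 2) (h1 0 1)))
    have h3 : X 1 * c.trV v ∈ P 2 (p + 1) := by
      convert h2 using 1
      simp only [trV_apply, trDot_apply, trH_apply, map_sub, map_add, map_mul, trAlg_X, trAlg_C,
        n_apply, Matrix.cons_val]
      ring
    rw [mem_P] at h3 ⊢
    by_cases h0 : c.trV v = 0
    · simp [h0]
    · rw [totalDegree_mul_of_isDomain (X_ne_zero _) h0, totalDegree_X] at h3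
      omega
  · intro hg
    exact ⟨_, Submodule.mem_sup_left (c.liftV_mem_PVec hg), c.trV_liftV g⟩

end FaceChart

theorem S1tet_faceTrace (k : ℕ) {i : Fin 4} (c : FaceChart i) :
    (S1tet k).faceTrace c = S1tri (k + 1) :=
  Seq2.ext (c.map_trH_P _) (c.map_trE_PVec _) (c.map_trV_PVec _)

theorem S2tet_faceTrace (k : ℕ) {i : Fin 4} (c : FaceChart i) :
    (S2tet k).faceTrace c = S2tri k :=
  Seq2.ext (c.map_trH_P _) (c.map_trE_nedelec _) (c.map_trV_raviartThomas _)

/-! ### Edges of faces -/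

namespace FaceChart

variable {i : Fin 4} (c : FaceChart i) {a b : Fin 4}

lemma vertex_sub_vertex (ha : a ≠ i) (hb : b ≠ i) : vertex b - vertex a =
    (c.coord (vertex b) 0 - c.coord (vertex a) 0) • c.t₁ +
      (c.coord (vertex b) 1 - c.coord (vertex a) 1) • c.t₂ := by
  conv_lhs => rw [← c.point_coord_vertex ha, ← c.point_coord_vertex hb]
  simp only [point]
  module

lemma edgeLen_coord (ha : a ≠ i) (hb : b ≠ i) :
    edgeLen (c.coord (vertex a)) (c.coord (vertex b)) = edgeLen (vertex a) (vertex b) := by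
  rw [edgeLen, edgeLen, c.vertex_sub_vertex ha hb]
  simp only [add_dotProduct, dotProduct_add, smul_dotProduct, dotProduct_smul, c.t₁_unit,
    c.t₂_unit, c.t₁_t₂, dotProduct_comm c.t₂ c.t₁]
  congr 1
  simp [dotProduct, Fin.sum_univ_two]

lemma edgeDir_coord (ha : a ≠ i) (hb : b ≠ i) : edgeDir (vertex a) (vertex b) =
    edgeDir (c.coord (vertex a)) (c.coord (vertex b)) 0 • c.t₁ +
      edgeDir (c.coord (vertex a)) (c.coord (vertex b)) 1 • c.t₂ := by
  rw [edgeDir, edgeDir, c.vertex_sub_vertex ha hb, edgeLen_coord c ha hb, smul_add, smul_smul,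
    smul_smul]
  rfl

lemma edgeAlg_trAlg (ha : a ≠ i) (hb : b ≠ i) (f : Poly 3) :
    edgeAlg (c.coord (vertex a)) (c.coord (vertex b)) (c.trAlg f) =
      edgeAlg (vertex a) (vertex b) f := by
  have : (edgeAlg (c.coord (vertex a)) (c.coord (vertex b))).comp c.trAlg =
      edgeAlg (vertex a) (vertex b) := by
    refine MvPolynomial.algHom_ext fun m => ?_
    have h1 := congrFun (c.edgeDir_coord ha hb) m
    have h2 := congrFun (c.point_coord_vertex ha) m
    rw [AlgHom.comp_apply, trAlg_X, edgeAlg_X, h1, ← h2]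
    simp only [map_add, map_mul, edgeAlg_C, edgeAlg_X, point, Pi.add_apply, Pi.smul_apply,
      smul_eq_mul]
    ring
  exact AlgHom.congr_fun this f

lemma edgeTrH_trH (ha : a ≠ i) (hb : b ≠ i) (f : Poly 3) :
    edgeTrH (c.coord (vertex a)) (c.coord (vertex b)) (c.trH f) =
      edgeTrH (vertex a) (vertex b) f :=
  c.edgeAlg_trAlg ha hb f

lemma edgeTrE_trE (ha : a ≠ i) (hb : b ≠ i) (v : PolyVec 3) :
    edgeTrE (c.coord (vertex a)) (c.coord (vertex b)) (c.trE v) =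
      edgeTrE (vertex a) (vertex b) v := by
  simp only [edgeTrE_apply, Fin.sum_univ_two, Fin.sum_univ_three, trE_zero, trE_one, trDot_apply,
    c.edgeDir_coord ha hb, map_add, map_mul, edgeAlg_C, c.edgeAlg_trAlg ha hb, Pi.add_apply,
    Pi.smul_apply, smul_eq_mul]
  ring

end FaceChart

end FES

namespace FES

open MeasureTheory

/-! ### Integration on simplices -/

/-- The open unit simplex. -/
def simplex (n : ℕ) : Set (Fin n → ℝ) := {x | (∀ i, 0 < x i) ∧ ∑ i, x i < 1}

lemma isOpen_simplex (n : ℕ) : IsOpen (simplex n) := by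
  have h1 : IsOpen {x : Fin n → ℝ | ∀ i, 0 < x i} := by
    simp only [Set.ofPred_forall]
    exact isOpen_iInter_of_finite fun i => isOpen_lt continuous_const (continuous_apply i)
  have h2 : IsOpen {x : Fin n → ℝ | ∑ i, x i < 1} :=
    isOpen_lt (continuous_finsetSum _ fun i _ => continuous_apply i) continuous_const
  exact h1.inter h2

lemma simplex_subset_Icc (n : ℕ) : simplex n ⊆ Set.Icc 0 1 := fun _ hx =>
  ⟨fun i => (hx.1 i).le, fun i =>
    (Finset.single_le_sum (fun j _ => (hx.1 j).le) (Finset.mem_univ i)).trans hx.2.le⟩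

lemma integrableOn_simplex {n : ℕ} {g : (Fin n → ℝ) → ℝ} (hg : Continuous g) :
    IntegrableOn g (simplex n) :=
  (hg.continuousOn.integrableOn_compact isCompact_Icc).mono_set (simplex_subset_Icc n)

lemma insertNth_mem_simplex {n : ℕ} (i : Fin (n + 1)) (t : ℝ) (y : Fin n → ℝ) :
    i.insertNth t y ∈ simplex (n + 1) ↔ y ∈ simplex n ∧ t ∈ Set.Ioo 0 (1 - ∑ j, y j) := by
  have h : ∑ j, (i.insertNth t y : Fin (n + 1) → ℝ) j = t + ∑ j, y j := by
    rw [Fin.sum_univ_succAbove _ i]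
    simp
  simp only [simplex, Set.mem_ofPred_eq, h, Set.mem_Ioo, i.forall_iff_succAbove,
    Fin.insertNth_apply_same, Fin.insertNth_apply_succAbove]
  constructor
  · rintro ⟨⟨h1, h2⟩, h3⟩
    exact ⟨⟨h2, by linarith⟩, h1, by linarith⟩
  · rintro ⟨⟨h1, h2⟩, h3, h4⟩
    exact ⟨⟨h3, h1⟩, by linarith⟩

/-- Fubini with the `i`-th coordinate innermost. Both integrands are extended by zero, so that the
product structure of the whole space can be used. -/
lemma integral_simplex_succ {n : ℕ} (i : Fin (n + 1)) {g : (Fin (n + 1) → ℝ) → ℝ}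
    (hg : Continuous g) : ∫ x in simplex (n + 1), g x =
      ∫ y in simplex n, ∫ t in (0 : ℝ)..(1 - ∑ j, y j), g (i.insertNth t y) := by
  have hm := volume_preserving_piFinSuccAbove (fun _ : Fin (n + 1) => ℝ) i
  have hint : Integrable ((simplex (n + 1)).indicator g) :=
    (integrable_indicator_iff (isOpen_simplex _).measurableSet).2 (integrableOn_simplex hg)
  rw [← integral_indicator (isOpen_simplex _).measurableSet,
    ← integral_indicator (isOpen_simplex _).measurableSet,
    ← hm.symm.integral_comp']
  rw [Measure.volume_eq_prod, integral_prod_symm]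
  · congr 1
    funext y
    have he (t : ℝ) : (MeasurableEquiv.piFinSuccAbove (fun _ : Fin (n + 1) => ℝ) i).symm (t, y) =
        i.insertNth t y := rfl
    simp only [he]
    by_cases hy : y ∈ simplex n
    · rw [Set.indicator_of_mem hy, intervalIntegral.integral_of_le (by linarith [hy.2]),
        integral_Ioc_eq_integral_Ioo, ← integral_indicator measurableSet_Ioo]
      congr 1
      funext t
      by_cases ht : t ∈ Set.Ioo 0 (1 - ∑ j, y j)
      · rw [Set.indicator_of_mem ht, Set.indicator_of_mem ((insertNth_mem_simplex i t y).2 ⟨hy, ht⟩)]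
      · rw [Set.indicator_of_notMem ht, Set.indicator_of_notMem
          fun h => ht ((insertNth_mem_simplex i t y).1 h).2]
    · rw [Set.indicator_of_notMem hy]
      rw [← integral_zero ℝ ℝ]
      congr 1
      funext t
      exact Set.indicator_of_notMem (fun h => hy ((insertNth_mem_simplex i t y).1 h).1) _
  · exact (hm.symm.integrable_comp_emb (MeasurableEquiv.measurableEmbedding _)).2 hint

lemma insertNth_eq_add {n : ℕ} (i : Fin (n + 1)) (t : ℝ) (y : Fin n → ℝ) :
    (i.insertNth t y : Fin (n + 1) → ℝ) = i.insertNth 0 y + t • Pi.single i 1 := by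
  funext j
  refine i.succAboveCases ?_ (fun j => ?_) j
  · simp
  · simp

/-- The fundamental theorem of calculus on a simplex. -/
lemma integral_simplex_fderiv {n : ℕ} (i : Fin (n + 1)) {h : (Fin (n + 1) → ℝ) → ℝ}
    (hh : ContDiff ℝ ∞ h) : ∫ x in simplex (n + 1), fderiv ℝ h x (Pi.single i 1) =
      ∫ y in simplex n, (h (i.insertNth (1 - ∑ j, y j) y) - h (i.insertNth 0 y)) := by
  have hc : Continuous fun x => fderiv ℝ h x (Pi.single i 1) :=
    (hh.continuous_fderiv (by simp)).clm_apply continuous_const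
  rw [integral_simplex_succ i hc]
  congr 1
  funext y
  refine intervalIntegral.integral_eq_sub_of_hasDerivAt (f := fun t => h (i.insertNth t y))
    (fun t _ => ?_) ?_
  · have h1 : HasFDerivAt h (fderiv ℝ h (i.insertNth t y)) (i.insertNth t y) :=
      (hh.differentiable (by simp) _).hasFDerivAt
    have h2 : HasDerivAt (fun t : ℝ => (i.insertNth t y : Fin (n + 1) → ℝ)) (Pi.single i 1) t := by
      have : (fun t : ℝ => (i.insertNth t y : Fin (n + 1) → ℝ)) =
          fun t => i.insertNth 0 y + t • Pi.single i 1 := funext fun t => insertNth_eq_add i t y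
      rw [this]
      simpa using ((hasDerivAt_id t).smul_const (Pi.single i (1 : ℝ))).const_add
        (i.insertNth 0 y : Fin (n + 1) → ℝ)
    exact h1.comp_hasDerivAt t h2
  · refine Continuous.intervalIntegrable (hc.comp ?_) _ _
    have : (fun t : ℝ => (i.insertNth t y : Fin (n + 1) → ℝ)) =
        fun t => i.insertNth 0 y + t • Pi.single i 1 := funext fun t => insertNth_eq_add i t y
    rw [this]
    fun_prop

lemma integral_simplex_one (g : (Fin 1 → ℝ) → ℝ) (hg : Continuous g) :
    ∫ x in simplex 1, g x = ∫ t in (0 : ℝ)..1, g ![t] := by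
  rw [integral_simplex_succ 0 hg]
  have h0 : simplex 0 = Set.univ := by
    ext x
    simp [simplex]
  rw [h0, Measure.restrict_univ, integral_unique]
  simp only [Finset.univ_eq_empty, Finset.sum_empty, sub_zero, Measure.real, volume_pi]
  simp
  rfl

lemma insertNth_zero_eq (t : ℝ) (y : Fin 1 → ℝ) :
    ((0 : Fin 2).insertNth t y : Fin 2 → ℝ) = ![t, y 0] := by
  funext j
  fin_cases j <;> rfl

lemma insertNth_one_eq (t : ℝ) (y : Fin 1 → ℝ) :
    ((1 : Fin 2).insertNth t y : Fin 2 → ℝ) = ![y 0, t] := by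
  funext j
  fin_cases j <;> rfl

/-- The map exchanges two barycentric coordinates of the triangle; on each fibre it is the
reflection `t ↦ 1 - y - t`. These flips later compare the two parametrizations of the slanted face.
-/
lemma integral_simplex_flip_zero {g : (Fin 2 → ℝ) → ℝ} (hg : Continuous g) :
    ∫ y in simplex 2, g ![1 - y 0 - y 1, y 1] = ∫ y in simplex 2, g y := by
  rw [integral_simplex_succ 0 (by fun_prop), integral_simplex_succ 0 hg]
  congr 1
  funext y
  simp only [insertNth_zero_eq, Finset.univ_unique, Finset.sum_singleton, Fin.default_eq_zero,
    Matrix.cons_val_zero, Matrix.cons_val_one]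
  have := intervalIntegral.integral_comp_sub_left (a := 0) (b := 1 - y 0)
    (fun t => g ![t, y 0]) (1 - y 0)
  rw [sub_self, sub_zero] at this
  rw [← this]
  congr 1
  funext t
  rw [sub_right_comm]

lemma integral_simplex_flip_one {g : (Fin 2 → ℝ) → ℝ} (hg : Continuous g) :
    ∫ y in simplex 2, g ![y 0, 1 - y 0 - y 1] = ∫ y in simplex 2, g y := by
  rw [integral_simplex_succ 1 (by fun_prop), integral_simplex_succ 1 hg]
  congr 1
  funext y
  simp only [insertNth_one_eq, Finset.univ_unique, Finset.sum_singleton, Fin.default_eq_zero,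
    Matrix.cons_val_zero, Matrix.cons_val_one]
  have := intervalIntegral.integral_comp_sub_left (a := 0) (b := 1 - y 0)
    (fun t => g ![y 0, t]) (1 - y 0)
  rw [sub_self, sub_zero] at this
  rw [← this]

/-- Green's formula on the unit triangle. -/
lemma green_simplex {F G : (Fin 2 → ℝ) → ℝ} (hF : ContDiff ℝ ∞ F) (hG : ContDiff ℝ ∞ G) :
    ∫ y in simplex 2, (fderiv ℝ G y (Pi.single 0 1) - fderiv ℝ F y (Pi.single 1 1)) =
      (∫ t in (0 : ℝ)..1, F ![t, 0]) + (∫ t in (0 : ℝ)..1, (G ![1 - t, t] - F ![1 - t, t])) -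
        ∫ t in (0 : ℝ)..1, G ![0, t] := by
  have cF := hF.continuous
  have cG := hG.continuous
  have hc {h : (Fin 2 → ℝ) → ℝ} (hh : ContDiff ℝ ∞ h) (i : Fin 2) :
      Continuous fun x => fderiv ℝ h x (Pi.single i 1) :=
    (hh.continuous_fderiv (by simp)).clm_apply continuous_const
  rw [integral_sub (integrableOn_simplex (hc hG 0)) (integrableOn_simplex (hc hF 1)),
    integral_simplex_fderiv 0 hG, integral_simplex_fderiv 1 hF]
  simp only [insertNth_zero_eq, insertNth_one_eq, Finset.univ_unique, Finset.sum_singleton,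
    Fin.default_eq_zero]
  rw [integral_simplex_one _ (by fun_prop), integral_simplex_one _ (by fun_prop)]
  simp only [Matrix.cons_val_zero]
  have hi {f : ℝ → ℝ} (hf : Continuous f) : IntervalIntegrable f volume 0 1 :=
    hf.intervalIntegrable _ _
  have hflip : ∫ t in (0 : ℝ)..1, F ![t, 1 - t] = ∫ t in (0 : ℝ)..1, F ![1 - t, t] := by
    have := intervalIntegral.integral_comp_sub_left (a := 0) (b := 1)
      (fun t => F ![t, 1 - t]) 1
    rw [sub_self, sub_zero] at this
    rw [← this]
    congr 1
    funext t
    rw [sub_sub_cancel]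
  rw [intervalIntegral.integral_sub (hi (by fun_prop)) (hi (by fun_prop)),
    intervalIntegral.integral_sub (hi (by fun_prop)) (hi (by fun_prop)),
    intervalIntegral.integral_sub (hi (by fun_prop)) (hi (by fun_prop)), hflip]
  ring

lemma integral_simplex_add_add {n : ℕ} {f g h : (Fin n → ℝ) → ℝ} (hf : Continuous f)
    (hg : Continuous g) (hh : Continuous h) : ∫ x in simplex n, (f x + g x + h x) =
      (∫ x in simplex n, f x) + (∫ x in simplex n, g x) + ∫ x in simplex n, h x := by
  rw [← integral_add (integrableOn_simplex hf) (integrableOn_simplex hg)]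
  exact integral_add (integrableOn_simplex (hf.add hg)) (integrableOn_simplex hh)

/-! ### Integrals of smooth fields over edges, faces and the tetrahedron -/

lemma smooth_contDiff (u : SmoothScalar) : ContDiff ℝ ∞ u.1 := u.2

lemma smooth_continuous (u : SmoothScalar) : Continuous u.1 := (smooth_contDiff u).continuous

lemma SmoothVec.continuous_value (u : SmoothVec) : Continuous u.value :=
  continuous_pi fun m => smooth_continuous (u m)

lemma continuous_dot {X : Type*} [TopologicalSpace X] {f : X → Fin 3 → ℝ} (hf : Continuous f)
    (a : Fin 3 → ℝ) : Continuous fun x => f x ⬝ᵥ a := by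
  simp only [dotProduct]
  fun_prop

lemma SmoothVec.value_add (u v : SmoothVec) (x : Fin 3 → ℝ) :
    SmoothVec.value (u + v) x = u.value x + v.value x := rfl

lemma SmoothVec.value_smul (a : ℝ) (u : SmoothVec) (x : Fin 3 → ℝ) :
    SmoothVec.value (a • u) x = a • u.value x := rfl

/-- Circulation of a smooth field along the segment from `p` to `q`. -/
def edgeInt (p q : Fin 3 → ℝ) : SmoothVec →ₗ[ℝ] ℝ where
  toFun u := ∫ t in (0 : ℝ)..1, u.value (p + t • (q - p)) ⬝ᵥ (q - p)
  map_add' u v := by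
    have h (u : SmoothVec) : IntervalIntegrable
        (fun t : ℝ => u.value (p + t • (q - p)) ⬝ᵥ (q - p)) volume 0 1 :=
      (continuous_dot (u.continuous_value.comp (by fun_prop)) _).intervalIntegrable _ _
    rw [← intervalIntegral.integral_add (h u) (h v)]
    simp only [SmoothVec.value_add, add_dotProduct]
  map_smul' a u := by
    simp only [SmoothVec.value_smul, smul_dotProduct, smul_eq_mul, RingHom.id_apply,
      intervalIntegral.integral_const_mul]

/-- Affine parametrization of a triangle. -/
def triPoint (a b c : Fin 3 → ℝ) (y : Fin 2 → ℝ) : Fin 3 → ℝ :=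
  a + y 0 • (b - a) + y 1 • (c - a)

lemma continuous_triPoint (a b c : Fin 3 → ℝ) : Continuous (triPoint a b c) := by
  unfold triPoint
  fun_prop

/-- Flux of a smooth field through the triangle with vertices `a, b, c`. -/
def triInt (a b c : Fin 3 → ℝ) : SmoothVec →ₗ[ℝ] ℝ where
  toFun u := ∫ y in simplex 2, u.value (triPoint a b c y) ⬝ᵥ ((b - a) ⨯₃ (c - a))
  map_add' u v := by
    have h (u : SmoothVec) : IntegrableOn
        (fun y => u.value (triPoint a b c y) ⬝ᵥ ((b - a) ⨯₃ (c - a))) (simplex 2) :=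
      integrableOn_simplex (continuous_dot (u.continuous_value.comp (continuous_triPoint a b c)) _)
    rw [← integral_add (h u) (h v)]
    simp only [SmoothVec.value_add, add_dotProduct]
  map_smul' a u := by
    simp only [SmoothVec.value_smul, smul_dotProduct, smul_eq_mul, RingHom.id_apply,
      integral_const_mul]

/-- Integral of a smooth function over the reference tetrahedron. -/
def cellInt : SmoothScalar →ₗ[ℝ] ℝ where
  toFun u := ∫ x in refTet, u.1 x
  map_add' u v := integral_add (integrableOn_simplex (smooth_continuous u))
    (integrableOn_simplex (smooth_continuous v))
  map_smul' a _ := integral_const_mul a _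

lemma edgeInt_apply (p q : Fin 3 → ℝ) (u : SmoothVec) :
    edgeInt p q u = ∫ t in (0 : ℝ)..1, u.value (p + t • (q - p)) ⬝ᵥ (q - p) := rfl

lemma triInt_apply (a b c : Fin 3 → ℝ) (u : SmoothVec) : triInt a b c u =
    ∫ y in simplex 2, u.value (triPoint a b c y) ⬝ᵥ ((b - a) ⨯₃ (c - a)) := rfl

lemma smoothD_apply (m : Fin 3) (u : SmoothScalar) (x : Fin 3 → ℝ) :
    (smoothD m u).1 x = fderiv ℝ u.1 x (Pi.single m 1) := rfl

lemma fderiv_eq_sum_smoothD (u : SmoothScalar) (x w : Fin 3 → ℝ) :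
    fderiv ℝ u.1 x w = ∑ m, (smoothD m u).1 x * w m := by
  conv_lhs => rw [pi_eq_sum_univ' w]
  simp [smoothD_apply, mul_comm]

lemma value_gradOf (u : SmoothScalar) (x : Fin 3 → ℝ) :
    SmoothVec.value (gradOf smoothD u) x = fun m => (smoothD m u).1 x := rfl

lemma value_curl3Of (u : SmoothVec) (x : Fin 3 → ℝ) :
    SmoothVec.value (curl3Of smoothD u) x =
      ![(smoothD 1 (u 2)).1 x - (smoothD 2 (u 1)).1 x, (smoothD 2 (u 0)).1 x - (smoothD 0 (u 2)).1 x,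
        (smoothD 0 (u 1)).1 x - (smoothD 1 (u 0)).1 x] := by
  have h0 : SmoothVec.value (curl3Of smoothD u) x 0 =
    -(smoothD 2 (u 1)).1 x + (smoothD 1 (u 2)).1 x := rfl
  have h1 : SmoothVec.value (curl3Of smoothD u) x 1 =
    -(smoothD 0 (u 2)).1 x + (smoothD 2 (u 0)).1 x := rfl
  have h2 : SmoothVec.value (curl3Of smoothD u) x 2 =
    -(smoothD 1 (u 0)).1 x + (smoothD 0 (u 1)).1 x := rfl
  funext m
  fin_cases m <;> simp [h0, h1, h2] <;> ring

lemma value_div3Of (u : SmoothVec) (x : Fin 3 → ℝ) : (div3Of smoothD u).1 x =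
    (smoothD 0 (u 0)).1 x + (smoothD 1 (u 1)).1 x + (smoothD 2 (u 2)).1 x := by
  have : div3Of smoothD u = ∑ i, partialOf smoothD i i u := by simp [div3Of]
  rw [this, Fin.sum_univ_three]
  rfl

lemma hasDerivAt_line (u : SmoothScalar) (p w : Fin 3 → ℝ) (t : ℝ) :
    HasDerivAt (fun t : ℝ => u.1 (p + t • w))
      (SmoothVec.value (gradOf smoothD u) (p + t • w) ⬝ᵥ w) t := by
  have h1 : HasFDerivAt u.1 (fderiv ℝ u.1 (p + t • w)) (p + t • w) :=
    ((smooth_contDiff u).differentiable (by simp) _).hasFDerivAt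
  have h2 : HasDerivAt (fun t : ℝ => p + t • w) w t := by
    simpa using ((hasDerivAt_id t).smul_const w).const_add p
  have h3 := h1.comp_hasDerivAt t h2
  rw [fderiv_eq_sum_smoothD] at h3
  exact h3

lemma edgeInt_grad (p q : Fin 3 → ℝ) (u : SmoothScalar) :
    edgeInt p q (gradOf smoothD u) = u.1 q - u.1 p := by
  have h := intervalIntegral.integral_eq_sub_of_hasDerivAt (a := 0) (b := 1)
    (fun t _ => hasDerivAt_line u p (q - p) t)
    ((continuous_dot ((SmoothVec.continuous_value _).comp (by fun_prop)) _).intervalIntegrable _ _)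
  rw [edgeInt_apply, h]
  simp

lemma edgeInt_eq_zero {p q : Fin 3 → ℝ} {u : SmoothVec}
    (h : ∀ x ∈ segment ℝ p q, u.value x ⬝ᵥ edgeDir p q = 0) : edgeInt p q u = 0 := by
  rw [edgeInt_apply, intervalIntegral.integral_congr (g := fun _ => (0 : ℝ)),
    intervalIntegral.integral_zero]
  intro t ht
  rw [Set.uIcc_of_le zero_le_one] at ht
  have hx : p + t • (q - p) ∈ segment ℝ p q := by
    rw [segment_eq_image']
    exact ⟨t, ht, rfl⟩
  have := h _ hx
  by_cases hpq : p = q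
  · simp [hpq]
  · simp only
    rw [← edgeLen_smul_edgeDir hpq, dotProduct_smul, edgeLen_smul_edgeDir hpq, this, smul_zero]

/-- The chain rule for the component along a fixed `w` of a field pulled back to parameters. With
`w` an edge vector it gives the coefficients of the pulled-back one-form in Stokes; with `w` a chart
vector it differentiates tangential traces. -/
lemma fderiv_comp_triPoint (a b c w : Fin 3 → ℝ) (u : SmoothVec) (y : Fin 2 → ℝ) :
    ContDiff ℝ ∞ (fun y => u.value (triPoint a b c y) ⬝ᵥ w) ∧ ∀ j : Fin 2,
      fderiv ℝ (fun y => u.value (triPoint a b c y) ⬝ᵥ w) y (Pi.single j 1) =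
        ∑ m, (∑ l, (smoothD l (u m)).1 (triPoint a b c y) * (![b - a, c - a] j) l) * w m := by
  have hT : ContDiff ℝ ∞ (triPoint a b c) := by
    unfold triPoint
    fun_prop
  have hcomp (m : Fin 3) : ContDiff ℝ ∞ fun y => (u m).1 (triPoint a b c y) :=
    (smooth_contDiff (u m)).comp hT
  have hfd (j : Fin 2) : fderiv ℝ (triPoint a b c) y (Pi.single j 1) = ![b - a, c - a] j := by
    have : HasFDerivAt (triPoint a b c)
        ((ContinuousLinearMap.proj (R := ℝ) (φ := fun _ : Fin 2 => ℝ) 0).smulRight (b - a) +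
          (ContinuousLinearMap.proj (R := ℝ) (φ := fun _ : Fin 2 => ℝ) 1).smulRight (c - a)) y := by
      unfold triPoint
      exact (((ContinuousLinearMap.proj (R := ℝ) (φ := fun _ : Fin 2 => ℝ) 0).hasFDerivAt.smul_const
        (b - a)).const_add a).add ((ContinuousLinearMap.proj (R := ℝ)
          (φ := fun _ : Fin 2 => ℝ) 1).hasFDerivAt.smul_const (c - a))
    rw [this.fderiv]
    fin_cases j <;> simp
  constructor
  · simp only [dotProduct, SmoothVec.value]
    exact ContDiff.sum fun m _ => (hcomp m).mul contDiff_const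
  · intro j
    have hd (m : Fin 3) : HasFDerivAt (fun y => (u m).1 (triPoint a b c y))
        ((fderiv ℝ (u m).1 (triPoint a b c y)).comp (fderiv ℝ (triPoint a b c) y)) y :=
      ((smooth_contDiff (u m)).differentiable (by simp) _).hasFDerivAt.comp y
        (hT.differentiable (by simp) _).hasFDerivAt
    have hs : HasFDerivAt (fun y => u.value (triPoint a b c y) ⬝ᵥ w)
        (∑ m, w m • ((fderiv ℝ (u m).1 (triPoint a b c y)).comp (fderiv ℝ (triPoint a b c) y)))
        y := by
      simp only [dotProduct, SmoothVec.value]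
      exact HasFDerivAt.fun_sum fun m _ => (hd m).mul_const (w m)
    rw [hs.fderiv]
    simp [hfd, fderiv_eq_sum_smoothD, mul_comm]

/-- The theorem of Stokes on a triangle in space. -/
lemma triInt_curl (a b c : Fin 3 → ℝ) (u : SmoothVec) :
    triInt a b c (curl3Of smoothD u) = edgeInt a b u + edgeInt b c u - edgeInt a c u := by
  have hF := fun y => fderiv_comp_triPoint a b c (b - a) u y
  have hG := fun y => fderiv_comp_triPoint a b c (c - a) u y
  have h := green_simplex (hF 0).1 (hG 0).1
  -- The parametrization is affine, so no second derivatives appear and the planar curl of the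
  -- pulled-back form is `curl u · ((b - a) × (c - a))`.
  have h1 : triInt a b c (curl3Of smoothD u) = ∫ y in simplex 2,
      (fderiv ℝ (fun y => u.value (triPoint a b c y) ⬝ᵥ (c - a)) y (Pi.single 0 1) -
        fderiv ℝ (fun y => u.value (triPoint a b c y) ⬝ᵥ (b - a)) y (Pi.single 1 1)) := by
    rw [triInt_apply]
    congr 1
    funext y
    rw [(hG y).2, (hF y).2, value_curl3Of, cross_apply]
    simp [dotProduct, Fin.sum_univ_three]
    ring
  rw [h1, h, edgeInt_apply, edgeInt_apply, edgeInt_apply]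
  congr 2
  · congr 1
    funext t
    simp [triPoint]
  · congr 1
    funext t
    have e1 : triPoint a b c ![1 - t, t] = b + t • (c - b) := by
      simp only [triPoint, Matrix.cons_val_zero, Matrix.cons_val_one]
      module
    rw [e1, ← dotProduct_sub, sub_sub_sub_cancel_right]
  · funext t
    simp [triPoint]

/-- Flux through the face opposite to the vertex `i`. -/
def faceInt (i : Fin 4) : SmoothVec →ₗ[ℝ] ℝ :=
  triInt (vertex (i.succAbove 0)) (vertex (i.succAbove 1)) (vertex (i.succAbove 2))

lemma faceInt_curl (i : Fin 4) (u : SmoothVec) : faceInt i (curl3Of smoothD u) =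
    edgeInt (vertex (i.succAbove 0)) (vertex (i.succAbove 1)) u +
    edgeInt (vertex (i.succAbove 1)) (vertex (i.succAbove 2)) u -
    edgeInt (vertex (i.succAbove 0)) (vertex (i.succAbove 2)) u :=
  triInt_curl _ _ _ u

lemma vertex_zero : vertex 0 = ![0, 0, 0] := by
  funext j; fin_cases j <;> rfl

lemma vertex_one : vertex 1 = ![1, 0, 0] := by
  funext j; fin_cases j <;> simp [vertex]

lemma vertex_two : vertex 2 = ![0, 1, 0] := by
  funext j; fin_cases j <;> simp [vertex]

lemma vertex_three : vertex 3 = ![0, 0, 1] := by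
  funext j; fin_cases j <;> simp [vertex]

/-- The divergence theorem on the reference tetrahedron. -/
lemma cellInt_div (u : SmoothVec) : cellInt (div3Of smoothD u) =
    faceInt 0 u - faceInt 1 u + faceInt 2 u - faceInt 3 u := by
  have cu (m : Fin 3) := smooth_continuous (u m)
  have h0 : cellInt (div3Of smoothD u) = ∑ m, ∫ x in simplex 3, (smoothD m (u m)).1 x := by
    have : cellInt (div3Of smoothD u) = ∫ x in simplex 3, (div3Of smoothD u).1 x := rfl
    rw [this]
    simp only [value_div3Of]
    rw [integral_simplex_add_add (smooth_continuous _) (smooth_continuous _) (smooth_continuous _),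
      Fin.sum_univ_three]
  have hm (m : Fin 3) : ∫ x in simplex 3, (smoothD m (u m)).1 x =
      (∫ y in simplex 2, (u m).1 (m.insertNth (1 - y 0 - y 1) y)) -
        ∫ y in simplex 2, (u m).1 (m.insertNth 0 y) := by
    have h1 (f : (Fin 2 → ℝ) → ℝ) (hf : Continuous f) :
        Continuous fun y : Fin 2 → ℝ => (m.insertNth (f y) y : Fin 3 → ℝ) := by
      fun_prop
    have h2 := integral_simplex_fderiv m (smooth_contDiff (u m))
    simp only [Fin.sum_univ_two, ← sub_sub] at h2
    refine h2.trans (integral_sub ?_ ?_)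
    · exact integrableOn_simplex ((cu m).comp (h1 _ (by fun_prop)))
    · exact integrableOn_simplex ((cu m).comp (h1 _ (by fun_prop)))
  have i0 (t : ℝ) (y : Fin 2 → ℝ) : ((0 : Fin 3).insertNth t y : Fin 3 → ℝ) = ![t, y 0, y 1] := by
    funext j; fin_cases j <;> rfl
  have i1 (t : ℝ) (y : Fin 2 → ℝ) : ((1 : Fin 3).insertNth t y : Fin 3 → ℝ) = ![y 0, t, y 1] := by
    funext j; fin_cases j <;> rfl
  have i2 (t : ℝ) (y : Fin 2 → ℝ) : ((2 : Fin 3).insertNth t y : Fin 3 → ℝ) = ![y 0, y 1, t] := by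
    funext j; fin_cases j <;> rfl
  have f1 : faceInt 1 u = ∫ y in simplex 2, (u 0).1 ![0, y 0, y 1] := by
    have e : ∀ y, triPoint (vertex 0) (vertex 2) (vertex 3) y = ![0, y 0, y 1] := by
      intro y
      rw [vertex_zero, vertex_two, vertex_three]
      funext j; fin_cases j <;> simp [triPoint]
    have : faceInt 1 u = triInt (vertex 0) (vertex 2) (vertex 3) u := rfl
    rw [this, triInt_apply]
    simp only [e]
    simp only [vertex_zero, vertex_two, vertex_three, cross_apply]
    simp [dotProduct, Fin.sum_univ_three, SmoothVec.value]
  -- With the vertices in increasing order, `e₁ × e₃ = -e₂`; the orientation of `faceInt`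
  -- alternates, which explains the signs in the divergence theorem.
  have f2 : faceInt 2 u = -∫ y in simplex 2, (u 1).1 ![y 0, 0, y 1] := by
    have e : ∀ y, triPoint (vertex 0) (vertex 1) (vertex 3) y = ![y 0, 0, y 1] := by
      intro y
      rw [vertex_zero, vertex_one, vertex_three]
      funext j; fin_cases j <;> simp [triPoint]
    have : faceInt 2 u = triInt (vertex 0) (vertex 1) (vertex 3) u := rfl
    rw [this, triInt_apply, ← integral_neg]
    simp only [e]
    simp only [vertex_zero, vertex_one, vertex_three, cross_apply]
    simp [dotProduct, Fin.sum_univ_three, SmoothVec.value]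
  have f3 : faceInt 3 u = ∫ y in simplex 2, (u 2).1 ![y 0, y 1, 0] := by
    have e : ∀ y, triPoint (vertex 0) (vertex 1) (vertex 2) y = ![y 0, y 1, 0] := by
      intro y
      rw [vertex_zero, vertex_one, vertex_two]
      funext j; fin_cases j <;> simp [triPoint]
    have : faceInt 3 u = triInt (vertex 0) (vertex 1) (vertex 2) u := rfl
    rw [this, triInt_apply]
    simp only [e]
    simp only [vertex_zero, vertex_one, vertex_two, cross_apply]
    simp [dotProduct, Fin.sum_univ_three, SmoothVec.value]
  have f0 : faceInt 0 u = (∫ y in simplex 2, (u 0).1 ![1 - y 0 - y 1, y 0, y 1]) +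
      (∫ y in simplex 2, (u 1).1 ![1 - y 0 - y 1, y 0, y 1]) +
      ∫ y in simplex 2, (u 2).1 ![1 - y 0 - y 1, y 0, y 1] := by
    have e : ∀ y, triPoint (vertex 1) (vertex 2) (vertex 3) y = ![1 - y 0 - y 1, y 0, y 1] := by
      intro y
      rw [vertex_one, vertex_two, vertex_three]
      funext j; fin_cases j <;> simp [triPoint]; ring
    have : faceInt 0 u = triInt (vertex 1) (vertex 2) (vertex 3) u := rfl
    rw [this, triInt_apply, ← integral_simplex_add_add (by fun_prop) (by fun_prop) (by fun_prop)]
    simp only [e]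
    simp only [vertex_one, vertex_two, vertex_three, cross_apply]
    simp [dotProduct, Fin.sum_univ_three, SmoothVec.value]
  -- Integrating `∂_m u_m` along `x_m` produces the slanted face as a graph over the coordinate
  -- plane normal to `e_m`; only for `m = 0` does this agree with the parametrization in `f0`.
  have g1 : ∫ y in simplex 2, (u 1).1 ![1 - y 0 - y 1, y 0, y 1] =
      ∫ y in simplex 2, (u 1).1 ![y 0, 1 - y 0 - y 1, y 1] := by
    have := integral_simplex_flip_zero
      (g := fun y => (u 1).1 ![1 - y 0 - y 1, y 0, y 1]) (by fun_prop)
    rw [← this]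
    have e1 (y : Fin 2 → ℝ) : 1 - (1 - y 0 - y 1) - y 1 = y 0 := by ring
    simp only [Matrix.cons_val_zero, Matrix.cons_val_one, e1]
  have g2 : ∫ y in simplex 2, (u 2).1 ![1 - y 0 - y 1, y 0, y 1] =
      ∫ y in simplex 2, (u 2).1 ![y 0, y 1, 1 - y 0 - y 1] := by
    have h1 := integral_simplex_flip_zero
      (g := fun y => (u 2).1 ![1 - y 0 - y 1, y 0, y 1]) (by fun_prop)
    have h2 := integral_simplex_flip_one
      (g := fun y => (u 2).1 ![y 0, 1 - y 0 - y 1, y 1]) (by fun_prop)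
    rw [← h1]
    simp only [Matrix.cons_val_zero, Matrix.cons_val_one] at h2 ⊢
    have e1 (y : Fin 2 → ℝ) : 1 - (1 - y 0 - y 1) - y 1 = y 0 := by ring
    have e2 (y : Fin 2 → ℝ) : 1 - y 0 - (1 - y 0 - y 1) = y 1 := by ring
    simp only [e1, e2] at h2 ⊢
    exact h2.symm
  rw [h0, Fin.sum_univ_three, hm, hm, hm, f0, f1, f2, f3, g1, g2]
  simp only [i0, i1, i2]
  ring

end FES

namespace FES

/-! ### Linear algebra -/

section LinearAlgebra

variable {M A B : Type*} [AddCommGroup M] [Module ℝ M] [AddCommGroup A] [Module ℝ A]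
  [AddCommGroup B] [Module ℝ B]

lemma finrank_comap_subtype (N K : Submodule ℝ M) :
    Module.finrank ℝ (K.comap N.subtype) = Module.finrank ℝ (N ⊓ K : Submodule ℝ M) := by
  rw [← Submodule.map_comap_subtype]
  exact (Submodule.finrank_map_subtype_eq N _).symm

lemma finrank_map_add_inf_ker (N : Submodule ℝ M) [FiniteDimensional ℝ N] (f : M →ₗ[ℝ] A) :
    Module.finrank ℝ (N.map f) + Module.finrank ℝ (N ⊓ LinearMap.ker f : Submodule ℝ M) =
      Module.finrank ℝ N := by
  have h := (f.domRestrict N).finrank_range_add_finrank_ker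
  rw [LinearMap.range_domRestrict, LinearMap.ker_domRestrict] at h
  rw [← h, ← finrank_comap_subtype N]

/-- Rank-nullity three times. The hypothesis says that on `N` the coarse trace `f` is determined by
the fine trace `g`; the fine traces then split into the coarse ones and the fine traces of elements
with no coarse trace. This peels vertices off edges and edges off faces. -/
lemma finrank_map_split (N : Submodule ℝ M) [FiniteDimensional ℝ N] (f : M →ₗ[ℝ] A)
    (g : M →ₗ[ℝ] B) (h : N ⊓ LinearMap.ker g ≤ LinearMap.ker f) :
    Module.finrank ℝ (N.map g) = Module.finrank ℝ (N.map f) +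
      Module.finrank ℝ ((N ⊓ LinearMap.ker f).map g) := by
  have : FiniteDimensional ℝ (N ⊓ LinearMap.ker f : Submodule ℝ M) :=
    Submodule.finiteDimensional_of_le inf_le_left
  have h1 := finrank_map_add_inf_ker N f
  have h2 := finrank_map_add_inf_ker N g
  have h3 := finrank_map_add_inf_ker (N ⊓ LinearMap.ker f) g
  have h4 : N ⊓ LinearMap.ker f ⊓ LinearMap.ker g = N ⊓ LinearMap.ker g :=
    le_antisymm (inf_le_inf_right _ inf_le_left)
      (le_inf (le_inf inf_le_left h) inf_le_right)
  rw [h4] at h3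
  omega

lemma finrank_pi_submodule {ι : Type*} [Fintype ι] {V : ι → Type*} [∀ i, AddCommGroup (V i)]
    [∀ i, Module ℝ (V i)] (N : ∀ i, Submodule ℝ (V i)) [∀ i, FiniteDimensional ℝ (N i)] :
    FiniteDimensional ℝ (Submodule.pi Set.univ N) ∧
    Module.finrank ℝ (Submodule.pi Set.univ N) = ∑ i, Module.finrank ℝ (N i) := by
  let e : (Submodule.pi Set.univ N) ≃ₗ[ℝ] (∀ i, N i) :=
    { toFun := fun x i => ⟨x.1 i, x.2 i trivial⟩
      map_add' := fun _ _ => rfl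
      map_smul' := fun _ _ => rfl
      invFun := fun x => ⟨fun i => x i, fun i _ => (x i).2⟩
      left_inv := fun _ => rfl
      right_inv := fun _ => rfl }
  exact ⟨Module.Finite.equiv e.symm, by rw [e.finrank_eq, Module.finrank_pi_fintype]⟩

lemma map_eq_pi {ι : Type*} [Fintype ι] [DecidableEq ι] {V : Type*} [AddCommGroup V] [Module ℝ V]
    {K : Submodule ℝ M} {g : M →ₗ[ℝ] (ι → V)} {N : ι → Submodule ℝ V}
    (h1 : ∀ x ∈ K, ∀ i, g x i ∈ N i) (h2 : ∀ i, ∀ y ∈ N i, ∃ x ∈ K, g x = Pi.single i y) :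
    K.map g = Submodule.pi Set.univ N := by
  ext y
  constructor
  · rintro ⟨x, hx, rfl⟩ i _
    exact h1 x hx i
  · intro hy
    rw [← Finset.univ_sum_single y]
    refine Submodule.sum_mem _ fun i _ => ?_
    obtain ⟨x, hx, hxy⟩ := h2 i (y i) (hy i trivial)
    exact ⟨x, hx, hxy⟩

lemma finrank_map_le_sum {ι : Type*} [Fintype ι] {V : Type*} [AddCommGroup V]
    [Module ℝ V] {K : Submodule ℝ M} {g : M →ₗ[ℝ] (ι → V)} {N : ι → Submodule ℝ V}
    [∀ i, FiniteDimensional ℝ (N i)] (h1 : ∀ x ∈ K, ∀ i, g x i ∈ N i) :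
    Module.finrank ℝ (K.map g) ≤ ∑ i, Module.finrank ℝ (N i) := by
  obtain ⟨hf, hr⟩ := finrank_pi_submodule N
  rw [← hr]
  refine Submodule.finrank_mono ?_
  rintro _ ⟨x, hx, rfl⟩ i _
  exact h1 x hx i

lemma finrank_map_eq_sum {ι : Type*} [Fintype ι] [DecidableEq ι] {V : Type*} [AddCommGroup V]
    [Module ℝ V] {K : Submodule ℝ M} {g : M →ₗ[ℝ] (ι → V)} {N : ι → Submodule ℝ V}
    [∀ i, FiniteDimensional ℝ (N i)] (h1 : ∀ x ∈ K, ∀ i, g x i ∈ N i)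
    (h2 : ∀ i, ∀ y ∈ N i, ∃ x ∈ K, g x = Pi.single i y) :
    Module.finrank ℝ (K.map g) = ∑ i, Module.finrank ℝ (N i) := by
  rw [map_eq_pi h1 h2]
  exact (finrank_pi_submodule N).2

/-- A finite-dimensional space of polynomials, embedded into any space of functions, is the range of
a linear retraction. -/
lemma exists_retraction (N : Submodule ℝ M) (f : M →ₗ[ℝ] A)
    (hf : ∀ x ∈ N, f x = 0 → x = 0) : ∃ Q : A →ₗ[ℝ] N, ∀ x : N, Q (f x) = x := by
  obtain ⟨Q, hQ⟩ := (f.domRestrict N).exists_leftInverse_of_injective (by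
    rw [LinearMap.ker_eq_bot']
    intro x hx
    exact Subtype.ext (hf x x.2 hx))
  exact ⟨Q, fun x => LinearMap.congr_fun hQ x⟩

/-- Interpolation by unisolvent degrees of freedom. -/
lemma exists_interpolation (N : Submodule ℝ M) [FiniteDimensional ℝ N] [FiniteDimensional ℝ B]
    (f : M →ₗ[ℝ] A) (L : A →ₗ[ℝ] B) (hL : ∀ x ∈ N, L (f x) = 0 → x = 0)
    (hdim : Module.finrank ℝ N = Module.finrank ℝ B) :
    ∃ Q : A →ₗ[ℝ] N, (∀ x : N, Q (f x) = x) ∧ ∀ u, L (f (Q u)) = L u := by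
  let e : N ≃ₗ[ℝ] B := LinearEquiv.ofInjectiveOfFinrankEq ((L ∘ₗ f).domRestrict N) (by
    rw [← LinearMap.ker_eq_bot, LinearMap.ker_eq_bot']
    intro x hx
    exact Subtype.ext (hL x x.2 hx)) hdim
  have he (x : N) : e x = L (f x) := rfl
  refine ⟨e.symm.toLinearMap ∘ₗ L, fun x => ?_, fun u => ?_⟩
  · rw [LinearMap.comp_apply, LinearEquiv.coe_coe, ← he, e.symm_apply_apply]
  · rw [LinearMap.comp_apply, LinearEquiv.coe_coe, ← he, e.apply_symm_apply]

/-- In a space of dimension at most one more than that of a subspace annihilated by a nonzero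
functional, that subspace is the kernel of the functional. -/
lemma mem_of_functional_eq_zero {N K : Submodule ℝ M} [FiniteDimensional ℝ N] (hK : K ≤ N)
    (hdim : Module.finrank ℝ N ≤ Module.finrank ℝ K + 1) {φ : M →ₗ[ℝ] ℝ}
    (hφ : ∀ x ∈ K, φ x = 0) (h1 : ∃ x ∈ N, φ x ≠ 0) {x : M} (hx : x ∈ N) (hx0 : φ x = 0) :
    x ∈ K := by
  have hle : K ≤ N ⊓ LinearMap.ker φ := le_inf hK hφ
  have : FiniteDimensional ℝ (N ⊓ LinearMap.ker φ : Submodule ℝ M) :=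
    Submodule.finiteDimensional_of_le inf_le_left
  have hlt : N ⊓ LinearMap.ker φ < N := by
    refine lt_of_le_of_ne inf_le_left fun h => ?_
    obtain ⟨y, hy, hy0⟩ := h1
    rw [← h] at hy
    exact hy0 hy.2
  have h2 := Submodule.finrank_lt_finrank_of_lt hlt
  have h3 : K = N ⊓ LinearMap.ker φ := Submodule.eq_of_le_of_finrank_le hle (by omega)
  rw [h3]
  exact ⟨hx, hx0⟩

lemma finrank_lt_of_functional {N K : Submodule ℝ M} [FiniteDimensional ℝ N] (hK : K ≤ N)
    {φ : M →ₗ[ℝ] ℝ} (hφ : ∀ x ∈ K, φ x = 0) (h1 : ∃ x ∈ N, φ x ≠ 0) :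
    Module.finrank ℝ K < Module.finrank ℝ N := by
  refine Submodule.finrank_lt_finrank_of_lt (lt_of_le_of_ne hK fun h => ?_)
  obtain ⟨y, hy, hy0⟩ := h1
  rw [← h] at hy
  exact hy0 (hφ y hy)

end LinearAlgebra

/-! ### Sequences on a segment -/

lemma mem_bubbleH1 {S : Seq1} {L : ℝ} {f : Polynomial ℝ} :
    f ∈ S.bubbleH L ↔ f ∈ S.H ∧ f.eval 0 = 0 ∧ f.eval L = 0 := by
  have : Seq1.bdryTrH L f = (f.eval 0, f.eval L) := rfl
  rw [Seq1.bubbleH, Submodule.mem_inf, LinearMap.mem_ker, this, Prod.mk_eq_zero]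

lemma const_of_derivative_eq_zero {f : Polynomial ℝ} (h : Polynomial.derivative f = 0) :
    ∃ a, f = Polynomial.C a :=
  ⟨_, Polynomial.eq_C_of_natDegree_eq_zero (Polynomial.derivative_eq_zero.1 h)⟩

instance (r : ℕ) : FiniteDimensional ℝ (P1 r) := by
  have : P1 r = Polynomial.degreeLT ℝ (r + 1) := by
    ext f
    rw [mem_P1, Polynomial.mem_degreeLT, Polynomial.natDegree_le_iff_degree_le,
      Polynomial.degree_le_iff_coeff_zero, Polynomial.degree_lt_iff_coeff_zero]
    exact forall_congr' fun m => by norm_cast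
  rw [this]
  exact Module.Finite.equiv (Polynomial.degreeLTEquiv ℝ (r + 1)).symm

lemma exists_antiderivative {r : ℕ} {g : Polynomial ℝ} (hg : g ∈ P1 r) :
    ∃ f ∈ P1 (r + 1), Polynomial.derivative f = g := by
  refine ⟨∑ i ∈ Finset.range (r + 1), Polynomial.monomial (i + 1) (g.coeff i / (i + 1)),
    Submodule.sum_mem _ fun i hi => ?_, ?_⟩
  · rw [mem_P1]
    exact (Polynomial.natDegree_monomial_le _).trans (by simpa using Finset.mem_range.1 hi)
  · rw [Polynomial.derivative_sum, Polynomial.as_sum_range' g (r + 1)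
      (Nat.lt_succ_of_le (mem_P1.1 hg))]
    refine Finset.sum_congr rfl fun i hi => ?_
    rw [Polynomial.derivative_monomial, ← Polynomial.as_sum_range' g (r + 1)
      (Nat.lt_succ_of_le (mem_P1.1 hg))]
    have : (i + 1 : ℝ) ≠ 0 := by positivity
    simp only [Nat.add_sub_cancel]
    congr 1
    push_cast
    field_simp

lemma derivative_mem_P1 {r : ℕ} {f : Polynomial ℝ} (hf : f ∈ P1 (r + 1)) :
    Polynomial.derivative f ∈ P1 r := by
  rw [mem_P1] at *
  exact (Polynomial.natDegree_derivative_le f).trans (by omega)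

lemma isCompatible1 {r : ℕ} {L : ℝ} (hL : L ≠ 0) {S : Seq1} (hH : S.H = P1 (r + 1))
    (hW : S.W = P1 r) : S.IsCompatible L where
  finH := by rw [hH]; infer_instance
  finW := by rw [hW]; infer_instance
  exact :=
    { ker_grad := by
        ext f
        rw [hH]
        constructor
        · rintro ⟨a, rfl⟩
          refine ⟨mem_P1.2 ?_, ?_⟩ <;> simp [Polynomial.algebraMap_eq]
        · rintro ⟨-, h⟩
          obtain ⟨a, rfl⟩ := const_of_derivative_eq_zero h
          exact ⟨a, rfl⟩
      range_grad := by
        ext g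
        rw [hH, hW]
        constructor
        · rintro ⟨f, hf, rfl⟩
          exact derivative_mem_P1 hf
        · intro hg
          obtain ⟨f, hf, h⟩ := exists_antiderivative hg
          exact ⟨f, hf, h⟩ }
  dim_trH := by
    have : S.H.map (Seq1.bdryTrH L) = ⊤ := by
      rw [eq_top_iff, hH]
      rintro ⟨a, b⟩ -
      refine ⟨Polynomial.C ((b - a) / L) * Polynomial.X + Polynomial.C a,
        mem_P1.2 (Polynomial.natDegree_linear_le.trans (by omega)), ?_⟩
      have h (f : Polynomial ℝ) : Seq1.bdryTrH L f = (f.eval 0, f.eval L) := rfl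
      rw [h]
      simp [hL]
    rw [this, finrank_top]
    simp

/-- End point values give `dim H = 2 + dim bubbles`, while exactness gives `dim H = 1 + dim W`. -/
lemma Seq1.IsCompatible.finrank_W {S : Seq1} {L : ℝ} (h : S.IsCompatible L) :
    Module.finrank ℝ S.W = Module.finrank ℝ (S.bubbleH L) + 1 := by
  have := h.finH
  have h1 := finrank_map_add_inf_ker S.H (Seq1.bdryTrH L)
  have h2 := finrank_map_add_inf_ker S.H (Polynomial.derivative (R := ℝ))
  rw [h.exact.range_grad, ← h.exact.ker_grad, LinearMap.finrank_range_of_inj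
    (FaithfulSMul.algebraMap_injective ℝ (Polynomial ℝ)), Module.finrank_self] at h2
  rw [h.dim_trH] at h1
  rw [Seq1.bubbleH]
  omega

/-- The degree `n` of the cofactor is part of the conclusion, with `n + 2 ≤ m`, because `m - 2`
would be truncated for small `m`, where no nonzero bubble exists. -/
lemma bubble_factor {m : ℕ} {L : ℝ} (hL : L ≠ 0) {h : Polynomial ℝ} (hm : h ∈ P1 m)
    (h0 : h.eval 0 = 0) (h1 : h.eval L = 0) (hne : h ≠ 0) :
    ∃ n g, n + 2 ≤ m ∧ g ∈ P1 n ∧ h = Polynomial.X * (Polynomial.C L - Polynomial.X) * g := by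
  obtain ⟨f, rfl⟩ := Polynomial.dvd_iff_isRoot.2 (show h.IsRoot 0 from h0)
  rw [Polynomial.C_0, sub_zero] at *
  rw [Polynomial.eval_mul, Polynomial.eval_X] at h1
  obtain ⟨g, rfl⟩ := Polynomial.dvd_iff_isRoot.2
    (show f.IsRoot L from (mul_eq_zero.1 h1).resolve_left hL)
  have hg : g ≠ 0 := by
    rintro rfl
    simp at hne
  refine ⟨g.natDegree, -g, ?_, mem_P1.2 (by rw [Polynomial.natDegree_neg]), by ring⟩
  rw [mem_P1, Polynomial.natDegree_mul Polynomial.X_ne_zero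
    (mul_ne_zero (Polynomial.X_sub_C_ne_zero L) hg),
    Polynomial.natDegree_mul (Polynomial.X_sub_C_ne_zero L) hg, Polynomial.natDegree_X,
    Polynomial.natDegree_X_sub_C] at hm
  omega

/-! ### Affine functions -/

open MvPolynomial

section Affine

variable {d : ℕ} {p q : Fin d → ℝ}

lemma affine_eq {f : Poly d} (hf : f ∈ P d 1) :
    ∃ (a : ℝ) (b : Fin d → ℝ), f = C a + ∑ i, C (b i) * X i := by
  have h (i : Fin d) : ∃ b, pderiv i f = C b := by
    have := pderiv_mem_P i hf
    rw [mem_P, Nat.le_zero, totalDegree_eq_zero_iff_eq_C] at this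
    exact ⟨_, this⟩
  choose b hb using h
  have hk : f - ∑ i, C (b i) * X i ∈ LinearMap.ker (grad d) := by
    rw [LinearMap.mem_ker]
    funext j
    rw [grad_apply, map_sub, hb, map_sum]
    simp [pderiv_X, Pi.single_apply]
  rw [ker_grad_eq_constants] at hk
  obtain ⟨a, ha⟩ := hk
  rw [Algebra.linearMap_apply, algebraMap_eq] at ha
  exact ⟨a, b, by rw [ha]; ring⟩

lemma edgeAlg_affine (h : p ≠ q) {f : Poly d} (hf : f ∈ P d 1) :
    edgeAlg p q f = Polynomial.C (eval p f) +
      Polynomial.C ((eval q f - eval p f) / edgeLen p q) * Polynomial.X := by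
  obtain ⟨a, b, hab⟩ := Polynomial.exists_eq_X_add_C_of_natDegree_le_one
    (mem_P1.1 (edgeTrH_mem_P1 (p := p) (q := q) hf))
  rw [edgeTrH_apply] at hab
  have h1 := bdryTrH_edgeTrH h f
  have h2 : Seq1.bdryTrH (edgeLen p q) (edgeTrH p q f) = ((edgeAlg p q f).eval 0,
    (edgeAlg p q f).eval (edgeLen p q)) := rfl
  rw [h2, hab] at h1
  simp only [Polynomial.eval_add, Polynomial.eval_mul, Polynomial.eval_C, Polynomial.eval_X,
    mul_zero, zero_add, Prod.mk.injEq] at h1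
  have hL := (edgeLen_pos h).ne'
  rw [hab, ← h1.1, ← h1.2, add_sub_cancel_right, mul_div_cancel_right₀ _ hL, add_comm]

lemma edgeAlg_affine_eq_zero (h : p ≠ q) {f : Poly d} (hf : f ∈ P d 1) (hp : eval p f = 0)
    (hq : eval q f = 0) : edgeAlg p q f = 0 := by
  rw [edgeAlg_affine h hf, hp, hq]
  simp

/-- Extension of functions on an edge that vanish at the end points. -/
lemma edge_extension (h : p ≠ q) {a b : Poly d} (ha : a ∈ P d 1) (hb : b ∈ P d 1)
    (hap : eval p a = 1) (haq : eval q a = 0) (hbp : eval p b = 0) (hbq : eval q b = 1)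
    {m : ℕ} {f : Polynomial ℝ} (hf : f ∈ P1 m) (h0 : f.eval 0 = 0)
    (h1 : f.eval (edgeLen p q) = 0) :
    ∃ g, a * b * g ∈ P d m ∧ edgeAlg p q (a * b * g) = f := by
  by_cases hne : f = 0
  · exact ⟨0, by simp [hne]⟩
  have hL := (edgeLen_pos h).ne'
  obtain ⟨n, g, hn, hg, rfl⟩ := bubble_factor hL hf h0 h1 hne
  -- On the edge `a b` is `(1 - s/L)(s/L) = s (L - s)/L²`, hence the factor `L²`.
  refine ⟨C (edgeLen p q ^ 2) * edgeLift p q g, P_mono hn ?_, ?_⟩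
  · rw [add_comm]
    exact mul_mem_P (mul_mem_P ha hb) (C_mul_mem_P _ (edgeLift_mem hg))
  · rw [map_mul, map_mul, map_mul, edgeAlg_affine h ha, edgeAlg_affine h hb, hap, haq, hbp, hbq,
      edgeAlg_edgeLift h, edgeAlg_C]
    have h2 : Polynomial.C (edgeLen p q) * Polynomial.C (1 / edgeLen p q) = 1 := by
      rw [← Polynomial.C_mul, mul_one_div_cancel hL, Polynomial.C_1]
    have h3 : (0 - 1) / edgeLen p q = -(1 / edgeLen p q) := by ring
    rw [h3, sub_zero, Polynomial.C_neg, Polynomial.C_1, Polynomial.C_0, Polynomial.C_pow]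
    generalize Polynomial.C (1 / edgeLen p q) = s at h2 ⊢
    linear_combination (Polynomial.X * g *
      (Polynomial.C (edgeLen p q) - Polynomial.X * (Polynomial.C (edgeLen p q) * s + 1))) * h2

end Affine

end FES

namespace FES

open MvPolynomial

/-! ### Sequences on a triangle -/

/-- Values of a polynomial at given points. -/
def pointTr {d : ℕ} {ι : Type*} (T : ι → Fin d → ℝ) : Poly d →ₗ[ℝ] (ι → ℝ) :=
  LinearMap.pi fun j => (MvPolynomial.aeval (T j)).toLinearMap

lemma pointTr_apply {d : ℕ} {ι : Type*} (T : ι → Fin d → ℝ) (f : Poly d) (j : ι) :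
    pointTr T f j = eval (T j) f := rfl

/-- Barycentric coordinates with respect to the points `T`. -/
structure IsBarycentric {d : ℕ} {ι : Type*} [DecidableEq ι] (T : ι → Fin d → ℝ)
    (μ : ι → Poly d) : Prop where
  degree : ∀ j, μ j ∈ P d 1
  eval : ∀ l j, eval (T l) (μ j) = if l = j then 1 else 0

namespace IsBarycentric

variable {d : ℕ} {ι : Type*} [DecidableEq ι] {T : ι → Fin d → ℝ} {μ : ι → Poly d}

lemma eval_self (h : IsBarycentric T μ) (j : ι) : MvPolynomial.eval (T j) (μ j) = 1 := by
  rw [h.eval, if_pos rfl]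

lemma eval_ne (h : IsBarycentric T μ) {l j : ι} (hlj : l ≠ j) :
    MvPolynomial.eval (T l) (μ j) = 0 := by
  rw [h.eval, if_neg hlj]

lemma ne (h : IsBarycentric T μ) {l j : ι} (hlj : l ≠ j) : T l ≠ T j := fun he => by
  have := h.eval_self l
  rw [he, h.eval_ne hlj.symm] at this
  exact zero_ne_one this

lemma edgeAlg_eq_zero (h : IsBarycentric T μ) {a b j : ι} (hab : a ≠ b) (ha : a ≠ j)
    (hb : b ≠ j) : edgeAlg (T a) (T b) (μ j) = 0 :=
  edgeAlg_affine_eq_zero (h.ne hab) (h.degree j) (h.eval_ne ha) (h.eval_ne hb)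

lemma finrank_map_pointTr [Fintype ι] (h : IsBarycentric T μ) {m : ℕ} (hm : 1 ≤ m) :
    Module.finrank ℝ ((P d m).map (pointTr T)) = Fintype.card ι := by
  have : (P d m).map (pointTr T) = ⊤ := by
    rw [eq_top_iff]
    rintro y -
    refine ⟨∑ j, y j • μ j, Submodule.sum_mem _ fun j _ =>
      Submodule.smul_mem _ _ (P_mono hm (h.degree j)), ?_⟩
    funext l
    rw [pointTr_apply, map_sum]
    simp [smul_eval, h.eval]
  rw [this, finrank_top, Module.finrank_fintype_fun_eq_card]

end IsBarycentric

lemma edgeTrH_const {d : ℕ} {p q : Fin d → ℝ} (h : p ≠ q) {f : Poly d}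
    (hf : edgeTrE p q (grad d f) = 0) :
    edgeTrH p q f = Polynomial.C (eval p f) ∧ eval q f = eval p f := by
  rw [← derivative_edgeTrH] at hf
  obtain ⟨a, ha⟩ := const_of_derivative_eq_zero hf
  have h1 := bdryTrH_edgeTrH h f
  have h2 : Seq1.bdryTrH (edgeLen p q) (edgeTrH p q f) = ((edgeTrH p q f).eval 0,
    (edgeTrH p q f).eval (edgeLen p q)) := rfl
  rw [h2, ha, Polynomial.eval_C, Polynomial.eval_C, Prod.mk.injEq] at h1
  exact ⟨by rw [ha, h1.1], by rw [← h1.1, ← h1.2]⟩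

lemma mem_bubbleH_edgeTrH {d : ℕ} {p q : Fin d → ℝ} (h : p ≠ q) {S : Seq1} {f : Poly d}
    (hf : edgeTrH p q f ∈ S.H) :
    edgeTrH p q f ∈ S.bubbleH (edgeLen p q) ↔ eval p f = 0 ∧ eval q f = 0 := by
  rw [Seq1.bubbleH, Submodule.mem_inf, LinearMap.mem_ker, bdryTrH_edgeTrH h, Prod.mk_eq_zero]
  exact and_iff_right hf

lemma finrank_constants (d : ℕ) : Module.finrank ℝ (constants d) = 1 := by
  rw [constants, LinearMap.finrank_range_of_inj (f := Algebra.linearMap ℝ (Poly d))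
      (MvPolynomial.C_injective _ _),
    Module.finrank_self]

lemma Seq2.mem_bubbleH {S : Seq2} {T : Fin 3 → Fin 2 → ℝ} {f : Poly 2} : f ∈ S.bubbleH T ↔
    f ∈ S.H ∧ ∀ j, edgeTrH (T (j + 1)) (T (j + 2)) f = 0 := by
  rw [Seq2.bubbleH, Submodule.mem_inf, LinearMap.mem_ker, funext_iff]
  rfl

lemma Seq2.mem_bubbleE {S : Seq2} {T : Fin 3 → Fin 2 → ℝ} {v : PolyVec 2} : v ∈ S.bubbleE T ↔
    v ∈ S.E ∧ ∀ j, edgeTrE (T (j + 1)) (T (j + 2)) v = 0 := by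
  rw [Seq2.bubbleE, Submodule.mem_inf, LinearMap.mem_ker, funext_iff]
  rfl

section Triangle

variable {S : Seq2} {r : ℕ} {T : Fin 3 → Fin 2 → ℝ} {μ : Fin 3 → Poly 2}

lemma fin3_ne (j : Fin 3) : j + 1 ≠ j + 2 ∧ j + 1 ≠ j ∧ j + 2 ≠ j := by
  fin_cases j <;> decide

lemma fin3_cases (j l : Fin 3) : l = j ∨ l = j + 1 ∨ l = j + 2 := by
  fin_cases j <;> fin_cases l <;> decide

/-- After the vertex values are peeled off, a bubble on one edge is extended as the product of the
barycentric coordinates of its end points with a polynomial; this product vanishes on the other two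
edges. -/
lemma finrank_bdryTrH2 (hμ : IsBarycentric T μ) (hH : S.H = P 2 (r + 1)) :
    Module.finrank ℝ (S.H.map (Seq2.bdryTrH T)) = (∑ _v : Fin 3, 1) +
      ∑ j : Fin 3, Module.finrank ℝ ((S.edgeTrace (T (j + 1)) (T (j + 2))).bubbleH
        (edgeLen (T (j + 1)) (T (j + 2)))) := by
  have hT (j : Fin 3) : T (j + 1) ≠ T (j + 2) := hμ.ne (fin3_ne j).1
  have hHj (j : Fin 3) : (S.edgeTrace (T (j + 1)) (T (j + 2))).H = P1 (r + 1) := by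
    rw [Seq2.edgeTrace, hH]
    exact map_edgeTrH_P (hT j) _
  have hfin : FiniteDimensional ℝ S.H := by rw [hH]; infer_instance
  have hfinj (j : Fin 3) : FiniteDimensional ℝ ((S.edgeTrace (T (j + 1)) (T (j + 2))).bubbleH
        (edgeLen (T (j + 1)) (T (j + 2)))) := by
    have : FiniteDimensional ℝ (S.edgeTrace (T (j + 1)) (T (j + 2))).H := by
      rw [hHj]; infer_instance
    exact Submodule.finiteDimensional_of_le inf_le_left
  rw [finrank_map_split S.H (pointTr T)]
  · congr 1
    · rw [hH, hμ.finrank_map_pointTr (by omega)]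
      simp
    · refine finrank_map_eq_sum ?_ ?_
      · rintro f ⟨hf, hf0⟩ j
        have hv (l : Fin 3) : eval (T l) f = 0 := congrFun hf0 l
        exact (mem_bubbleH_edgeTrH (S := S.edgeTrace _ _) (hT j)
          (Submodule.mem_map_of_mem hf)).2 ⟨hv _, hv _⟩
      · intro j y hy
        obtain ⟨hy, h0, h1⟩ := mem_bubbleH1.1 hy
        rw [hHj] at hy
        obtain ⟨h12, h10, h20⟩ := fin3_ne j
        obtain ⟨g, hg, hgy⟩ := edge_extension (hT j) (hμ.degree (j + 1)) (hμ.degree (j + 2))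
          (hμ.eval_self _) (hμ.eval_ne h12.symm) (hμ.eval_ne h12) (hμ.eval_self _) hy h0 h1
        refine ⟨_, ⟨by rw [hH]; exact hg, ?_⟩, ?_⟩
        · rw [SetLike.mem_coe, LinearMap.mem_ker]
          funext l
          rw [pointTr_apply, map_mul, map_mul, hμ.eval, hμ.eval]
          split_ifs with ha hb
          · exact absurd (ha.symm.trans hb) h12
          all_goals simp
        · funext l
          have hl : Seq2.bdryTrH T (μ (j + 1) * μ (j + 2) * g) l =
            edgeAlg (T (l + 1)) (T (l + 2)) (μ (j + 1) * μ (j + 2) * g) := rfl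
          rw [hl]
          by_cases hjl : l = j
          · rw [hjl, Pi.single_eq_same, hgy]
          · rw [Pi.single_eq_of_ne hjl, map_mul, map_mul]
            obtain ⟨l12, l10, l20⟩ := fin3_ne l
            rcases fin3_cases j l with h | h | h
            · exact absurd h hjl
            · rw [← h, hμ.edgeAlg_eq_zero l12 l10 l20, zero_mul, zero_mul]
            · rw [← h, hμ.edgeAlg_eq_zero l12 l10 l20, mul_zero, zero_mul]
  · rintro f ⟨hf, hf0⟩
    rw [LinearMap.mem_ker]
    funext l
    -- The vertex `l` is the second end point of the edge `l + 1`, the indices being taken modulo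
    -- `3`.
    have h1 : edgeTrH (T (l + 1 + 1)) (T (l + 1 + 2)) f = 0 := congrFun hf0 (l + 1)
    have h2 := bdryTrH_edgeTrH (hT (l + 1)) f
    rw [h1, map_zero] at h2
    have h3 : l + 1 + 2 = l := by rw [add_assoc]; exact add_zero l
    rw [h3] at h2
    exact (congrArg Prod.snd h2).symm

/-- A potential of such a field has zero derivative along every edge, so it is constant on the
connected boundary; subtracting that constant makes it a bubble. -/
lemma bubbleE_inf_ker_curl (hT : ∀ j : Fin 3, T (j + 1) ≠ T (j + 2)) (hS : S.IsExact)  :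
    S.bubbleE T ⊓ LinearMap.ker curl2 = (S.bubbleH T).map (grad 2) := by
  ext v
  constructor
  · rintro ⟨hv, hc⟩
    obtain ⟨hv, hv0⟩ := Seq2.mem_bubbleE.1 hv
    have h1 : v ∈ S.H.map (grad 2) := by rw [hS.range_grad]; exact ⟨hv, hc⟩
    obtain ⟨f, hf, rfl⟩ := h1
    have hC : C (eval (T 0) f) ∈ S.H ⊓ LinearMap.ker (grad 2) := by
      rw [← hS.ker_grad]
      exact ⟨_, rfl⟩
    have hj (j : Fin 3) := edgeTrH_const (hT j) (hv0 j)
    have h2 : eval (T 2) f = eval (T 1) f := (hj 0).2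
    have h0 : eval (T 0) f = eval (T 2) f := (hj 1).2
    have h1 : eval (T 1) f = eval (T 0) f := (hj 2).2
    have hall : ∀ j : Fin 3, eval (T (j + 1)) f = eval (T 0) f := by
      intro j
      fin_cases j
      · exact h1
      · exact h0.symm
      · rfl
    refine ⟨f - C (eval (T 0) f), Seq2.mem_bubbleH.2 ⟨Submodule.sub_mem _ hf hC.1, fun j => ?_⟩, ?_⟩
    · rw [map_sub, (hj j).1, hall, edgeTrH_apply, edgeAlg_C, sub_self]
    · rw [map_sub, LinearMap.mem_ker.1 hC.2, sub_zero]
  · rintro ⟨f, hf, rfl⟩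
    obtain ⟨hf, hf0⟩ := Seq2.mem_bubbleH.1 hf
    have h1 : grad 2 f ∈ S.E ⊓ LinearMap.ker curl2 := by
      rw [← hS.range_grad]; exact ⟨f, hf, rfl⟩
    refine ⟨Seq2.mem_bubbleE.2 ⟨h1.1, fun j => ?_⟩, h1.2⟩
    rw [← derivative_edgeTrH, hf0, Polynomial.derivative_zero]

lemma grad_injOn_of_eval {d : ℕ} {p : Fin d → ℝ} {f : Poly d} (hf : grad d f = 0)
    (hp : eval p f = 0) : f = 0 := by
  have : f ∈ constants d := by rw [← ker_grad_eq_constants]; exact hf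
  obtain ⟨a, rfl⟩ := this
  have ha : a = 0 := by simpa [algebraMap_eq] using hp
  rw [ha, map_zero]

lemma finrank_map_grad_of_eval {d : ℕ} {N : Submodule ℝ (Poly d)} [FiniteDimensional ℝ N]
    {p : Fin d → ℝ} (h : ∀ f ∈ N, eval p f = 0) :
    Module.finrank ℝ (N.map (grad d)) = Module.finrank ℝ N := by
  rw [← finrank_map_add_inf_ker N (grad d)]
  have : N ⊓ LinearMap.ker (grad d) = ⊥ :=
    (Submodule.eq_bot_iff _).2 fun f hf => grad_injOn_of_eval hf.2 (h f hf.1)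
  rw [this, finrank_bot, add_zero]

lemma eval_eq_zero_of_edgeTrH {d : ℕ} {p q : Fin d → ℝ} {f : Poly d} (h : edgeTrH p q f = 0) :
    eval p f = 0 := by
  have := eval_edgeTrH p q 0 f
  rw [h, zero_smul, add_zero, Polynomial.eval_zero] at this
  exact this.symm

lemma finrank_grad_bubbleH2 [FiniteDimensional ℝ S.H] :
    Module.finrank ℝ ((S.bubbleH T).map (grad 2)) = Module.finrank ℝ (S.bubbleH T) := by
  have : FiniteDimensional ℝ (S.bubbleH T) := Submodule.finiteDimensional_of_le inf_le_left
  exact finrank_map_grad_of_eval fun f hf =>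
    eval_eq_zero_of_edgeTrH ((Seq2.mem_bubbleH.1 hf).2 0)

/-- Compatibility of a sequence on a triangle and the dimension of the image of the bubbles,
given a functional that vanishes on the curls of bubbles. -/
theorem isCompatible2 (hμ : IsBarycentric T μ) (hH : S.H = P 2 (r + 1))
    (finE : FiniteDimensional ℝ S.E) (finW : FiniteDimensional ℝ S.W) (hS : S.IsExact)
    (hedge : ∀ p q : Fin 2 → ℝ, p ≠ q → S.E.map (edgeTrE p q) = P1 r)
    (φ : Poly 2 →ₗ[ℝ] ℝ) (hφ : ∀ v ∈ S.bubbleE T, φ (curl2 v) = 0) (hφ1 : ∃ w ∈ S.W, φ w ≠ 0) :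
    S.IsCompatible T ∧
      Module.finrank ℝ S.W = Module.finrank ℝ ((S.bubbleE T).map curl2) + 1 := by
  have hT (j : Fin 3) : T (j + 1) ≠ T (j + 2) := hμ.ne (fin3_ne j).1
  have finH : FiniteDimensional ℝ S.H := by rw [hH]; infer_instance
  have edge (j : Fin 3) : (S.edgeTrace (T (j + 1)) (T (j + 2))).IsCompatible
      (edgeLen (T (j + 1)) (T (j + 2))) := by
    refine isCompatible1 (r := r) (edgeLen_pos (hT j)).ne' ?_ (hedge _ _ (hT j))
    rw [Seq2.edgeTrace, hH]
    exact map_edgeTrH_P (hT j) _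
  have dimH := finrank_bdryTrH2 hμ hH
  have : FiniteDimensional ℝ (S.bubbleE T) := Submodule.finiteDimensional_of_le inf_le_left
  have e1 := finrank_map_add_inf_ker S.E (Seq2.bdryTrE T)
  have e2 := finrank_map_add_inf_ker (S.bubbleE T) curl2
  rw [bubbleE_inf_ker_curl hT hS, finrank_grad_bubbleH2] at e2
  -- The functional vanishes on curls of bubbles but not on `W`, so at least one dimension is lost.
  have e3 : Module.finrank ℝ ((S.bubbleE T).map curl2) < Module.finrank ℝ S.W := by
    refine finrank_lt_of_functional (φ := φ) ?_ ?_ hφ1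
    · rw [← hS.range_curl]
      exact Submodule.map_mono inf_le_left
    · rintro _ ⟨v, hv, rfl⟩
      exact hφ v hv
  have e4 := finrank_map_add_inf_ker S.H (Seq2.bdryTrH T)
  have e5 := finrank_map_add_inf_ker S.H (grad 2)
  have e6 := finrank_map_add_inf_ker S.E curl2
  rw [← hS.ker_grad, finrank_constants] at e5
  rw [← hS.range_grad, hS.range_curl] at e6
  -- Only this upper bound for the tangential traces is direct. With exactness and the scalar
  -- traces, `e3` gives the same number as a lower bound, so both `e7` and `e3` are sharp.
  have e7 : Module.finrank ℝ (S.E.map (Seq2.bdryTrE T)) ≤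
      ∑ j : Fin 3, Module.finrank ℝ (S.edgeTrace (T (j + 1)) (T (j + 2))).W := by
    have (j : Fin 3) : FiniteDimensional ℝ (S.edgeTrace (T (j + 1)) (T (j + 2))).W := (edge j).finW
    exact finrank_map_le_sum (N := fun j => (S.edgeTrace (T (j + 1)) (T (j + 2))).W)
      fun v hv j => ⟨v, hv, rfl⟩
  have e8 : ∑ j : Fin 3, Module.finrank ℝ (S.edgeTrace (T (j + 1)) (T (j + 2))).W =
      ∑ j : Fin 3, Module.finrank ℝ ((S.edgeTrace (T (j + 1)) (T (j + 2))).bubbleH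
        (edgeLen (T (j + 1)) (T (j + 2)))) + ∑ _v : Fin 3, 1 := by
    rw [← Finset.sum_add_distrib]
    exact Finset.sum_congr rfl fun j _ => (edge j).finrank_W
  have e9 : S.H ⊓ LinearMap.ker (Seq2.bdryTrH T) = S.bubbleH T := rfl
  have e10 : S.E ⊓ LinearMap.ker (Seq2.bdryTrE T) = S.bubbleE T := rfl
  rw [e9] at e4
  rw [e10] at e1
  simp only [Finset.sum_const, Finset.card_univ, Fintype.card_fin, smul_eq_mul, mul_one] at *
  refine ⟨⟨finH, finE, finW, hS, edge, ?_, ?_⟩, ?_⟩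
  · simpa using dimH
  · omega
  · omega

end Triangle

end FES

namespace FES

open MvPolynomial

/-! ### Barycentric coordinates of the tetrahedron -/

namespace FaceChart

variable {i : Fin 4} (c : FaceChart i)

/-- Signed height of the opposite vertex. -/
def height : ℝ := (vertex i - c.origin) ⬝ᵥ c.n

lemma height_ne : c.height ≠ 0 := c.outward.ne

/-- The affine function that vanishes on the face and equals `1` at the opposite vertex. -/
def bary : Poly 3 := ∑ m, C (c.height⁻¹ * c.n m) * (X m - C (c.origin m))

lemma bary_mem : c.bary ∈ P 3 1 :=
  Submodule.sum_mem _ fun _ _ => C_mul_mem_P _ (Submodule.sub_mem _ (X_mem_P _) (C_mem_P _ _))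

lemma eval_bary (x : Fin 3 → ℝ) : eval x c.bary = c.height⁻¹ * ((x - c.origin) ⬝ᵥ c.n) := by
  simp only [bary, map_sum, map_mul, map_sub, eval_C, eval_X, dotProduct, Pi.sub_apply,
    Finset.mul_sum]
  exact Finset.sum_congr rfl fun m _ => by ring

lemma trH_bary : c.trH c.bary = 0 := by
  have h1 := c.t₁_n
  have h2 := c.t₂_n
  rw [dotProduct, Fin.sum_univ_three] at h1 h2
  have h1' := congrArg (C : ℝ → Poly 2) h1
  have h2' := congrArg (C : ℝ → Poly 2) h2
  simp only [C_add, C_mul, C_0] at h1' h2'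
  simp only [trH_apply, bary, Fin.sum_univ_three, map_add, map_mul, map_sub, trAlg_X, trAlg_C]
  linear_combination C (c.height⁻¹) * (X 0 * h1' + X 1 * h2')

end FaceChart

lemma isBarycentric_bary (c : ∀ i, FaceChart i) :
    IsBarycentric vertex fun i => (c i).bary where
  degree i := (c i).bary_mem
  eval l j := by
    rw [FaceChart.eval_bary]
    split_ifs with h
    · rw [h]
      exact inv_mul_cancel₀ (c j).height_ne
    · have : (vertex l - (c j).origin) ⬝ᵥ (c j).n = 0 := (c j).in_plane l h
      rw [this, mul_zero]

lemma affine_eq_zero {f : Poly 3} (hf : f ∈ P 3 1) (h : ∀ v, eval (vertex v) f = 0) : f = 0 := by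
  obtain ⟨a, b, rfl⟩ := affine_eq hf
  have h0 := h 0
  have h1 := h 1
  have h2 := h 2
  have h3 := h 3
  simp only [vertex_zero, vertex_one, vertex_two, vertex_three, Fin.sum_univ_three, map_add,
    map_mul, eval_C, eval_X, Matrix.cons_val] at h0 h1 h2 h3
  have ha : a = 0 := by linarith
  have hb0 : b 0 = 0 := by linarith
  have hb1 : b 1 = 0 := by linarith
  have hb2 : b 2 = 0 := by linarith
  simp [Fin.sum_univ_three, ha, hb0, hb1, hb2]

lemma affine_eq_sum_bary (c : ∀ i, FaceChart i) {f : Poly 3} (hf : f ∈ P 3 1) :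
    f = ∑ v, C (eval (vertex v) f) * (c v).bary := by
  rw [← sub_eq_zero]
  refine affine_eq_zero (Submodule.sub_mem _ hf (Submodule.sum_mem _ fun v _ =>
    C_mul_mem_P _ (c v).bary_mem)) fun v => ?_
  have := (isBarycentric_bary c).eval v
  simp [this]

lemma sum_bary (c : ∀ i, FaceChart i) : ∑ v, (c v).bary = 1 := by
  have := affine_eq_sum_bary c (one_mem_P 1)
  simp only [map_one, one_mul] at this
  exact this.symm

lemma sum_bary_mul_vertex (c : ∀ i, FaceChart i) (m : Fin 3) :
    ∑ v, (c v).bary * C (vertex v m) = X m := by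
  have := affine_eq_sum_bary c (X_mem_P m)
  simp only [eval_X] at this
  rw [this]
  exact Finset.sum_congr rfl fun v _ => mul_comm _ _

/-- The constant `1` and every coordinate `x_i` are combinations of the barycentric coordinates, so
one linear factor of each monomial, or the factor `1`, can be expanded in them. -/
lemma exists_bary_decomp (c : ∀ i, FaceChart i) {k : ℕ} {f : Poly 3} (hf : f ∈ P 3 (k + 1)) :
    ∃ g : Fin 4 → Poly 3, (∀ v, g v ∈ P 3 k) ∧ f = ∑ v, (c v).bary * g v := by
  let N : Submodule ℝ (Poly 3) := (Submodule.pi Set.univ fun _ : Fin 4 => P 3 k).map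
    (∑ v, LinearMap.mulLeft ℝ (c v).bary ∘ₗ LinearMap.proj v)
  suffices h : f ∈ N by
    obtain ⟨g, hg, rfl⟩ := h
    exact ⟨g, fun v => hg v trivial, by simp⟩
  suffices h : P 3 (k + 1) ≤ N from h hf
  refine P_le_of_monomial fun m hm => ?_
  have key (a : Fin 4 → ℝ) {q : Poly 3} (hq : q ∈ P 3 k) :
      (∑ v, (c v).bary * C (a v)) * q ∈ N := by
    refine ⟨fun v => C (a v) * q, fun v _ => C_mul_mem_P _ hq, ?_⟩
    simp [Finset.sum_mul, mul_assoc]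
  by_cases h0 : m = 0
  · rw [h0]
    have := key 1 (one_mem_P k)
    simpa [sum_bary c] using this
  · obtain ⟨i, hi⟩ := Finsupp.ne_iff.1 h0
    have h1 : Finsupp.single i 1 + (m - Finsupp.single i 1) = m := by
      refine add_tsub_cancel_of_le ?_
      rw [Finsupp.single_le_iff]
      exact Nat.one_le_iff_ne_zero.2 (by simpa using hi)
    have h2 : (monomial m 1 : Poly 3) = X i * monomial (m - Finsupp.single i 1) 1 := by
      rw [X, monomial_mul, h1, one_mul]
    have h3 := congrArg Finsupp.degree h1
    rw [map_add, Finsupp.degree_single] at h3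
    rw [h2, ← sum_bary_mul_vertex c i]
    exact key _ (mem_P.2 ((totalDegree_monomial_le _ _).trans (by
      change (m - Finsupp.single i 1).degree ≤ k
      omega)))

lemma vertex_injective : Function.Injective vertex := by
  intro a b h
  by_contra hne
  exact (isBarycentric_bary fun _ => Classical.arbitrary _).ne hne h

lemma Edge.p_ne_q (e : Edge) : e.p ≠ e.q := fun h => e.2.ne (vertex_injective h)

namespace FaceChart

variable {i : Fin 4} (c : FaceChart i)

/-- The barycentric coordinates of a face are the traces of those of the tetrahedron. -/
lemma isBarycentric_trH (c : ∀ i, FaceChart i) (i : Fin 4) :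
    IsBarycentric (c i).triangle fun j => (c i).trH (c (i.succAbove j)).bary where
  degree j := (c i).trH_mem_P (c _).bary_mem
  eval l j := by
    rw [trH_apply, eval_trAlg, triangle, point_coord_vertex _ (Fin.succAbove_ne i l),
      (isBarycentric_bary c).eval]
    simp

lemma edgeTrH_eq_zero_of_edges {u : Poly 3}
    (h : ∀ e : Edge, e.1.1 ≠ i → e.1.2 ≠ i → edgeTrH e.p e.q u = 0) {a b : Fin 4}
    (ha : a ≠ i) (hb : b ≠ i) (hab : a ≠ b) : edgeTrH (vertex a) (vertex b) u = 0 := by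
  rcases lt_or_gt_of_ne hab with hlt | hlt
  · exact h ⟨(a, b), hlt⟩ ha hb
  · exact edgeTrH_symm_eq_zero (vertex_injective.ne hab.symm) (h ⟨(b, a), hlt⟩ hb ha)

lemma edgeTrE_eq_zero_of_edges {u : PolyVec 3}
    (h : ∀ e : Edge, e.1.1 ≠ i → e.1.2 ≠ i → edgeTrE e.p e.q u = 0) {a b : Fin 4}
    (ha : a ≠ i) (hb : b ≠ i) (hab : a ≠ b) : edgeTrE (vertex a) (vertex b) u = 0 := by
  rcases lt_or_gt_of_ne hab with hlt | hlt
  · exact h ⟨(a, b), hlt⟩ ha hb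
  · exact edgeTrE_symm_eq_zero (vertex_injective.ne hab.symm) (h ⟨(b, a), hlt⟩ hb ha)

lemma edgeTrH_triangle (a b : Fin 3) (u : Poly 3) : edgeTrH (c.triangle a) (c.triangle b) (c.trH u) =
    edgeTrH (vertex (i.succAbove a)) (vertex (i.succAbove b)) u :=
  c.edgeTrH_trH (Fin.succAbove_ne i a) (Fin.succAbove_ne i b) u

lemma edgeTrE_triangle (a b : Fin 3) (u : PolyVec 3) :
    edgeTrE (c.triangle a) (c.triangle b) (c.trE u) =
    edgeTrE (vertex (i.succAbove a)) (vertex (i.succAbove b)) u :=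
  c.edgeTrE_trE (Fin.succAbove_ne i a) (Fin.succAbove_ne i b) u

lemma trH_mem_bubbleH {S : Seq3} {u : Poly 3} (hu : u ∈ S.H)
    (h : ∀ e : Edge, e.1.1 ≠ i → e.1.2 ≠ i → edgeTrH e.p e.q u = 0) :
    c.trH u ∈ (S.faceTrace c).bubbleH c.triangle :=
  Seq2.mem_bubbleH.2 ⟨⟨u, hu, rfl⟩, fun j => by
    rw [edgeTrH_triangle]
    exact edgeTrH_eq_zero_of_edges h (Fin.succAbove_ne i _) (Fin.succAbove_ne i _)
      ((Fin.succAbove_right_injective).ne (fin3_ne j).1)⟩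

lemma trE_mem_bubbleE {S : Seq3} {u : PolyVec 3} (hu : u ∈ S.E)
    (h : ∀ e : Edge, e.1.1 ≠ i → e.1.2 ≠ i → edgeTrE e.p e.q u = 0) :
    c.trE u ∈ (S.faceTrace c).bubbleE c.triangle :=
  Seq2.mem_bubbleE.2 ⟨⟨u, hu, rfl⟩, fun j => by
    rw [edgeTrE_triangle]
    exact edgeTrE_eq_zero_of_edges h (Fin.succAbove_ne i _) (Fin.succAbove_ne i _)
      ((Fin.succAbove_right_injective).ne (fin3_ne j).1)⟩

lemma edgeTrH_eq_zero_of_trH {u : Poly 3} (h : c.trH u = 0) (e : Edge) (h1 : e.1.1 ≠ i)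
    (h2 : e.1.2 ≠ i) : edgeTrH e.p e.q u = 0 := by
  rw [Edge.p, Edge.q, ← c.edgeTrH_trH h1 h2, h, map_zero]

lemma edgeTrE_eq_zero_of_trE {u : PolyVec 3} (h : c.trE u = 0) (e : Edge) (h1 : e.1.1 ≠ i)
    (h2 : e.1.2 ≠ i) : edgeTrE e.p e.q u = 0 := by
  rw [Edge.p, Edge.q, ← c.edgeTrE_trE h1 h2, h, map_zero]

end FaceChart

lemma exists_ne_edge (e : Edge) : ∃ i : Fin 4, e.1.1 ≠ i ∧ e.1.2 ≠ i := by
  obtain ⟨⟨a, b⟩, h⟩ := e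
  have : ∀ a b : Fin 4, ∃ i : Fin 4, a ≠ i ∧ b ≠ i := by decide
  exact this a b

/-! ### Extension of bubbles from faces -/

/-- A polynomial that vanishes on a line is divisible by every affine function that vanishes there. -/
lemma affine_dvd {p q : Fin 2 → ℝ} (h : p ≠ q) {f μ : Poly 2} (hμ : μ ∈ P 2 1) (hμ0 : μ ≠ 0)
    (hμe : edgeAlg p q μ = 0) (hf : edgeAlg p q f = 0) : μ ∣ f := by
  have hunit := edgeDir_unit h
  rw [dotProduct, Fin.sum_univ_two] at hunit
  set t := edgeDir p q with ht
  -- The equation of the line. Modulo `ν` the plane retracts to the line along its normals, so every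
  -- polynomial is congruent to the lift of its restriction and `ν` divides those with zero
  -- restriction. The remaining steps show that `ν` and `μ` differ by a nonzero constant.
  let ν : Poly 2 := C (t 0) * (X 1 - C (p 1)) - C (t 1) * (X 0 - C (p 0))
  have key (g : Poly 2) (hg : edgeAlg p q g = 0) : ν ∣ g := by
    have h1 : (Ideal.Quotient.mkₐ ℝ (Ideal.span {ν})) =
        (Ideal.Quotient.mkₐ ℝ (Ideal.span {ν})).comp ((edgeLift p q).comp (edgeAlg p q)) := by
      refine MvPolynomial.algHom_ext fun m => ?_
      rw [AlgHom.comp_apply, AlgHom.comp_apply, edgeAlg_X]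
      refine Ideal.Quotient.eq.2 (Ideal.mem_span_singleton.2 ?_)
      have h2 : edgeLift p q (Polynomial.C (p m) + Polynomial.C (t m) * Polynomial.X) =
          C (p m) + C (t m) * (C (t 0) * (X 0 - C (p 0)) + C (t 1) * (X 1 - C (p 1))) := by
        simp [edgeLift, arcPoly, Fin.sum_univ_two, algebraMap_eq, ← ht]
      rw [← ht, h2]
      have hC := congrArg (C : ℝ → Poly 2) hunit
      simp only [C_add, C_mul, C_1] at hC
      fin_cases m
      · exact ⟨-C (t 1), by simp only [ν, Fin.zero_eta]; linear_combination (C (p 0) - X 0) * hC⟩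
      · exact ⟨C (t 0), by simp only [ν, Fin.mk_one]; linear_combination (C (p 1) - X 1) * hC⟩
    have h3 := AlgHom.congr_fun h1 g
    rw [AlgHom.comp_apply, AlgHom.comp_apply, hg, map_zero, map_zero] at h3
    exact Ideal.mem_span_singleton.1 (Ideal.Quotient.eq_zero_iff_mem.1 h3)
  obtain ⟨κ, hκ⟩ := key μ hμe
  have hν0 : ν ≠ 0 := fun h0 => hμ0 (by rw [hκ, h0, zero_mul])
  have hκ0 : κ ≠ 0 := fun h0 => hμ0 (by rw [hκ, h0, mul_zero])
  have hdeg : ν.totalDegree ≠ 0 := by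
    intro h0
    obtain ⟨a, ha⟩ : ∃ a, ν = C a := ⟨_, totalDegree_eq_zero_iff_eq_C.1 h0⟩
    have h1 := congrArg (pderiv 0) ha
    have h2 := congrArg (pderiv 1) ha
    simp [ν, pderiv_X] at h1 h2
    rw [h1, h2] at hunit
    norm_num at hunit
  have hκC : κ.totalDegree = 0 := by
    have := mem_P.1 hμ
    rw [hκ, totalDegree_mul_of_isDomain hν0 hκ0] at this
    omega
  rw [totalDegree_eq_zero_iff_eq_C] at hκC
  set a := coeff 0 κ
  have ha : a ≠ 0 := fun h0 => hκ0 (by rw [hκC, h0, C_0])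
  have hdvd : μ ∣ ν := ⟨C a⁻¹, by rw [hκ, hκC, mul_assoc, ← C_mul, mul_inv_cancel₀ ha, C_1, mul_one]⟩
  exact hdvd.trans (key f hf)

lemma affine_totalDegree {T : Fin 3 → Fin 2 → ℝ} {μ : Fin 3 → Poly 2} (hμ : IsBarycentric T μ)
    (j : Fin 3) : μ j ≠ 0 ∧ (μ j).totalDegree = 1 := by
  have h0 : μ j ≠ 0 := fun h0 => by
    have := hμ.eval_self j
    rw [h0, map_zero] at this
    exact zero_ne_one this
  refine ⟨h0, le_antisymm (mem_P.1 (hμ.degree j)) (Nat.one_le_iff_ne_zero.2 fun hd => ?_)⟩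
  obtain ⟨a, ha⟩ : ∃ a, μ j = C a := ⟨_, totalDegree_eq_zero_iff_eq_C.1 hd⟩
  have h1 := hμ.eval_self j
  have h2 := hμ.eval_ne (fin3_ne j).2.1
  rw [ha, eval_C] at h1 h2
  exact one_ne_zero (h1.symm.trans h2)

/-- Functions on a triangle that vanish on the boundary are divisible by the bubble function. -/
lemma triangle_bubble_factor {T : Fin 3 → Fin 2 → ℝ} {μ : Fin 3 → Poly 2}
    (hμ : IsBarycentric T μ) {m : ℕ} {f : Poly 2} (hf : f ∈ P 2 m)
    (h : ∀ j, edgeTrH (T (j + 1)) (T (j + 2)) f = 0) (hne : f ≠ 0) :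
    ∃ n g, n + 3 ≤ m ∧ g ∈ P 2 n ∧ f = μ 0 * μ 1 * μ 2 * g := by
  have hT (j : Fin 3) : T (j + 1) ≠ T (j + 2) := hμ.ne (fin3_ne j).1
  have hz (j : Fin 3) : edgeAlg (T (j + 1)) (T (j + 2)) (μ j) = 0 :=
    hμ.edgeAlg_eq_zero (fin3_ne j).1 (fin3_ne j).2.1 (fin3_ne j).2.2
  have hnz (j l : Fin 3) (hjl : l ≠ j) : edgeAlg (T (j + 1)) (T (j + 2)) (μ l) ≠ 0 := by
    intro h0
    have h1 := bdryTrH_edgeTrH (hT j) (μ l)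
    rw [edgeTrH_apply, h0, map_zero, Prod.ext_iff] at h1
    rcases fin3_cases j l with h | h | h
    · exact hjl h
    · have h2 := h1.1
      rw [← h, hμ.eval_self] at h2
      exact zero_ne_one h2
    · have h2 := h1.2
      rw [← h, hμ.eval_self] at h2
      exact zero_ne_one h2
  have hd (j : Fin 3) := affine_totalDegree hμ j
  obtain ⟨f1, rfl⟩ := affine_dvd (hT 0) (hμ.degree 0) (hd 0).1 (hz 0) (h 0)
  have h1 : edgeAlg (T (1 + 1)) (T (1 + 2)) f1 = 0 := by
    have := h 1
    rw [edgeTrH_apply, map_mul] at this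
    exact (mul_eq_zero.1 this).resolve_left (hnz 1 0 (by decide))
  obtain ⟨f2, rfl⟩ := affine_dvd (hT 1) (hμ.degree 1) (hd 1).1 (hz 1) h1
  have h2 : edgeAlg (T (2 + 1)) (T (2 + 2)) f2 = 0 := by
    have := h 2
    rw [edgeTrH_apply, map_mul, map_mul] at this
    exact (mul_eq_zero.1 ((mul_eq_zero.1 this).resolve_left
      (hnz 2 0 (by decide)))).resolve_left (hnz 2 1 (by decide))
  obtain ⟨g, rfl⟩ := affine_dvd (hT 2) (hμ.degree 2) (hd 2).1 (hz 2) h2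
  refine ⟨g.totalDegree, g, ?_, mem_P.2 le_rfl, by ring⟩
  have hg : g ≠ 0 := by
    rintro rfl
    simp at hne
  rw [mem_P, totalDegree_mul_of_isDomain (hd 0).1
    (mul_ne_zero (hd 1).1 (mul_ne_zero (hd 2).1 hg)), totalDegree_mul_of_isDomain (hd 1).1
    (mul_ne_zero (hd 2).1 hg), totalDegree_mul_of_isDomain (hd 2).1 hg, (hd 0).2, (hd 1).2,
    (hd 2).2] at hf
  omega

/-- A bubble on the face is the product of its three barycentric coordinates and some `g`. Replacing
these by the coordinates of the tetrahedron and `g` by its lift gives the extension: every other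
face and every edge annihilates one of the three factors. -/
lemma face_extension (c : ∀ i, FaceChart i) (i : Fin 4) {m : ℕ} {f : Poly 2} (hf : f ∈ P 2 m)
    (h : ∀ j, edgeTrH ((c i).triangle (j + 1)) ((c i).triangle (j + 2)) f = 0) :
    ∃ g ∈ P 3 m, Seq3.bdryTrH c g = Pi.single i f ∧ ∀ e : Edge, edgeTrH e.p e.q g = 0 := by
  by_cases hne : f = 0
  · exact ⟨0, Submodule.zero_mem _, by simp [hne], fun e => map_zero _⟩
  obtain ⟨n, g, hn, hg, rfl⟩ :=
    triangle_bubble_factor (FaceChart.isBarycentric_trH c i) hf h hne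
  let a (j : Fin 3) : Poly 3 := (c (i.succAbove j)).bary
  have ha (j : Fin 3) : a j ∈ P 3 1 := (c _).bary_mem
  refine ⟨a 0 * a 1 * a 2 * (c i).lift g, P_mono hn ?_, ?_, fun e => ?_⟩
  · rw [add_comm]
    exact mul_mem_P (mul_mem_P (mul_mem_P (ha 0) (ha 1)) (ha 2)) ((c i).lift_mem_P hg)
  · funext l
    have hl : Seq3.bdryTrH c (a 0 * a 1 * a 2 * (c i).lift g) l =
      (c l).trAlg (a 0 * a 1 * a 2 * (c i).lift g) := rfl
    rw [hl, map_mul, map_mul, map_mul]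
    by_cases hli : l = i
    · subst hli
      rw [Pi.single_eq_same, (c l).trAlg_lift]
      rfl
    · rw [Pi.single_eq_of_ne hli]
      obtain ⟨j, rfl⟩ := Fin.exists_succAbove_eq hli
      have h0 : (c (i.succAbove j)).trAlg (a j) = 0 := (c (i.succAbove j)).trH_bary
      fin_cases j
      · simp only [Fin.zero_eta] at h0 ⊢
        rw [h0]; ring
      · simp only [Fin.mk_one] at h0 ⊢
        rw [h0]; ring
      · simp only [Fin.reduceFinMk] at h0 ⊢
        rw [h0]; ring
  · have hex : ∃ j : Fin 3, e.1.1 ≠ i.succAbove j ∧ e.1.2 ≠ i.succAbove j := by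
      have : ∀ i a b : Fin 4, ∃ j : Fin 3, a ≠ i.succAbove j ∧ b ≠ i.succAbove j := by decide
      exact this i _ _
    obtain ⟨j, h1, h2⟩ := hex
    have h0 : edgeAlg e.p e.q (a j) = 0 := (isBarycentric_bary c).edgeAlg_eq_zero e.2.ne h1 h2
    rw [edgeTrH_apply, map_mul, map_mul, map_mul]
    fin_cases j
    · simp only [Fin.zero_eta] at h0 ⊢
      rw [h0]; ring
    · simp only [Fin.mk_one] at h0 ⊢
      rw [h0]; ring
    · simp only [Fin.reduceFinMk] at h0 ⊢
      rw [h0]; ring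

/-! ### Normal traces -/

/-- Extension of normal traces from a face. -/
lemma bdryTrV_extension (c : ∀ i, FaceChart i) (i : Fin 4) (g : Fin 4 → Poly 3) :
    Seq3.bdryTrV c (fun m => ∑ v, (c v).bary * g v * C (vertex v m - vertex i m)) =
      Pi.single i (C (-(c i).height) * (c i).trH (∑ v, (c v).bary * g v)) := by
  funext l
  have hl (u : PolyVec 3) : Seq3.bdryTrV c u l = (c l).trV u := rfl
  have h1 : (c l).trV (fun m => ∑ v, (c v).bary * g v * C (vertex v m - vertex i m)) =
      ∑ v, (c l).trAlg (c v).bary * (c l).trAlg (g v) *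
        C ((vertex v - vertex i) ⬝ᵥ (c l).n) := by
    simp only [FaceChart.trV_apply, FaceChart.trDot_apply, map_sum, map_mul, FaceChart.trAlg_C,
      Finset.mul_sum, ← Finset.sum_add_distrib, dotProduct, Fin.sum_univ_three, Pi.sub_apply]
    exact Finset.sum_congr rfl fun v _ => by simp only [map_add, map_mul]; ring
  have h0 : (c l).trAlg (c l).bary = 0 := (c l).trH_bary
  have hp (v : Fin 4) (hv : v ≠ l) : (vertex v - (c l).origin) ⬝ᵥ (c l).n = 0 :=
    (c l).in_plane v hv
  have hsub (v w : Fin 4) : (vertex v - vertex w) ⬝ᵥ (c l).n =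
      (vertex v - (c l).origin) ⬝ᵥ (c l).n - (vertex w - (c l).origin) ⬝ᵥ (c l).n := by
    rw [← sub_dotProduct, sub_sub_sub_cancel_right]
  -- On the face `l ≠ i` the direction from the vertex `i` to the vertex `v` is tangential unless `v
  -- = l`, and then the barycentric coordinate in front vanishes. On the face `i` all relevant
  -- directions have the same normal component `-height`.
  rw [hl, h1]
  by_cases hli : l = i
  · subst hli
    rw [Pi.single_eq_same, FaceChart.trH_apply, map_sum, Finset.mul_sum]
    refine Finset.sum_congr rfl fun v _ => ?_
    by_cases hv : v = l
    · rw [hv, map_mul, h0]; ring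
    · rw [hsub, hp v hv, zero_sub, map_mul, FaceChart.height]; ring
  · rw [Pi.single_eq_of_ne hli]
    refine Finset.sum_eq_zero fun v _ => ?_
    by_cases hv : v = l
    · rw [hv, h0]; ring
    · rw [hsub, hp v hv, hp i (Ne.symm hli), sub_zero, C_0, mul_zero]

lemma exists_bdryTrV_eq_single (c : ∀ i, FaceChart i) (i : Fin 4) (w : Poly 2)
    {N : Submodule ℝ (PolyVec 3)} {g : Fin 4 → Poly 3} (hw : (c i).trH (∑ v, (c v).bary * g v) = w)
    (hN : (fun m => ∑ v, (c v).bary * g v * C (vertex v m - vertex i m)) ∈ N) :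
    ∃ v ∈ N, Seq3.bdryTrV c v = Pi.single i w := by
  have hh : -(c i).height ≠ 0 := neg_ne_zero.2 (c i).height_ne
  refine ⟨_, N.smul_mem (-(c i).height)⁻¹ hN, ?_⟩
  rw [map_smul, bdryTrV_extension, hw, ← Pi.single_smul, smul_eq_C_mul, ← mul_assoc, ← C_mul,
    inv_mul_cancel₀ hh, C_1, one_mul]

/-- Expanding the lift of `w` in barycentric coordinates lowers the degree of the cofactors by one,
so the field in `bdryTrV_extension` has the degree of `w` and no more. -/
lemma S1tet_extension (c : ∀ i, FaceChart i) (k : ℕ) (i : Fin 4) {w : Poly 2}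
    (hw : w ∈ P 2 (k + 1)) : ∃ v ∈ (S1tet k).V, Seq3.bdryTrV c v = Pi.single i w := by
  obtain ⟨g, hg, hgw⟩ := exists_bary_decomp c ((c i).lift_mem_P hw)
  refine exists_bdryTrV_eq_single c i w (g := g) ?_ (mem_PVec.2 fun m =>
    Submodule.sum_mem _ fun v _ => ?_)
  · rw [← hgw]
    exact (c i).trAlg_lift w
  · rw [mul_comm, add_comm]
    exact C_mul_mem_P _ (mul_mem_P (c v).bary_mem (hg v))

/-- With equal cofactors the field is `g (x - vertex i)` for the lift `g` of `w`. It has degree one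
more than `w`, but its top part is parallel to `x`, so it stays in the first kind space. -/
lemma S2tet_extension (c : ∀ i, FaceChart i) (k : ℕ) (i : Fin 4) {w : Poly 2}
    (hw : w ∈ P 2 k) : ∃ v ∈ (S2tet k).V, Seq3.bdryTrV c v = Pi.single i w := by
  have hg := (c i).lift_mem_P hw
  refine exists_bdryTrV_eq_single c i w (g := fun _ => (c i).lift w) ?_ ?_
  · rw [← Finset.sum_mul, sum_bary, one_mul]
    exact (c i).trAlg_lift w
  · have h1 : (fun m => ∑ v, (c v).bary * (c i).lift w * C (vertex v m - vertex i m)) =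
        fun m => (c i).lift w * (X m - C (vertex i m)) := by
      funext m
      have : ∀ v, (c v).bary * (c i).lift w * C (vertex v m - vertex i m) =
          (c i).lift w * ((c v).bary * C (vertex v m)) -
            (c i).lift w * ((c v).bary * C (vertex i m)) := by
        intro v
        rw [C_sub]
        ring
      rw [Finset.sum_congr rfl fun v _ => this v, Finset.sum_sub_distrib, ← Finset.mul_sum,
        ← Finset.mul_sum, sum_bary_mul_vertex, ← Finset.sum_mul, sum_bary, one_mul]
      ring
    rw [h1]
    refine mem_raviartThomas.2 ⟨mem_PVec.2 fun m => mul_mem_P hg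
      (Submodule.sub_mem _ (X_mem_P _) (C_mem_P _ _)), fun a b => ?_⟩
    have h2 : X a * ((c i).lift w * (X b - C (vertex i b))) -
        X b * ((c i).lift w * (X a - C (vertex i a))) =
        (c i).lift w * (C (vertex i a) * X b - C (vertex i b) * X a) := by ring
    rw [h2]
    exact mul_mem_P hg (Submodule.sub_mem _ (C_mul_mem_P _ (X_mem_P _))
      (C_mul_mem_P _ (X_mem_P _)))

lemma bary_zero (c : FaceChart 0) : c.bary = 1 - X 0 - X 1 - X 2 := by
  let c' : ∀ i, FaceChart i := Fin.cases c fun _ => Classical.arbitrary _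
  have hc : c.bary = (c' 0).bary := rfl
  rw [hc, ← sub_eq_zero]
  refine affine_eq_zero (Submodule.sub_mem _ (c' 0).bary_mem (Submodule.sub_mem _
    (Submodule.sub_mem _ (Submodule.sub_mem _ (one_mem_P _) (X_mem_P _)) (X_mem_P _))
      (X_mem_P _))) fun v => ?_
  have := (isBarycentric_bary c').eval v 0
  rw [map_sub, this]
  fin_cases v <;> simp [vertex_zero, vertex_one, vertex_two, vertex_three]

lemma bary_succ (m : Fin 3) (c : FaceChart m.succ) : c.bary = X m := by
  classical
  let c' : ∀ i, FaceChart i := Function.update (fun _ => Classical.arbitrary _) m.succ c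
  have hc : c.bary = (c' m.succ).bary := by simp [c']
  rw [hc, ← sub_eq_zero]
  refine affine_eq_zero (Submodule.sub_mem _ (c' _).bary_mem (X_mem_P _)) fun v => ?_
  have := (isBarycentric_bary c').eval v m.succ
  rw [map_sub, this]
  fin_cases v <;> fin_cases m <;>
    simp [vertex_zero, vertex_one, vertex_two, vertex_three, Fin.ext_iff]

namespace FaceChart

variable {i : Fin 4} (c : FaceChart i)

/-- The normal trace in terms of the gradient of the barycentric coordinate. -/
lemma trV_eq (v : PolyVec 3) :
    c.trV v = C c.height * c.trAlg (∑ m, pderiv m c.bary * v m) := by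
  have h (m : Fin 3) : pderiv m c.bary = C (c.height⁻¹ * c.n m) := by
    simp [bary, pderiv_X, Pi.single_apply]
  have hh : (C c.height * C c.height⁻¹ : Poly 2) = 1 := by
    rw [← C_mul, mul_inv_cancel₀ c.height_ne, C_1]
  simp only [h, Fin.sum_univ_three, map_add, map_mul, trAlg_C, trV_apply, trDot_apply]
  linear_combination -(C (c.n 0) * c.trAlg (v 0) + C (c.n 1) * c.trAlg (v 1) +
    C (c.n 2) * c.trAlg (v 2)) * hh

end FaceChart

/-- The normal trace is proportional to `∇λ · A ∇q` for the barycentric coordinate `λ` of the face,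
and `A ∇λ` is divisible by `λ`: the factors are `x_l` and `1 - x - y - z` in the two cases. -/
lemma bdryTrV_simplexFlux (c : ∀ i, FaceChart i) (q : Poly 3) :
    Seq3.bdryTrV c (simplexFlux q) = 0 := by
  funext i
  have hl : Seq3.bdryTrV c (simplexFlux q) i = (c i).trV (simplexFlux q) := rfl
  have h0 : (c i).trAlg (c i).bary = 0 := (c i).trH_bary
  rw [hl, FaceChart.trV_eq]
  suffices (c i).trAlg (∑ m, pderiv m (c i).bary * simplexFlux q m) = 0 by
    rw [this, mul_zero]; rfl
  generalize c i = c at *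
  induction i using Fin.cases with
  | zero =>
    have h1 : ∑ m, pderiv m c.bary * simplexFlux q m =
        -(c.bary * ∑ j, X j * pderiv j q) := by
      rw [bary_zero]
      simp only [simplexFlux_apply, Fin.sum_univ_three]
      simp [pderiv_X]
      ring
    rw [h1, map_neg, map_mul, h0, zero_mul, neg_zero]
  | succ l =>
    have h1 : ∑ m, pderiv m c.bary * simplexFlux q m = c.bary * (pderiv l q -
        ∑ j, X j * pderiv j q) := by
      rw [bary_succ]
      simp only [simplexFlux_apply, pderiv_X, Pi.single_apply, ite_mul, one_mul, zero_mul,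
        Finset.sum_ite_eq, Finset.mem_univ, if_true]
      ring
    rw [h1, map_mul, h0, zero_mul]

end FES

namespace FES

open MvPolynomial

/-! ### Compatibility on the tetrahedron -/

namespace Seq3

variable (S : Seq3) (c : ∀ i, FaceChart i)

/-- Scalar fields in `H` with vanishing trace on the boundary. -/
def bubbleH : Submodule ℝ (Poly 3) := S.H ⊓ LinearMap.ker (bdryTrH c)

/-- Fields in `E` with vanishing tangential trace on the boundary. -/
def bubbleE : Submodule ℝ (PolyVec 3) := S.E ⊓ LinearMap.ker (bdryTrE c)

/-- Fields in `V` with vanishing normal trace on the boundary. -/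
def bubbleV : Submodule ℝ (PolyVec 3) := S.V ⊓ LinearMap.ker (bdryTrV c)

variable {S c}

lemma mem_bubbleH {u : Poly 3} : u ∈ S.bubbleH c ↔ u ∈ S.H ∧ ∀ i, (c i).trH u = 0 := by
  rw [bubbleH, Submodule.mem_inf, LinearMap.mem_ker, funext_iff]
  rfl

lemma mem_bubbleE {u : PolyVec 3} : u ∈ S.bubbleE c ↔ u ∈ S.E ∧ ∀ i, (c i).trE u = 0 := by
  rw [bubbleE, Submodule.mem_inf, LinearMap.mem_ker, funext_iff]
  rfl

lemma mem_bubbleV {u : PolyVec 3} : u ∈ S.bubbleV c ↔ u ∈ S.V ∧ ∀ i, (c i).trV u = 0 := by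
  rw [bubbleV, Submodule.mem_inf, LinearMap.mem_ker, funext_iff]
  rfl

/-- Traces on all edges. -/
def edgesTrH : Poly 3 →ₗ[ℝ] (Edge → Polynomial ℝ) := LinearMap.pi fun e => edgeTrH e.p e.q

def edgesTrE : PolyVec 3 →ₗ[ℝ] (Edge → Polynomial ℝ) := LinearMap.pi fun e => edgeTrE e.p e.q

lemma edgesTrH_eq_zero {u : Poly 3} : edgesTrH u = 0 ↔ ∀ e : Edge, edgeTrH e.p e.q u = 0 :=
  funext_iff

lemma edgesTrE_eq_zero {u : PolyVec 3} : edgesTrE u = 0 ↔ ∀ e : Edge, edgeTrE e.p e.q u = 0 :=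
  funext_iff

lemma edges_of_facesH {u : Poly 3} (h : ∀ i, (c i).trH u = 0) (e : Edge) :
    edgeTrH e.p e.q u = 0 := by
  obtain ⟨i, h1, h2⟩ := exists_ne_edge e
  exact (c i).edgeTrH_eq_zero_of_trH (h i) e h1 h2

lemma edges_of_facesE {u : PolyVec 3} (h : ∀ i, (c i).trE u = 0) (e : Edge) :
    edgeTrE e.p e.q u = 0 := by
  obtain ⟨i, h1, h2⟩ := exists_ne_edge e
  exact (c i).edgeTrE_eq_zero_of_trE (h i) e h1 h2

lemma vertices_of_edges {u : Poly 3} (h : ∀ e : Edge, edgeTrH e.p e.q u = 0) (v : Fin 4) :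
    eval (vertex v) u = 0 := by
  have hw : ∃ w : Fin 4, v ≠ w := by fin_cases v <;> decide
  obtain ⟨w, hw⟩ := hw
  rcases lt_or_gt_of_ne hw with hlt | hlt
  · exact eval_eq_zero_of_edgeTrH (h ⟨(v, w), hlt⟩)
  · exact eval_eq_zero_of_edgeTrH
      (edgeTrH_symm_eq_zero (Edge.p_ne_q ⟨(w, v), hlt⟩) (h ⟨(w, v), hlt⟩))

variable {r : ℕ}

lemma edgeTrace_H (hH : S.H = P 3 (r + 1)) (e : Edge) : (S.edgeTrace e).H = P1 (r + 1) := by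
  rw [edgeTrace, hH]
  exact map_edgeTrH_P e.p_ne_q _

lemma edgeTrace_isCompatible (hH : S.H = P 3 (r + 1))
    (hedge : ∀ p q : Fin 3 → ℝ, p ≠ q → S.E.map (edgeTrE p q) = P1 r) (e : Edge) :
    (S.edgeTrace e).IsCompatible (edgeLen e.p e.q) :=
  isCompatible1 (r := r) (edgeLen_pos e.p_ne_q).ne' (edgeTrace_H hH e) (hedge _ _ e.p_ne_q)

lemma finrank_bdryTrH3 (hH : S.H = P 3 (r + 1)) :
    Module.finrank ℝ (S.H.map (bdryTrH c)) = (∑ _v : Fin 4, 1) +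
      (∑ e : Edge, Module.finrank ℝ ((S.edgeTrace e).bubbleH (edgeLen e.p e.q))) +
      ∑ i : Fin 4, Module.finrank ℝ ((S.faceTrace (c i)).bubbleH (c i).triangle) := by
  have hfin : FiniteDimensional ℝ S.H := by rw [hH]; infer_instance
  have hfinv : FiniteDimensional ℝ (S.H ⊓ LinearMap.ker (pointTr vertex) : Submodule ℝ _) :=
    Submodule.finiteDimensional_of_le inf_le_left
  have hfine (e : Edge) : FiniteDimensional ℝ ((S.edgeTrace e).bubbleH (edgeLen e.p e.q)) := by
    have : FiniteDimensional ℝ (S.edgeTrace e).H := by rw [edgeTrace_H hH]; infer_instance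
    exact Submodule.finiteDimensional_of_le inf_le_left
  have hfinf (i : Fin 4) :
      FiniteDimensional ℝ ((S.faceTrace (c i)).bubbleH (c i).triangle) := by
    have : FiniteDimensional ℝ (S.faceTrace (c i)).H := by
      rw [faceTrace]; infer_instance
    exact Submodule.finiteDimensional_of_le inf_le_left
  have hbary := isBarycentric_bary c
  -- Face traces determine edge traces and edge traces determine vertex values, which gives the
  -- three summands.
  rw [finrank_map_split S.H edgesTrH, finrank_map_split S.H (pointTr vertex)]
  · congr 1
    · congr 1
      · rw [hH, hbary.finrank_map_pointTr (by omega)]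
        simp
      · refine finrank_map_eq_sum ?_ ?_
        · rintro f ⟨hf, hf0⟩ e
          have hv (l : Fin 4) : eval (vertex l) f = 0 := congrFun hf0 l
          exact (mem_bubbleH_edgeTrH (S := S.edgeTrace e) e.p_ne_q
            (Submodule.mem_map_of_mem hf)).2 ⟨hv _, hv _⟩
        · intro e y hy
          obtain ⟨hy, h0, h1⟩ := mem_bubbleH1.1 hy
          rw [edgeTrace_H hH] at hy
          have hne := e.2.ne
          obtain ⟨g, hg, hgy⟩ := edge_extension e.p_ne_q (hbary.degree e.1.1) (hbary.degree e.1.2)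
            (hbary.eval_self _) (hbary.eval_ne hne.symm) (hbary.eval_ne hne)
            (hbary.eval_self _) hy h0 h1
          refine ⟨_, ⟨by rw [hH]; exact hg, ?_⟩, ?_⟩
          · rw [SetLike.mem_coe, LinearMap.mem_ker]
            funext l
            rw [pointTr_apply, map_mul, map_mul, hbary.eval, hbary.eval]
            split_ifs with ha hb
            · exact absurd (ha.symm.trans hb) hne
            all_goals simp
          · funext e'
            have hl (u : Poly 3) : edgesTrH u e' = edgeAlg e'.p e'.q u := rfl
            rw [hl]
            by_cases hee : e' = e
            · rw [hee, Pi.single_eq_same, hgy]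
            · rw [Pi.single_eq_of_ne hee, map_mul, map_mul]
              -- Of two different edges, the first always has an end point off the second; its
              -- barycentric coordinate vanishes along the second.
              have hcase : (e'.1.1 ≠ e.1.1 ∧ e'.1.2 ≠ e.1.1) ∨
                  (e'.1.1 ≠ e.1.2 ∧ e'.1.2 ≠ e.1.2) := by
                have h1 := e.2
                have h2 := e'.2
                by_contra hcon
                refine hee (Subtype.ext (Prod.ext ?_ ?_)) <;> omega
              rcases hcase with ⟨h1, h2⟩ | ⟨h1, h2⟩
              · have : edgeAlg e'.p e'.q (c e.1.1).bary = 0 :=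
                  hbary.edgeAlg_eq_zero e'.2.ne h1 h2
                rw [this, zero_mul, zero_mul]
              · have : edgeAlg e'.p e'.q (c e.1.2).bary = 0 :=
                  hbary.edgeAlg_eq_zero e'.2.ne h1 h2
                rw [this, mul_zero, zero_mul]
    · refine finrank_map_eq_sum ?_ ?_
      · rintro f ⟨hf, hf0⟩ i
        exact (c i).trH_mem_bubbleH hf fun e _ _ => edgesTrH_eq_zero.1 hf0 e
      · intro i y hy
        obtain ⟨hy, h0⟩ := Seq2.mem_bubbleH.1 hy
        have hy' : y ∈ P 2 (r + 1) := by
          rw [← (c i).map_trH_P, ← hH]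
          exact hy
        obtain ⟨g, hg, h1, h2⟩ := face_extension c i hy' h0
        exact ⟨g, ⟨by rw [hH]; exact hg, edgesTrH_eq_zero.2 h2⟩, h1⟩
  · rintro f ⟨hf, hf0⟩
    rw [LinearMap.mem_ker]
    funext v
    exact vertices_of_edges (edgesTrH_eq_zero.1 hf0) v
  · rintro f ⟨hf, hf0⟩
    exact edgesTrH_eq_zero.2 (edges_of_facesH fun i => congrFun hf0 i)

/-- The trace of a potential on each face has zero gradient, hence is constant. The edges issuing
from the vertex `0` show that all these constants are equal, and the common value can be subtracted.
-/
lemma bubbleE_inf_ker_curl (hS : S.IsExact) :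
    S.bubbleE c ⊓ LinearMap.ker curl3 = (S.bubbleH c).map (grad 3) := by
  ext v
  constructor
  · rintro ⟨hv, hc⟩
    obtain ⟨hv, hv0⟩ := mem_bubbleE.1 hv
    have h1 : v ∈ S.H.map (grad 3) := by rw [hS.range_grad]; exact ⟨hv, hc⟩
    obtain ⟨f, hf, rfl⟩ := h1
    have hC : C (eval (vertex 0) f) ∈ S.H ⊓ LinearMap.ker (grad 3) := by
      rw [← hS.ker_grad]
      exact ⟨_, rfl⟩
    have he (v : Fin 4) (hv : 0 < v) : eval (vertex v) f = eval (vertex 0) f :=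
      (edgeTrH_const (Edge.p_ne_q ⟨(0, v), hv⟩) (edges_of_facesE hv0 ⟨(0, v), hv⟩)).2
    refine ⟨f - C (eval (vertex 0) f), mem_bubbleH.2 ⟨Submodule.sub_mem _ hf hC.1, fun i => ?_⟩, ?_⟩
    · have h1 : grad 2 ((c i).trH f) = 0 := by rw [FaceChart.grad_trH, hv0]
      refine grad_injOn_of_eval (p := (c i).triangle 0) ?_ ?_
      · rw [map_sub, map_sub, h1, zero_sub, neg_eq_zero, FaceChart.grad_trH,
          LinearMap.mem_ker.1 hC.2, map_zero]
      · rw [FaceChart.trH_apply, FaceChart.eval_trAlg, FaceChart.triangle,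
          FaceChart.point_coord_vertex _ (Fin.succAbove_ne i 0), map_sub, eval_C, sub_eq_zero]
        by_cases h0 : i.succAbove 0 = 0
        · rw [h0]
        · exact he _ (Fin.pos_iff_ne_zero.2 h0)
    · rw [map_sub, LinearMap.mem_ker.1 hC.2, sub_zero]
  · rintro ⟨f, hf, rfl⟩
    obtain ⟨hf, hf0⟩ := mem_bubbleH.1 hf
    have h1 : grad 3 f ∈ S.E ⊓ LinearMap.ker curl3 := by
      rw [← hS.range_grad]; exact ⟨f, hf, rfl⟩
    refine ⟨mem_bubbleE.2 ⟨h1.1, fun i => ?_⟩, h1.2⟩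
    rw [← FaceChart.grad_trH, hf0, map_zero]

lemma finrank_grad_bubbleH [FiniteDimensional ℝ S.H] :
    Module.finrank ℝ ((S.bubbleH c).map (grad 3)) = Module.finrank ℝ (S.bubbleH c) := by
  have : FiniteDimensional ℝ (S.bubbleH c) := Submodule.finiteDimensional_of_le inf_le_left
  exact finrank_map_grad_of_eval (p := vertex 0) fun f hf =>
    vertices_of_edges (edges_of_facesH (mem_bubbleH.1 hf).2) 0

lemma map_curl_bubbleE_le (hS : S.IsExact) :
    (S.bubbleE c).map curl3 ≤ S.bubbleV c ⊓ LinearMap.ker div3 := by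
  rintro _ ⟨v, hv, rfl⟩
  obtain ⟨hv, hv0⟩ := mem_bubbleE.1 hv
  have h1 : curl3 v ∈ S.V ⊓ LinearMap.ker div3 := by
    rw [← hS.range_curl]; exact ⟨v, hv, rfl⟩
  refine ⟨mem_bubbleV.2 ⟨h1.1, fun i => ?_⟩, h1.2⟩
  rw [← FaceChart.curl_trE, hv0, map_zero]

/-- Compatibility of a sequence on the tetrahedron from compatibility on its faces, extension of
normal traces, and sufficiently many divergences of bubbles. -/
theorem isCompatible3 (hH : S.H = P 3 (r + 1))
    (finE : FiniteDimensional ℝ S.E) (finV : FiniteDimensional ℝ S.V)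
    (finW : FiniteDimensional ℝ S.W) (hS : S.IsExact)
    (hface : ∀ i, (S.faceTrace (c i)).IsCompatible (c i).triangle)
    (hfaceW : ∀ i, Module.finrank ℝ (S.faceTrace (c i)).W =
      Module.finrank ℝ (((S.faceTrace (c i)).bubbleE (c i).triangle).map curl2) + 1)
    (hedge : ∀ p q : Fin 3 → ℝ, p ≠ q → S.E.map (edgeTrE p q) = P1 r)
    (hV : ∀ i, ∀ w ∈ (S.faceTrace (c i)).W, ∃ v ∈ S.V, bdryTrV c v = Pi.single i w)
    (hdiv : Module.finrank ℝ S.W ≤ Module.finrank ℝ ((S.bubbleV c).map div3) + 1) :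
    S.IsCompatible c ∧ (S.bubbleE c).map curl3 = S.bubbleV c ⊓ LinearMap.ker div3 := by
  have finH : FiniteDimensional ℝ S.H := by rw [hH]; infer_instance
  have finE0 : FiniteDimensional ℝ (S.bubbleE c) := Submodule.finiteDimensional_of_le inf_le_left
  have finV0 : FiniteDimensional ℝ (S.bubbleV c) := Submodule.finiteDimensional_of_le inf_le_left
  have finV1 : FiniteDimensional ℝ (S.bubbleV c ⊓ LinearMap.ker div3 : Submodule ℝ _) :=
    Submodule.finiteDimensional_of_le inf_le_left
  have dimH := finrank_bdryTrH3 (c := c) hH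
  have dimV : Module.finrank ℝ (S.V.map (bdryTrV c)) =
      ∑ i : Fin 4, Module.finrank ℝ (S.faceTrace (c i)).W := by
    have (i : Fin 4) : FiniteDimensional ℝ (S.faceTrace (c i)).W := (hface i).finW
    exact finrank_map_eq_sum (N := fun i => (S.faceTrace (c i)).W)
      (fun v hv i => ⟨v, hv, rfl⟩) hV
  have e1 := finrank_map_add_inf_ker S.H (grad 3)
  rw [← hS.ker_grad, finrank_constants] at e1
  have e2 := finrank_map_add_inf_ker S.E curl3
  rw [← hS.range_grad, hS.range_curl] at e2
  have e3 := finrank_map_add_inf_ker S.V div3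
  rw [hS.range_div] at e3
  have e4 : Module.finrank ℝ (S.H.map (bdryTrH c)) + Module.finrank ℝ (S.bubbleH c) =
    Module.finrank ℝ S.H := finrank_map_add_inf_ker S.H (bdryTrH c)
  have e5 : Module.finrank ℝ (S.E.map (bdryTrE c)) + Module.finrank ℝ (S.bubbleE c) =
    Module.finrank ℝ S.E := finrank_map_add_inf_ker S.E (bdryTrE c)
  have e6 : Module.finrank ℝ (S.V.map (bdryTrV c)) + Module.finrank ℝ (S.bubbleV c) =
    Module.finrank ℝ S.V := finrank_map_add_inf_ker S.V (bdryTrV c)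
  have e7 := finrank_map_add_inf_ker (S.bubbleE c) curl3
  rw [bubbleE_inf_ker_curl hS, finrank_grad_bubbleH] at e7
  have e8 := finrank_map_add_inf_ker (S.bubbleV c) div3
  have hle := map_curl_bubbleE_le (c := c) hS
  have e9 := Submodule.finrank_mono hle
  -- Again only an upper bound: the fields with no edge traces have face traces among the tangential
  -- bubbles of the faces.
  have e10 : Module.finrank ℝ (S.E.map (bdryTrE c)) ≤
      (∑ e : Edge, Module.finrank ℝ (S.edgeTrace e).W) +
      ∑ i : Fin 4, Module.finrank ℝ ((S.faceTrace (c i)).bubbleE (c i).triangle) := by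
    rw [finrank_map_split S.E edgesTrE]
    · have (e : Edge) : FiniteDimensional ℝ (S.edgeTrace e).W :=
        (edgeTrace_isCompatible hH hedge e).finW
      have (i : Fin 4) : FiniteDimensional ℝ ((S.faceTrace (c i)).bubbleE (c i).triangle) := by
        have := (hface i).finE
        exact Submodule.finiteDimensional_of_le inf_le_left
      refine add_le_add (finrank_map_le_sum (N := fun e => (S.edgeTrace e).W)
        fun v hv e => ⟨v, hv, rfl⟩) (finrank_map_le_sum
          (N := fun i => (S.faceTrace (c i)).bubbleE (c i).triangle) ?_)
      rintro v ⟨hv, hv0⟩ i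
      exact (c i).trE_mem_bubbleE hv fun e _ _ => edgesTrE_eq_zero.1 hv0 e
    · rintro f ⟨hf, hf0⟩
      exact edgesTrE_eq_zero.2 (edges_of_facesE fun i => congrFun hf0 i)
  have e11 : ∑ e : Edge, Module.finrank ℝ (S.edgeTrace e).W =
      ∑ e : Edge, Module.finrank ℝ ((S.edgeTrace e).bubbleH (edgeLen e.p e.q)) + 6 := by
    have h6 : ∑ _e : Edge, 1 = 6 := by decide
    rw [← h6, ← Finset.sum_add_distrib]
    exact Finset.sum_congr rfl fun e _ => (edgeTrace_isCompatible hH hedge e).finrank_W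
  have e12 : ∑ i : Fin 4, Module.finrank ℝ ((S.faceTrace (c i)).bubbleE (c i).triangle) + 4 =
      ∑ i : Fin 4, Module.finrank ℝ ((S.faceTrace (c i)).bubbleH (c i).triangle) +
        ∑ i : Fin 4, Module.finrank ℝ (S.faceTrace (c i)).W := by
    have h : ∑ i : Fin 4, (Module.finrank ℝ ((S.faceTrace (c i)).bubbleE (c i).triangle) + 1) =
        ∑ i : Fin 4, (Module.finrank ℝ ((S.faceTrace (c i)).bubbleH (c i).triangle) +
          Module.finrank ℝ (S.faceTrace (c i)).W) := ?_
    · rw [Finset.sum_add_distrib, Finset.sum_add_distrib] at h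
      exact h
    refine Finset.sum_congr rfl fun i _ => ?_
    have := (hface i).finH
    have := (hface i).finE
    have finE0 : FiniteDimensional ℝ ((S.faceTrace (c i)).bubbleE (c i).triangle) :=
      Submodule.finiteDimensional_of_le inf_le_left
    have h1 := finrank_map_add_inf_ker ((S.faceTrace (c i)).bubbleE (c i).triangle) curl2
    rw [FES.bubbleE_inf_ker_curl (fun j => (FaceChart.isBarycentric_trH c i).ne (fin3_ne j).1)
      (hface i).exact, finrank_grad_bubbleH2] at h1
    have h2 := hfaceW i
    omega
  have h4 : ∑ _i : Fin 4, 1 = 4 := by decide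
  rw [h4] at dimH
  -- The lower bound for the tangential traces follows from exactness, `dimH`, `dimV`, `hdiv` and
  -- `e9`, and it coincides with `e10`. Hence every inequality used is an equality; in particular
  -- `e9` is, so curls of bubbles fill the divergence-free bubbles.
  refine ⟨⟨finH, finE, finV, finW, hS, hface, finrank_bdryTrH3 hH, ?_, dimV⟩, ?_⟩
  · omega
  · exact Submodule.eq_of_le_of_finrank_le hle (by omega)

/-- The divergences of bubbles have codimension at most one. -/
lemma finrank_div_bubbleV {k : ℕ} (hW : S.W = P 3 k)
    (hV : PVec 3 k ⊔ (Phom 3 k).map xMul3 ≤ S.V) (finV : FiniteDimensional ℝ S.V) :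
    Module.finrank ℝ S.W ≤ Module.finrank ℝ ((S.bubbleV c).map div3) + 1 := by
  have finV0 : FiniteDimensional ℝ (S.bubbleV c) := Submodule.finiteDimensional_of_le inf_le_left
  -- Rank-nullity for `q ↦ div (A ∇q)` on `𝓟_k`: the image consists of divergences of bubbles and
  -- the kernel of constants.
  rw [hW, ← finrank_map_add_inf_ker (P 3 k) (div3 ∘ₗ simplexFlux)]
  refine add_le_add (Submodule.finrank_mono ?_) ?_
  · rintro _ ⟨q, hq, rfl⟩
    exact ⟨simplexFlux q, ⟨hV (simplexFlux_mem hq), bdryTrV_simplexFlux c q⟩, rfl⟩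
  · rw [← finrank_constants 3]
    have : FiniteDimensional ℝ (constants 3) := by
      rw [constants]; infer_instance
    exact Submodule.finrank_mono fun q hq => div3_simplexFlux_eq_zero hq.2

end Seq3

end FES

namespace FES

open MvPolynomial MeasureTheory

/-! ### Polynomials as smooth fields -/

lemma toSmooth_apply (p : Poly 3) (x : Fin 3 → ℝ) : (toSmooth p).1 x = eval x p := rfl

lemma value_toSmoothVec (v : PolyVec 3) (x : Fin 3 → ℝ) :
    SmoothVec.value (toSmoothVec v) x = fun m => eval x (v m) := rfl

lemma hasDerivAt_eval_line (p : Poly 3) (x : Fin 3 → ℝ) (m : Fin 3) :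
    HasDerivAt (fun t : ℝ => eval (x + t • Pi.single m 1) p) (eval x (pderiv m p)) 0 := by
  induction p using MvPolynomial.induction_on with
  | C a => simpa using hasDerivAt_const (0 : ℝ) a
  | add f g hf hg => simpa only [map_add] using hf.fun_add hg
  | mul_X f j hf =>
    have h1 : HasDerivAt (fun t : ℝ => x j + t * (Pi.single m (1 : ℝ) : Fin 3 → ℝ) j)
        ((Pi.single m (1 : ℝ) : Fin 3 → ℝ) j) 0 := by
      simpa using ((hasDerivAt_id (0 : ℝ)).mul_const
        ((Pi.single m (1 : ℝ) : Fin 3 → ℝ) j)).const_add (x j)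
    have h2 := hf.mul h1
    have h3 : eval x (pderiv m (f * X j)) = eval x (pderiv m f) *
        (x j + 0 * (Pi.single m (1 : ℝ) : Fin 3 → ℝ) j) +
        eval (x + (0 : ℝ) • Pi.single m 1) f * (Pi.single m (1 : ℝ) : Fin 3 → ℝ) j := by
      rw [pderiv_mul, pderiv_X]
      by_cases h : j = m
      · subst h; simp
      · simp [Pi.single_eq_of_ne h]
    rw [h3]
    refine h2.congr_of_eventuallyEq (Filter.Eventually.of_forall fun t => ?_)
    simp

lemma smoothD_toSmooth (m : Fin 3) (p : Poly 3) : smoothD m (toSmooth p) = toSmooth (pderiv m p) := by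
  refine Subtype.ext (funext fun x => ?_)
  have h1 := hasDerivAt_line (toSmooth p) x (Pi.single m 1) 0
  rw [zero_smul, add_zero, value_gradOf, dotProduct_single, mul_one] at h1
  exact h1.unique (hasDerivAt_eval_line p x m)

lemma gradOf_toSmooth (p : Poly 3) : gradOf smoothD (toSmooth p) = toSmoothVec (grad 3 p) :=
  funext fun m => smoothD_toSmooth m p

lemma curl3Of_toSmoothVec (v : PolyVec 3) :
    curl3Of smoothD (toSmoothVec v) = toSmoothVec (curl3 v) := by
  have h (a b : Fin 3) : smoothD a (toSmoothVec v b) = toSmooth (polyD a (v b)) :=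
    smoothD_toSmooth a (v b)
  funext m
  fin_cases m
  · change -smoothD 2 (toSmoothVec v 1) + smoothD 1 (toSmoothVec v 2) =
      toSmooth (-polyD 2 (v 1) + polyD 1 (v 2))
    rw [h, h, map_add, map_neg]
  · change -smoothD 0 (toSmoothVec v 2) + smoothD 2 (toSmoothVec v 0) =
      toSmooth (-polyD 0 (v 2) + polyD 2 (v 0))
    rw [h, h, map_add, map_neg]
  · change -smoothD 1 (toSmoothVec v 0) + smoothD 0 (toSmoothVec v 1) =
      toSmooth (-polyD 1 (v 0) + polyD 0 (v 1))
    rw [h, h, map_add, map_neg]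

lemma div3Of_toSmoothVec (v : PolyVec 3) :
    div3Of smoothD (toSmoothVec v) = toSmooth (div3 v) := by
  have h (a : Fin 3) : smoothD a (toSmoothVec v a) = toSmooth (polyD a (v a)) :=
    smoothD_toSmooth a (v a)
  have h1 : div3Of smoothD (toSmoothVec v) = ∑ a, smoothD a (toSmoothVec v a) := by
    simp [div3Of, partialOf]
  have h2 : div3 v = ∑ a, polyD a (v a) := by
    simp [div3, div3Of, partialOf]
  rw [h1, h2, map_sum]
  exact Finset.sum_congr rfl fun a _ => h a

lemma smoothD_comm (a b : Fin 3) (u : SmoothScalar) :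
    smoothD a (smoothD b u) = smoothD b (smoothD a u) := by
  refine Subtype.ext (funext fun x => ?_)
  have h (a b : Fin 3) : (smoothD a (smoothD b u)).1 x =
      fderiv ℝ (fderiv ℝ u.1) x (Pi.single a 1) (Pi.single b 1) := by
    have hd : DifferentiableAt ℝ (fderiv ℝ u.1) x :=
      ((smooth_contDiff u).fderiv_right (m := ∞) (by simp)).differentiable (by simp) x
    have h1 : (smoothD b u).1 = fun y => fderiv ℝ u.1 y (Pi.single b 1) := rfl
    rw [smoothD_apply, h1, fderiv_clm_apply hd (differentiableAt_const _)]
    simp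
  rw [h, h]
  have hs : IsSymmSndFDerivAt ℝ u.1 x :=
    (smooth_contDiff u).contDiffAt.isSymmSndFDerivAt (by
      rw [minSmoothness_of_isRCLikeNormedField]
      exact WithTop.coe_le_coe.2 le_top)
  exact hs _ _

lemma curl3Of_gradOf (u : SmoothScalar) : curl3Of smoothD (gradOf smoothD u) = 0 := by
  funext m
  fin_cases m
  · change -smoothD 2 (smoothD 1 u) + smoothD 1 (smoothD 2 u) = 0
    rw [smoothD_comm, neg_add_cancel]
  · change -smoothD 0 (smoothD 2 u) + smoothD 2 (smoothD 0 u) = 0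
    rw [smoothD_comm, neg_add_cancel]
  · change -smoothD 1 (smoothD 0 u) + smoothD 0 (smoothD 1 u) = 0
    rw [smoothD_comm, neg_add_cancel]

lemma div3Of_curl3Of (u : SmoothVec) : div3Of smoothD (curl3Of smoothD u) = 0 := by
  have h1 (v : SmoothVec) : div3Of smoothD v = ∑ a, smoothD a (v a) := by
    simp [div3Of, partialOf]
  have h2 : div3Of smoothD (curl3Of smoothD u) =
      smoothD 0 (-smoothD 2 (u 1) + smoothD 1 (u 2)) +
      smoothD 1 (-smoothD 0 (u 2) + smoothD 2 (u 0)) +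
      smoothD 2 (-smoothD 1 (u 0) + smoothD 0 (u 1)) := by
    rw [h1, Fin.sum_univ_three]
    rfl
  rw [h2]
  simp only [map_add, map_neg]
  rw [smoothD_comm 1 0, smoothD_comm 2 0, smoothD_comm 2 1]
  abel

/-! ### Geometry of faces -/

lemma vertex_mem_face {i j : Fin 4} (h : j ≠ i) : vertex j ∈ face i :=
  subset_convexHull ℝ _ ⟨j, h, rfl⟩

lemma triPoint_mem_face (i : Fin 4) {y : Fin 2 → ℝ} (hy : y ∈ simplex 2) :
    triPoint (vertex (i.succAbove 0)) (vertex (i.succAbove 1)) (vertex (i.succAbove 2)) y ∈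
      face i := by
  have hs := hy.2
  rw [Fin.sum_univ_two] at hs
  have h : triPoint (vertex (i.succAbove 0)) (vertex (i.succAbove 1)) (vertex (i.succAbove 2)) y =
      ∑ j : Fin 3, (![1 - y 0 - y 1, y 0, y 1] : Fin 3 → ℝ) j • vertex (i.succAbove j) := by
    rw [Fin.sum_univ_three, triPoint]
    simp only [Matrix.cons_val]
    module
  rw [h]
  refine (convex_convexHull ℝ _).sum_mem (fun j _ => ?_) ?_ fun j _ =>
    vertex_mem_face (Fin.succAbove_ne i j)
  · have h0 := hy.1 0
    have h1 := hy.1 1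
    fin_cases j <;> simp <;> linarith
  · rw [Fin.sum_univ_three]
    simp only [Matrix.cons_val]
    ring

lemma segment_subset_face {i a b : Fin 4} (ha : a ≠ i) (hb : b ≠ i) :
    segment ℝ (vertex a) (vertex b) ⊆ face i :=
  (convex_convexHull ℝ _).segment_subset (vertex_mem_face ha) (vertex_mem_face hb)

lemma volume_simplex_pos {n : ℕ} : 0 < (volume (simplex n)).toReal := by
  have hne : (simplex n).Nonempty := by
    have hn : (0 : ℝ) < n + 1 := by positivity
    refine ⟨fun _ => 1 / (n + 1), fun _ => by positivity, ?_⟩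
    rw [Finset.sum_const, Finset.card_univ, Fintype.card_fin, nsmul_eq_mul, mul_one_div,
      div_lt_one hn]
    linarith
  refine ENNReal.toReal_pos ((isOpen_simplex n).measure_pos _ hne).ne' ?_
  exact ((measure_mono (simplex_subset_Icc n)).trans_lt isCompact_Icc.measure_lt_top).ne

lemma cellInt_one_ne : cellInt (toSmooth 1) ≠ 0 := by
  have h : cellInt (toSmooth 1) = ∫ _x in simplex 3, (1 : ℝ) := by
    change ∫ x in refTet, (toSmooth 1).1 x = _
    simp only [toSmooth_apply, map_one]
    rfl
  rw [h, setIntegral_const, smul_eq_mul, mul_one]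
  exact volume_simplex_pos.ne'

lemma edgeInt_eq_zero_of_edgeTrE {p q : Fin 3 → ℝ} {v : PolyVec 3} (h : edgeTrE p q v = 0) :
    edgeInt p q (toSmoothVec v) = 0 := by
  by_cases hpq : p = q
  · subst hpq
    simp [edgeInt_apply]
  refine edgeInt_eq_zero fun x hx => ?_
  rw [segment_eq_image'] at hx
  obtain ⟨t, -, rfl⟩ := hx
  have := eval_edgeTrE p q (t * edgeLen p q) v
  rw [h, Polynomial.eval_zero, ← smul_smul, edgeLen_smul_edgeDir hpq] at this
  exact this.symm

namespace FaceChart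

variable {i : Fin 4} (c : FaceChart i)

/-- The vector area (twice) of a face is a nonzero multiple of the normal. -/
lemma exists_cross_eq : ∃ β : ℝ, β ≠ 0 ∧
    (vertex (i.succAbove 1) - vertex (i.succAbove 0)) ⨯₃
      (vertex (i.succAbove 2) - vertex (i.succAbove 0)) = β • c.n := by
  have hd (j : Fin 3) : (vertex (i.succAbove j) - vertex (i.succAbove 0)) ⬝ᵥ c.n = 0 := by
    have h1 := c.in_plane _ (Fin.succAbove_ne i j)
    have h2 := c.in_plane _ (Fin.succAbove_ne i 0)
    rw [sub_dotProduct] at h1 h2 ⊢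
    exact (sub_eq_zero.1 h1).trans (sub_eq_zero.1 h2).symm ▸ sub_self _
  have h1 := (c.dot_n_eq_zero_iff _).1 (hd 1)
  have h2 := (c.dot_n_eq_zero_iff _).1 (hd 2)
  set x := vertex (i.succAbove 1) - vertex (i.succAbove 0) with hx
  set y := vertex (i.succAbove 2) - vertex (i.succAbove 0) with hy
  have he : x ⨯₃ y = ((x ⬝ᵥ c.t₁) * (y ⬝ᵥ c.t₂) - (x ⬝ᵥ c.t₂) * (y ⬝ᵥ c.t₁)) • c.n := by
    generalize x ⬝ᵥ c.t₁ = a at *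
    generalize x ⬝ᵥ c.t₂ = b at *
    generalize y ⬝ᵥ c.t₁ = a' at *
    generalize y ⬝ᵥ c.t₂ = b' at *
    rw [h1, h2, n_apply, cross_apply]
    funext m
    fin_cases m <;> simp <;> ring
  refine ⟨_, fun h0 => ?_, he⟩
  rw [h0, zero_smul, hx, hy] at he
  have e0 := congrFun he 0
  have e1 := congrFun he 1
  have e2 := congrFun he 2
  clear he h0 h2 h1 hd
  fin_cases i <;>
    simp [cross_apply, vertex, Fin.succAbove, Fin.lt_def] at e0 e1 e2

lemma faceInt_eq_zero {u : SmoothVec} (h : ∀ x ∈ face i, u.value x ⬝ᵥ c.n = 0) :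
    faceInt i u = 0 := by
  obtain ⟨β, -, hβ⟩ := c.exists_cross_eq
  rw [faceInt, triInt_apply, hβ]
  refine (setIntegral_congr_fun (g := fun _ => (0 : ℝ)) (isOpen_simplex 2).measurableSet
    fun y hy => ?_).trans (by simp)
  simp only
  rw [dotProduct_smul, h _ (triPoint_mem_face i hy), smul_zero]

lemma dot_n_of_mem_face {x : Fin 3 → ℝ} (hx : x ∈ face i) : (x - c.origin) ⬝ᵥ c.n = 0 := by
  have hconv : Convex ℝ {x : Fin 3 → ℝ | (x - c.origin) ⬝ᵥ c.n = 0} := by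
    intro x hx y hy a b _ _ hab
    simp only [Set.mem_ofPred_eq] at *
    have : a • x + b • y - c.origin = a • (x - c.origin) + b • (y - c.origin) := by
      have : c.origin = (a + b) • c.origin := by rw [hab, one_smul]
      conv_lhs => rw [this]
      module
    rw [this, add_dotProduct, smul_dotProduct, smul_dotProduct, hx, hy, smul_zero, smul_zero,
      add_zero]
  refine convexHull_min ?_ hconv hx
  rintro _ ⟨j, hj, rfl⟩
  exact c.in_plane j hj

lemma point_coord {x : Fin 3 → ℝ} (hx : x ∈ face i) : c.point (c.coord x) = x := by
  have h := (c.dot_n_eq_zero_iff _).1 (c.dot_n_of_mem_face hx)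
  simp only [point, coord, Matrix.cons_val_zero, Matrix.cons_val_one, add_assoc]
  rw [← h, add_sub_cancel]

lemma value_dot_n_of_trV {v : PolyVec 3} (h : c.trV v = 0) {x : Fin 3 → ℝ} (hx : x ∈ face i) :
    SmoothVec.value (toSmoothVec v) x ⬝ᵥ c.n = 0 := by
  have := c.eval_trDot c.n (c.coord x) v
  rw [← trV_apply, h, map_zero, c.point_coord hx] at this
  exact this.symm

/-- Flux through the face, as a functional of the normal trace. -/
def flux : Poly 2 →ₗ[ℝ] ℝ where
  toFun g := faceInt i (toSmoothVec (c.liftV g))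
  map_add' f g := by
    rw [← map_add, ← map_add]
    congr 2
    funext m
    simp [liftV, mul_add]
  map_smul' a g := by
    rw [← map_smul, ← map_smul]
    congr 2
    funext m
    simp [liftV]

/-- `v` and the normal lift of its normal trace differ by a field with no normal component on the
face. This is why a functional of plane polynomials can be defined through a lift. -/
lemma flux_trV (v : PolyVec 3) : c.flux (c.trV v) = faceInt i (toSmoothVec v) := by
  change faceInt i (toSmoothVec (c.liftV (c.trV v))) = _
  rw [← sub_eq_zero, ← map_sub, ← map_sub]
  refine c.faceInt_eq_zero fun x hx => c.value_dot_n_of_trV ?_ hx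
  rw [map_sub, trV_liftV, sub_self]

lemma flux_one_ne : c.flux 1 ≠ 0 := by
  obtain ⟨β, hβ0, hβ⟩ := c.exists_cross_eq
  have h : c.flux 1 = ∫ _y in simplex 2, β := by
    change faceInt i (toSmoothVec (c.liftV 1)) = _
    rw [faceInt, triInt_apply, hβ]
    congr 1
    funext y
    have : SmoothVec.value (toSmoothVec (c.liftV 1)) (triPoint (vertex (i.succAbove 0))
        (vertex (i.succAbove 1)) (vertex (i.succAbove 2)) y) = c.n := by
      rw [value_toSmoothVec]
      funext m
      simp [liftV]
    rw [this, dotProduct_smul, c.n_unit, smul_eq_mul, mul_one]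
  rw [h, setIntegral_const, smul_eq_mul]
  exact mul_ne_zero volume_simplex_pos.ne' hβ0

/-- The theorem of Stokes for fields with vanishing tangential trace on the boundary of the face. -/
lemma flux_curl2 {w : PolyVec 2}
    (h : ∀ j : Fin 3, edgeTrE (c.triangle (j + 1)) (c.triangle (j + 2)) w = 0) :
    c.flux (curl2 w) = 0 := by
  -- Every plane field is a tangential trace, so Stokes on a triangle in space applies.
  obtain ⟨v, rfl⟩ : ∃ v, c.trE v = w := ⟨_, c.trE_liftE w⟩
  simp only [edgeTrE_triangle] at h
  rw [c.curl_trE, flux_trV, ← curl3Of_toSmoothVec, faceInt_curl]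
  have h0 : edgeInt (vertex (i.succAbove 1)) (vertex (i.succAbove 2)) (toSmoothVec v) = 0 :=
    edgeInt_eq_zero_of_edgeTrE (h 0)
  have h1 : edgeInt (vertex (i.succAbove 0)) (vertex (i.succAbove 2)) (toSmoothVec v) = 0 :=
    edgeInt_eq_zero_of_edgeTrE (edgeTrE_symm_eq_zero (vertex_injective.ne
      (Fin.succAbove_right_injective.ne (by decide))) (h 1))
  have h2 : edgeInt (vertex (i.succAbove 0)) (vertex (i.succAbove 1)) (toSmoothVec v) = 0 :=
    edgeInt_eq_zero_of_edgeTrE (h 2)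
  rw [h0, h1, h2]
  simp

end FaceChart

end FES

namespace FES

open MvPolynomial

/-! ### Compatibility of the polynomial sequences -/

instance (d p : ℕ) : FiniteDimensional ℝ (PVec d p) :=
  (finrank_pi_submodule fun _ : Fin d => P d p).1

lemma nedelec3_le (k : ℕ) : PVec 3 k ⊔ (PhomVec 3 k).map xCross3 ≤ PVec 3 (k + 1) :=
  fun _ hv => (mem_nedelec3.1 hv).1

lemma raviartThomas_le (k : ℕ) : PVec 3 k ⊔ (Phom 3 k).map xMul3 ≤ PVec 3 (k + 1) :=
  fun _ hv => (mem_raviartThomas.1 hv).1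

lemma nedelec2_le (k : ℕ) : PVec 2 k ⊔ (Phom 2 k).map xCross2 ≤ PVec 2 (k + 1) :=
  fun _ hv => (mem_nedelec2.1 hv).1

lemma FaceChart.isCompatible_S1tri (c : ∀ i, FaceChart i) (i : Fin 4) (k : ℕ) :
    (S1tri k).IsCompatible (c i).triangle ∧ Module.finrank ℝ (S1tri k).W =
      Module.finrank ℝ (((S1tri k).bubbleE (c i).triangle).map curl2) + 1 :=
  isCompatible2 (r := k + 1) (FaceChart.isBarycentric_trH c i) rfl
    (inferInstanceAs (FiniteDimensional ℝ (PVec 2 (k + 1))))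
    (inferInstanceAs (FiniteDimensional ℝ (P 2 k))) (S1tri_isExact k)
    (fun _ _ h => map_edgeTrE_eq h (fun _ hv => edgeTrE_mem_P1_of_PVec hv) le_rfl)
    (c i).flux (fun _ hv => (c i).flux_curl2 (Seq2.mem_bubbleE.1 hv).2)
    ⟨1, one_mem_P _, (c i).flux_one_ne⟩

lemma FaceChart.isCompatible_S2tri (c : ∀ i, FaceChart i) (i : Fin 4) (k : ℕ) :
    (S2tri k).IsCompatible (c i).triangle ∧ Module.finrank ℝ (S2tri k).W =
      Module.finrank ℝ (((S2tri k).bubbleE (c i).triangle).map curl2) + 1 :=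
  isCompatible2 (r := k) (FaceChart.isBarycentric_trH c i) rfl
    (Submodule.finiteDimensional_of_le (nedelec2_le k))
    (inferInstanceAs (FiniteDimensional ℝ (P 2 k))) (S2tri_isExact k)
    (fun _ _ h => map_edgeTrE_eq h (fun _ hv => edgeTrE_mem_P1_of_dot (mem_nedelec2.1 hv).1
      (mem_nedelec2.1 hv).2) le_sup_left)
    (c i).flux (fun _ hv => (c i).flux_curl2 (Seq2.mem_bubbleE.1 hv).2)
    ⟨1, one_mem_P _, (c i).flux_one_ne⟩

namespace Seq3

/-- Compatible sequences for which the sequences of bubbles on the edges, the faces and the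
tetrahedron are exact up to the constants in the last space. -/
structure HasExactBubbles (S : Seq3) (c : ∀ i, FaceChart i) : Prop where
  compat : S.IsCompatible c
  edge : ∀ e, (S.edgeTrace e).IsCompatible (edgeLen e.p e.q)
  face_W : ∀ i, Module.finrank ℝ (S.faceTrace (c i)).W =
    Module.finrank ℝ (((S.faceTrace (c i)).bubbleE (c i).triangle).map curl2) + 1
  map_curl : (S.bubbleE c).map curl3 = S.bubbleV c ⊓ LinearMap.ker div3
  finrank_W : Module.finrank ℝ S.W ≤ Module.finrank ℝ ((S.bubbleV c).map div3) + 1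
  one_mem_face : ∀ i, 1 ∈ (S.faceTrace (c i)).W
  one_mem : 1 ∈ S.W

end Seq3

theorem S1tet_hasExactBubbles (k : ℕ) (c : ∀ i, FaceChart i) : (S1tet k).HasExactBubbles c := by
  have hedge (p q : Fin 3 → ℝ) (h : p ≠ q) : (S1tet k).E.map (edgeTrE p q) = P1 (k + 2) :=
    map_edgeTrE_eq h (fun _ hv => edgeTrE_mem_P1_of_PVec hv) le_rfl
  have hface (i : Fin 4) := FaceChart.isCompatible_S1tri c i (k + 1)
  have finV : FiniteDimensional ℝ (S1tet k).V :=
    inferInstanceAs (FiniteDimensional ℝ (PVec 3 (k + 1)))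
  -- The bubbles `A ∇q` lie in the first kind space, which is contained in `𝓟_{k+1}³`; one
  -- construction serves both sequences.
  have hdiv := Seq3.finrank_div_bubbleV (S := S1tet k) (c := c) (k := k) rfl
    (raviartThomas_le k) finV
  have hface' (i : Fin 4) : Module.finrank ℝ ((S1tet k).faceTrace (c i)).W = Module.finrank ℝ
      ((((S1tet k).faceTrace (c i)).bubbleE (c i).triangle).map curl2) + 1 := by
    rw [S1tet_faceTrace]; exact (hface i).2
  obtain ⟨h1, h2⟩ := Seq3.isCompatible3 (S := S1tet k) (c := c) (r := k + 2) rfl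
    (inferInstanceAs (FiniteDimensional ℝ (PVec 3 (k + 2)))) finV
    (inferInstanceAs (FiniteDimensional ℝ (P 3 k))) (S1tet_isExact k)
    (fun i => by rw [S1tet_faceTrace]; exact (hface i).1) hface' hedge
    (fun i w hw => S1tet_extension c k i (by rwa [S1tet_faceTrace] at hw)) hdiv
  exact
    { compat := h1
      edge := Seq3.edgeTrace_isCompatible rfl hedge
      face_W := hface'
      map_curl := h2
      finrank_W := hdiv
      one_mem_face := fun i => by rw [S1tet_faceTrace]; exact one_mem_P _
      one_mem := one_mem_P _ }

theorem S2tet_hasExactBubbles (k : ℕ) (c : ∀ i, FaceChart i) : (S2tet k).HasExactBubbles c := by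
  have hedge (p q : Fin 3 → ℝ) (h : p ≠ q) : (S2tet k).E.map (edgeTrE p q) = P1 k :=
    map_edgeTrE_eq h (fun _ hv => edgeTrE_mem_P1_of_dot (mem_nedelec3.1 hv).1
      (mem_nedelec3.1 hv).2) le_sup_left
  have hface (i : Fin 4) := FaceChart.isCompatible_S2tri c i k
  have finV : FiniteDimensional ℝ (S2tet k).V :=
    Submodule.finiteDimensional_of_le (raviartThomas_le k)
  have hdiv := Seq3.finrank_div_bubbleV (S := S2tet k) (c := c) (k := k) rfl le_rfl finV
  have hface' (i : Fin 4) : Module.finrank ℝ ((S2tet k).faceTrace (c i)).W = Module.finrank ℝ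
      ((((S2tet k).faceTrace (c i)).bubbleE (c i).triangle).map curl2) + 1 := by
    rw [S2tet_faceTrace]; exact (hface i).2
  obtain ⟨h1, h2⟩ := Seq3.isCompatible3 (S := S2tet k) (c := c) (r := k) rfl
    (Submodule.finiteDimensional_of_le (nedelec3_le k)) finV
    (inferInstanceAs (FiniteDimensional ℝ (P 3 k))) (S2tet_isExact k)
    (fun i => by rw [S2tet_faceTrace]; exact (hface i).1) hface' hedge
    (fun i w hw => S2tet_extension c k i (by rwa [S2tet_faceTrace] at hw)) hdiv
  exact
    { compat := h1
      edge := Seq3.edgeTrace_isCompatible rfl hedge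
      face_W := hface'
      map_curl := h2
      finrank_W := hdiv
      one_mem_face := fun i => by rw [S2tet_faceTrace]; exact one_mem_P _
      one_mem := one_mem_P _ }

end FES

namespace FES

open MvPolynomial

/-! ### Moments -/

lemma eq_zero_of_eval_eq_zero {d : ℕ} {U : Set (Fin d → ℝ)} (hU : IsOpen U) (hne : U.Nonempty)
    {f : Poly d} (hf : ∀ x ∈ U, eval x f = 0) : f = 0 := by
  obtain ⟨x, hx⟩ := hne
  obtain ⟨ε, hε, hball⟩ := Metric.isOpen_iff.1 hU x hx
  rw [ball_pi x hε] at hball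
  refine MvPolynomial.funext_set (fun i => Metric.ball (x i) ε) (fun i => ?_) fun y hy => ?_
  · rw [Real.ball_eq_Ioo]
    exact Set.Ioo_infinite (by linarith)
  · rw [hf y (hball hy), map_zero]

lemma refTet_nonempty : refTet.Nonempty :=
  ⟨fun _ => 1 / 4, fun _ => by norm_num, by norm_num [Fin.sum_univ_three]⟩

lemma isOpen_refTet : IsOpen refTet := isOpen_simplex 3

/-- The interior of a face, in the coordinates of the face. -/
def faceRegion (c : ∀ i, FaceChart i) (i : Fin 4) : Set (Fin 2 → ℝ) :=
  {s | ∀ j ≠ i, 0 < eval ((c i).point s) (c j).bary}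

/-! ### The open region of a face on which traces are tested -/

section FaceRegion

variable (c : ∀ i, FaceChart i) (i : Fin 4)

lemma FaceChart.continuous_point {i : Fin 4} (c : FaceChart i) : Continuous c.point := by
  unfold FaceChart.point
  fun_prop

lemma isOpen_faceRegion : IsOpen (faceRegion c i) := by
  simp only [faceRegion, Set.ofPred_forall]
  exact isOpen_iInter_of_finite fun j => isOpen_iInter_of_finite fun _ =>
    isOpen_lt continuous_const ((MvPolynomial.continuous_eval _).comp (c i).continuous_point)

lemma faceRegion_nonempty : (faceRegion c i).Nonempty := by
  let x : Fin 3 → ℝ := ∑ j : Fin 3, (1 / 3 : ℝ) • vertex (i.succAbove j)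
  have hx : x ∈ face i := (convex_convexHull ℝ _).sum_mem (fun _ _ => by norm_num)
    (by norm_num [Fin.sum_univ_three]) fun j _ => vertex_mem_face (Fin.succAbove_ne i j)
  refine ⟨(c i).coord x, fun l hl => ?_⟩
  have h1 : eval x (c l).bary = ∑ j : Fin 3, (1 / 3 : ℝ) * eval (vertex (i.succAbove j)) (c l).bary := by
    simp only [FaceChart.eval_bary]
    have h2 : x - (c l).origin =
        ∑ j : Fin 3, (1 / 3 : ℝ) • (vertex (i.succAbove j) - (c l).origin) := by
      simp only [x, Fin.sum_univ_three]
      module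
    rw [h2, sum_dotProduct, Finset.mul_sum]
    refine Finset.sum_congr rfl fun j _ => ?_
    rw [smul_dotProduct, smul_eq_mul]
    ring
  obtain ⟨j, rfl⟩ := Fin.exists_succAbove_eq hl
  rw [(c i).point_coord hx, h1]
  simp [(isBarycentric_bary c).eval]

variable {i}

lemma point_mem_face {s : Fin 2 → ℝ} (hs : s ∈ faceRegion c i) : (c i).point s ∈ face i := by
  have h0 : eval ((c i).point s) (c i).bary = 0 := by
    rw [← FaceChart.eval_trAlg, ← FaceChart.trH_apply, FaceChart.trH_bary, map_zero]
  have h1 := congrArg (eval ((c i).point s)) (sum_bary c)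
  rw [map_sum, map_one, Fin.sum_univ_succAbove _ i, h0, zero_add] at h1
  have h2 : (c i).point s = ∑ j : Fin 3,
      eval ((c i).point s) (c (i.succAbove j)).bary • vertex (i.succAbove j) := by
    funext m
    have := congrArg (eval ((c i).point s)) (sum_bary_mul_vertex c m)
    rw [map_sum, eval_X, Fin.sum_univ_succAbove _ i, map_mul, h0, zero_mul, zero_add] at this
    rw [← this]
    simp
  rw [h2]
  exact (convex_convexHull ℝ _).sum_mem (fun j _ => (hs _ (Fin.succAbove_ne i j)).le) h1
    fun j _ => vertex_mem_face (Fin.succAbove_ne i j)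

end FaceRegion

/-- Linear functionals which retract smooth fields to a space of polynomials, where agreement of a
field with a polynomial is given by the relation `R`. -/
def IsRetraction {F M : Type*} [AddCommGroup F] [Module ℝ F] [AddCommGroup M] [Module ℝ M]
    {N : Submodule ℝ M} (R : F → M → Prop) (m : F →ₗ[ℝ] N) : Prop :=
  ∀ u (x : N), R u x → m u = x

/-- The field has the tangential component `f` on the edge. -/
def EdgeAgree (e : Edge) (u : SmoothVec) (f : Polynomial ℝ) : Prop :=
  ∀ s ∈ Set.Ioo 0 (edgeLen e.p e.q),
    u.value (e.p + s • edgeDir e.p e.q) ⬝ᵥ edgeDir e.p e.q = f.eval s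

/-- The field has the tangential components `w` on the face. -/
def FaceAgreeE (c : ∀ i, FaceChart i) (i : Fin 4) (u : SmoothVec) (w : PolyVec 2) : Prop :=
  ∀ s ∈ faceRegion c i, u.value ((c i).point s) ⬝ᵥ (c i).t₁ = eval s (w 0) ∧
    u.value ((c i).point s) ⬝ᵥ (c i).t₂ = eval s (w 1)

/-- The field has the normal component `w` on the face. -/
def FaceAgreeV (c : ∀ i, FaceChart i) (i : Fin 4) (u : SmoothVec) (w : Poly 2) : Prop :=
  ∀ s ∈ faceRegion c i, u.value ((c i).point s) ⬝ᵥ (c i).n = eval s w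

/-- The field equals `v` on the tetrahedron. -/
def CellAgreeVec (u : SmoothVec) (v : PolyVec 3) : Prop :=
  ∀ x ∈ refTet, u.value x = SmoothVec.value (toSmoothVec v) x

/-- The function equals `f` on the tetrahedron. -/
def CellAgree (u : SmoothScalar) (f : Poly 3) : Prop := ∀ x ∈ refTet, u.1 x = eval x f

namespace Seq3

variable (S : Seq3) (c : ∀ i, FaceChart i)

/-- Derivatives of bubbles on an edge. -/
def edgeGrads (e : Edge) : Submodule ℝ (Polynomial ℝ) :=
  ((S.edgeTrace e).bubbleH (edgeLen e.p e.q)).map Polynomial.derivative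

/-- Gradients of bubbles on a face. -/
def faceGrads (i : Fin 4) : Submodule ℝ (PolyVec 2) :=
  ((S.faceTrace (c i)).bubbleH (c i).triangle).map (grad 2)

/-- Curls of bubbles on a face. -/
def faceCurls (i : Fin 4) : Submodule ℝ (Poly 2) :=
  ((S.faceTrace (c i)).bubbleE (c i).triangle).map curl2

/-- Gradients of bubbles. -/
def cellGrads : Submodule ℝ (PolyVec 3) := (S.bubbleH c).map (grad 3)

/-- Curls of bubbles. -/
def cellCurls : Submodule ℝ (PolyVec 3) := (S.bubbleE c).map curl3

/-- Divergences of bubbles. -/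
def cellDivs : Submodule ℝ (Poly 3) := (S.bubbleV c).map div3

end Seq3

/-! ### Existence of retractions that depend only on a trace -/

section Existence

variable {M A F : Type*} [AddCommGroup M] [Module ℝ M] [AddCommGroup A] [Module ℝ A]
  [AddCommGroup F] [Module ℝ F]

/-- The retraction is a purely algebraic left inverse on a space of arbitrary functions; no inner
product or continuity is involved. What matters is that it factors through the restriction `tr`,
hence sees nothing else of the field. -/
lemma exists_moment (N : Submodule ℝ M) (res : M →ₗ[ℝ] A) (hres : ∀ x, res x = 0 → x = 0)
    (tr : F →ₗ[ℝ] A) : ∃ m : F →ₗ[ℝ] N, ∀ u (x : N), tr u = res x → m u = x := by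
  obtain ⟨Q, hQ⟩ := exists_retraction N res fun x _ => hres x
  exact ⟨Q ∘ₗ tr, fun u x h => by rw [LinearMap.comp_apply, h, hQ]⟩

variable {X : Type*}

/-- Component along a vector of a smooth field, at the points of a parametrized set. -/
def fieldDot (f : X → Fin 3 → ℝ) (a : Fin 3 → ℝ) : SmoothVec →ₗ[ℝ] (X → ℝ) where
  toFun u x := u.value (f x) ⬝ᵥ a
  map_add' u v := by
    funext x
    rw [SmoothVec.value_add, add_dotProduct]
    rfl
  map_smul' r u := by
    funext x
    rw [SmoothVec.value_smul, smul_dotProduct]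
    rfl

/-- Values of polynomials on a set. -/
def polyRes {d : ℕ} (U : Set (Fin d → ℝ)) : Poly d →ₗ[ℝ] (U → ℝ) := pointTr Subtype.val

lemma polyRes_injective {d : ℕ} {U : Set (Fin d → ℝ)} (hU : IsOpen U) (hne : U.Nonempty)
    (f : Poly d) (h : polyRes U f = 0) : f = 0 :=
  eq_zero_of_eval_eq_zero hU hne fun x hx => congrFun h ⟨x, hx⟩

/-- Values of polynomial fields on a set. -/
def polyVecRes {d m : ℕ} (U : Set (Fin d → ℝ)) : (Fin m → Poly d) →ₗ[ℝ] (Fin m → U → ℝ) :=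
  LinearMap.pi fun j => polyRes U ∘ₗ LinearMap.proj j

lemma polyVecRes_injective {d m : ℕ} {U : Set (Fin d → ℝ)} (hU : IsOpen U) (hne : U.Nonempty)
    (f : Fin m → Poly d) (h : polyVecRes U f = 0) : f = 0 :=
  funext fun j => polyRes_injective hU hne _ (congrFun h j)

lemma exists_moment_edge (e : Edge) (N : Submodule ℝ (Polynomial ℝ)) :
    ∃ m : SmoothVec →ₗ[ℝ] N, IsRetraction (EdgeAgree e) m := by
  let res : Polynomial ℝ →ₗ[ℝ] (Set.Ioo 0 (edgeLen e.p e.q) → ℝ) :=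
    LinearMap.pi fun s => Polynomial.leval s.1
  have hres (f : Polynomial ℝ) (hf : res f = 0) : f = 0 :=
    Polynomial.eq_zero_of_infinite_isRoot f ((Set.Ioo_infinite (edgeLen_pos e.p_ne_q)).mono
      fun s hs => congrFun hf ⟨s, hs⟩)
  obtain ⟨m, hm⟩ := exists_moment N res hres (fieldDot
    (fun s : Set.Ioo 0 (edgeLen e.p e.q) => e.p + s.1 • edgeDir e.p e.q) (edgeDir e.p e.q))
  exact ⟨m, fun u x h => hm u x (funext fun s => h s s.2)⟩

variable (c : ∀ i, FaceChart i) (i : Fin 4)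

lemma exists_moment_faceE (N : Submodule ℝ (PolyVec 2)) :
    ∃ m : SmoothVec →ₗ[ℝ] N, IsRetraction (FaceAgreeE c i) m := by
  obtain ⟨m, hm⟩ := exists_moment N (polyVecRes (faceRegion c i))
    (polyVecRes_injective (isOpen_faceRegion c i) (faceRegion_nonempty c i))
    (LinearMap.pi ![fieldDot (fun s : faceRegion c i => (c i).point s) (c i).t₁,
      fieldDot (fun s : faceRegion c i => (c i).point s) (c i).t₂])
  refine ⟨m, fun u x h => hm u x (funext fun j => funext fun s => ?_)⟩
  fin_cases j
  · exact (h s s.2).1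
  · exact (h s s.2).2

lemma exists_moment_faceV (N : Submodule ℝ (Poly 2)) :
    ∃ m : SmoothVec →ₗ[ℝ] N, IsRetraction (FaceAgreeV c i) m := by
  obtain ⟨m, hm⟩ := exists_moment N (polyRes (faceRegion c i))
    (polyRes_injective (isOpen_faceRegion c i) (faceRegion_nonempty c i))
    (fieldDot (fun s : faceRegion c i => (c i).point s) (c i).n)
  exact ⟨m, fun u x h => hm u x (funext fun s => h s s.2)⟩

/-- Values of smooth functions on the tetrahedron. -/
def cellRes : SmoothScalar →ₗ[ℝ] (refTet → ℝ) where
  toFun u x := u.1 x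
  map_add' _ _ := rfl
  map_smul' _ _ := rfl

lemma exists_moment_cellVec (N : Submodule ℝ (PolyVec 3)) :
    ∃ m : SmoothVec →ₗ[ℝ] N, IsRetraction CellAgreeVec m := by
  obtain ⟨m, hm⟩ := exists_moment N (polyVecRes refTet)
    (polyVecRes_injective isOpen_refTet refTet_nonempty)
    (LinearMap.pi fun j => cellRes ∘ₗ LinearMap.proj j)
  exact ⟨m, fun u x h => hm u x (funext fun j => funext fun s => congrFun (h s s.2) j)⟩

lemma exists_moment_cell (N : Submodule ℝ (Poly 3)) :
    ∃ m : SmoothScalar →ₗ[ℝ] N, IsRetraction CellAgree m := by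
  obtain ⟨m, hm⟩ := exists_moment N (polyRes refTet)
    (polyRes_injective isOpen_refTet refTet_nonempty) cellRes
  exact ⟨m, fun u x h => hm u x (funext fun s => h s s.2)⟩

end Existence

/-! The degrees of freedom: retractions of smooth fields to derivatives of bubbles. -/

namespace Seq3

variable (S : Seq3) (c : ∀ i, FaceChart i)

def edgeMoment (e : Edge) : SmoothVec →ₗ[ℝ] S.edgeGrads e :=
  (exists_moment_edge e (S.edgeGrads e)).choose

def faceGradMoment (i : Fin 4) : SmoothVec →ₗ[ℝ] S.faceGrads c i :=
  (exists_moment_faceE c i (S.faceGrads c i)).choose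

/-- One functional serves two purposes: it is applied to `curl u` for fields in `E` and to the field
itself in `V`. Sharing it makes the degrees of freedom commute with the curl; `cellCurlMoment` and
`cellDivMoment` are shared likewise, as are the gradient moments between `H` and `E`. -/
def faceCurlMoment (i : Fin 4) : SmoothVec →ₗ[ℝ] S.faceCurls c i :=
  (exists_moment_faceV c i (S.faceCurls c i)).choose

def cellGradMoment : SmoothVec →ₗ[ℝ] S.cellGrads c := (exists_moment_cellVec (S.cellGrads c)).choose

def cellCurlMoment : SmoothVec →ₗ[ℝ] S.cellCurls c := (exists_moment_cellVec (S.cellCurls c)).choose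

def cellDivMoment : SmoothScalar →ₗ[ℝ] S.cellDivs c := (exists_moment_cell (S.cellDivs c)).choose

lemma edgeMoment_spec (e : Edge) : IsRetraction (EdgeAgree e) (S.edgeMoment e) :=
  (exists_moment_edge e (S.edgeGrads e)).choose_spec

lemma faceGradMoment_spec (i : Fin 4) : IsRetraction (FaceAgreeE c i) (S.faceGradMoment c i) :=
  (exists_moment_faceE c i (S.faceGrads c i)).choose_spec

lemma faceCurlMoment_spec (i : Fin 4) : IsRetraction (FaceAgreeV c i) (S.faceCurlMoment c i) :=
  (exists_moment_faceV c i (S.faceCurls c i)).choose_spec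

lemma cellGradMoment_spec : IsRetraction CellAgreeVec (S.cellGradMoment c) :=
  (exists_moment_cellVec (S.cellGrads c)).choose_spec

lemma cellCurlMoment_spec : IsRetraction CellAgreeVec (S.cellCurlMoment c) :=
  (exists_moment_cellVec (S.cellCurls c)).choose_spec

lemma cellDivMoment_spec : IsRetraction CellAgree (S.cellDivMoment c) :=
  (exists_moment_cell (S.cellDivs c)).choose_spec

end Seq3

end FES

namespace FES

open MvPolynomial

/-! ### Unisolvence -/

lemma IsRetraction.eq_of_agree {F M : Type*} [AddCommGroup F] [Module ℝ F] [AddCommGroup M]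
    [Module ℝ M] {N : Submodule ℝ M} {R : F → M → Prop} {m : F →ₗ[ℝ] N} (hm : IsRetraction R m)
    {u : F} {x : M} (hx : x ∈ N) (h : R u x) (h0 : m u = 0) : x = 0 := by
  have := hm u ⟨x, hx⟩ h
  rw [h0] at this
  exact (congrArg Subtype.val this).symm

lemma IsRetraction.eq_zero {F M : Type*} [AddCommGroup F] [Module ℝ F] [AddCommGroup M]
    [Module ℝ M] {N : Submodule ℝ M} {R : F → M → Prop} {m : F →ₗ[ℝ] N} (hm : IsRetraction R m)
    {u : F} (h : R u 0) : m u = 0 := hm u 0 h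

lemma edgeAgree_toSmoothVec (e : Edge) (v : PolyVec 3) :
    EdgeAgree e (toSmoothVec v) (edgeTrE e.p e.q v) := fun s _ => (eval_edgeTrE _ _ s v).symm

lemma faceAgreeE_toSmoothVec (c : ∀ i, FaceChart i) (i : Fin 4) (v : PolyVec 3) :
    FaceAgreeE c i (toSmoothVec v) ((c i).trE v) := fun s _ =>
  ⟨((c i).eval_trDot _ s v).symm, ((c i).eval_trDot _ s v).symm⟩

lemma faceAgreeV_toSmoothVec (c : ∀ i, FaceChart i) (i : Fin 4) (v : PolyVec 3) :
    FaceAgreeV c i (toSmoothVec v) ((c i).trV v) := fun s _ => ((c i).eval_trDot _ s v).symm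

lemma cellAgreeVec_toSmoothVec (v : PolyVec 3) : CellAgreeVec (toSmoothVec v) v := fun _ _ => rfl

lemma cellAgree_toSmooth (f : Poly 3) : CellAgree (toSmooth f) f := fun _ _ => rfl

lemma triangle_ne (c : ∀ i, FaceChart i) (i : Fin 4) (j : Fin 3) :
    (c i).triangle (j + 1) ≠ (c i).triangle (j + 2) :=
  (FaceChart.isBarycentric_trH c i).ne (fin3_ne j).1

/-- The integral of a polynomial over the tetrahedron. -/
def cellIntPoly : Poly 3 →ₗ[ℝ] ℝ := cellInt ∘ₗ toSmooth

namespace Seq3.HasExactBubbles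

variable {S : Seq3} {c : ∀ i, FaceChart i}

/-- The trace is the derivative of some edge function. Zero circulation makes its end values equal,
so up to a constant it is a bubble; the retraction then reproduces the trace, and it is zero by
assumption. -/
lemma edgeTrE_eq_zero (h : S.HasExactBubbles c) (e : Edge) {v : PolyVec 3} (hv : v ∈ S.E)
    (h1 : edgeInt e.p e.q (toSmoothVec v) = 0) (h2 : S.edgeMoment e (toSmoothVec v) = 0) :
    edgeTrE e.p e.q v = 0 := by
  refine (S.edgeMoment_spec e).eq_of_agree ?_ (edgeAgree_toSmoothVec e v) h2
  have h3 : edgeTrE e.p e.q v ∈ (S.edgeTrace e).W := ⟨v, hv, rfl⟩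
  rw [← (h.edge e).exact.range_grad] at h3
  obtain ⟨_, ⟨f, hf, rfl⟩, hfv⟩ := h3
  have h4 : edgeInt e.p e.q (toSmoothVec (v - grad 3 f)) = 0 := by
    refine edgeInt_eq_zero_of_edgeTrE ?_
    rw [map_sub, ← derivative_edgeTrH, hfv, sub_self]
  rw [map_sub, map_sub, h1, zero_sub, neg_eq_zero, ← gradOf_toSmooth, edgeInt_grad, sub_eq_zero,
    toSmooth_apply, toSmooth_apply] at h4
  have hC : C (eval e.p f) ∈ S.H ⊓ LinearMap.ker (grad 3) := by
    rw [← h.compat.exact.ker_grad]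
    exact ⟨_, rfl⟩
  refine ⟨edgeTrH e.p e.q (f - C (eval e.p f)), ?_, ?_⟩
  · refine (mem_bubbleH_edgeTrH (S := S.edgeTrace e) e.p_ne_q
      ⟨_, Submodule.sub_mem _ hf hC.1, rfl⟩).2 ⟨?_, ?_⟩
    · simp
    · simp [h4]
  · rw [map_sub, Polynomial.derivative_sub, hfv, derivative_edgeTrH, LinearMap.mem_ker.1 hC.2,
      map_zero, sub_zero]

/-- Without edge traces the face trace is a bubble. The moment of the curl first shows that it has
zero curl; by exactness of bubbles it is then the gradient of a bubble, which the second moment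
detects. -/
lemma trE_eq_zero (h : S.HasExactBubbles c) (i : Fin 4) {v : PolyVec 3} (hv : v ∈ S.E)
    (h0 : ∀ e : Edge, e.1.1 ≠ i → e.1.2 ≠ i → edgeTrE e.p e.q v = 0)
    (h1 : S.faceCurlMoment c i (curl3Of smoothD (toSmoothVec v)) = 0)
    (h2 : S.faceGradMoment c i (toSmoothVec v) = 0) : (c i).trE v = 0 := by
  have hb := (c i).trE_mem_bubbleE hv h0
  have hc : curl2 ((c i).trE v) = 0 := by
    refine (S.faceCurlMoment_spec c i).eq_of_agree ⟨_, hb, rfl⟩ ?_ h1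
    rw [(c i).curl_trE, curl3Of_toSmoothVec]
    exact faceAgreeV_toSmoothVec c i _
  refine (S.faceGradMoment_spec c i).eq_of_agree ?_ (faceAgreeE_toSmoothVec c i v) h2
  rw [faceGrads, ← FES.bubbleE_inf_ker_curl (triangle_ne c i) (h.compat.face i).exact]
  exact ⟨hb, hc⟩

lemma E_eq_zero (h : S.HasExactBubbles c) {v : PolyVec 3} (hv : v ∈ S.E)
    (h0 : ∀ i, (c i).trE v = 0)
    (h1 : S.cellCurlMoment c (curl3Of smoothD (toSmoothVec v)) = 0)
    (h2 : S.cellGradMoment c (toSmoothVec v) = 0) : v = 0 := by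
  have hb : v ∈ S.bubbleE c := mem_bubbleE.2 ⟨hv, h0⟩
  have hc : curl3 v = 0 := by
    refine (S.cellCurlMoment_spec c).eq_of_agree ⟨_, hb, rfl⟩ ?_ h1
    rw [curl3Of_toSmoothVec]
    exact cellAgreeVec_toSmoothVec _
  refine (S.cellGradMoment_spec c).eq_of_agree ?_ (cellAgreeVec_toSmoothVec v) h2
  rw [cellGrads, ← Seq3.bubbleE_inf_ker_curl h.compat.exact]
  exact ⟨hb, hc⟩

/-- Curls of bubbles have codimension one in `W` of the face and are annihilated by the flux, so a
normal trace of zero flux is such a curl and the moment detects it. -/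
lemma trV_eq_zero (h : S.HasExactBubbles c) (i : Fin 4) {v : PolyVec 3} (hv : v ∈ S.V)
    (h1 : faceInt i (toSmoothVec v) = 0) (h2 : S.faceCurlMoment c i (toSmoothVec v) = 0) :
    (c i).trV v = 0 := by
  refine (S.faceCurlMoment_spec c i).eq_of_agree ?_ (faceAgreeV_toSmoothVec c i v) h2
  have hf := h.compat.face i
  have := hf.finW
  refine mem_of_functional_eq_zero (N := (S.faceTrace (c i)).W) (φ := (c i).flux) ?_
    (h.face_W i).le ?_ ⟨1, h.one_mem_face i, (c i).flux_one_ne⟩ ⟨v, hv, rfl⟩ ?_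
  · rw [← hf.exact.range_curl]
    exact Submodule.map_mono inf_le_left
  · rintro _ ⟨w, hw, rfl⟩
    exact (c i).flux_curl2 (Seq2.mem_bubbleE.1 hw).2
  · rw [FaceChart.flux_trV, h1]

/-- The divergence moment makes the bubble divergence-free; `map_curl` then writes it as the curl of
a bubble. -/
lemma V_eq_zero (h : S.HasExactBubbles c) {v : PolyVec 3} (hv : v ∈ S.V)
    (h0 : ∀ i, (c i).trV v = 0)
    (h1 : S.cellDivMoment c (div3Of smoothD (toSmoothVec v)) = 0)
    (h2 : S.cellCurlMoment c (toSmoothVec v) = 0) : v = 0 := by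
  have hb : v ∈ S.bubbleV c := mem_bubbleV.2 ⟨hv, h0⟩
  have hc : div3 v = 0 := by
    refine (S.cellDivMoment_spec c).eq_of_agree ⟨_, hb, rfl⟩ ?_ h1
    rw [div3Of_toSmoothVec]
    exact cellAgree_toSmooth _
  refine (S.cellCurlMoment_spec c).eq_of_agree ?_ (cellAgreeVec_toSmoothVec v) h2
  rw [cellCurls, h.map_curl]
  exact ⟨hb, hc⟩

lemma cellDivs_le (h : S.HasExactBubbles c) : S.cellDivs c ≤ S.W := by
  rw [← h.compat.exact.range_div]
  exact Submodule.map_mono inf_le_left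

lemma cellIntPoly_cellDivs {f : Poly 3} (hf : f ∈ S.cellDivs c) : cellIntPoly f = 0 := by
  obtain ⟨v, hv, rfl⟩ := hf
  have h0 (i : Fin 4) : faceInt i (toSmoothVec v) = 0 :=
    (c i).faceInt_eq_zero fun x hx => (c i).value_dot_n_of_trV ((mem_bubbleV.1 hv).2 i) hx
  rw [cellIntPoly, LinearMap.comp_apply, ← div3Of_toSmoothVec, cellInt_div, h0, h0, h0, h0]
  simp

lemma W_eq_zero (h : S.HasExactBubbles c) {f : Poly 3} (hf : f ∈ S.W)
    (h1 : cellInt (toSmooth f) = 0) (h2 : S.cellDivMoment c (toSmooth f) = 0) : f = 0 := by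
  refine (S.cellDivMoment_spec c).eq_of_agree ?_ (cellAgree_toSmooth f) h2
  have := h.compat.finW
  exact mem_of_functional_eq_zero (φ := cellIntPoly) h.cellDivs_le h.finrank_W
    (fun _ => cellIntPoly_cellDivs) ⟨1, h.one_mem, cellInt_one_ne⟩ hf h1

/-! Dimensions of the spaces of moments. -/

lemma finrank_edgeGrads (h : S.HasExactBubbles c) (e : Edge) :
    FiniteDimensional ℝ (S.edgeGrads e) ∧ Module.finrank ℝ (S.edgeGrads e) =
      Module.finrank ℝ ((S.edgeTrace e).bubbleH (edgeLen e.p e.q)) ∧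
      Module.finrank ℝ (S.edgeTrace e).W = Module.finrank ℝ (S.edgeGrads e) + 1 := by
  have := (h.edge e).finH
  have hf : FiniteDimensional ℝ ((S.edgeTrace e).bubbleH (edgeLen e.p e.q)) :=
    Submodule.finiteDimensional_of_le inf_le_left
  have h1 := finrank_map_add_inf_ker ((S.edgeTrace e).bubbleH (edgeLen e.p e.q))
    (Polynomial.derivative (R := ℝ))
  have h2 : (S.edgeTrace e).bubbleH (edgeLen e.p e.q) ⊓
      LinearMap.ker (Polynomial.derivative (R := ℝ)) = ⊥ := by
    refine (Submodule.eq_bot_iff _).2 fun f hf => ?_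
    obtain ⟨a, rfl⟩ := const_of_derivative_eq_zero hf.2
    have := (mem_bubbleH1.1 hf.1).2.1
    rw [Polynomial.eval_C] at this
    rw [this, Polynomial.C_0]
  rw [h2, finrank_bot, add_zero] at h1
  refine ⟨?_, h1, ?_⟩
  · rw [edgeGrads]; infer_instance
  · rw [(h.edge e).finrank_W, ← h1, edgeGrads]

lemma finrank_faceGrads (h : S.HasExactBubbles c) (i : Fin 4) :
    FiniteDimensional ℝ (S.faceGrads c i) ∧ Module.finrank ℝ (S.faceGrads c i) =
      Module.finrank ℝ ((S.faceTrace (c i)).bubbleH (c i).triangle) := by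
  have := (h.compat.face i).finH
  have hf : FiniteDimensional ℝ ((S.faceTrace (c i)).bubbleH (c i).triangle) :=
    Submodule.finiteDimensional_of_le inf_le_left
  exact ⟨by rw [faceGrads]; infer_instance, finrank_grad_bubbleH2⟩

lemma finrank_faceCurls (h : S.HasExactBubbles c) (i : Fin 4) :
    FiniteDimensional ℝ (S.faceCurls c i) ∧
      Module.finrank ℝ ((S.faceTrace (c i)).bubbleE (c i).triangle) =
        Module.finrank ℝ (S.faceCurls c i) + Module.finrank ℝ (S.faceGrads c i) := by
  have := (h.compat.face i).finE
  have hf : FiniteDimensional ℝ ((S.faceTrace (c i)).bubbleE (c i).triangle) :=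
    Submodule.finiteDimensional_of_le inf_le_left
  have h1 := finrank_map_add_inf_ker ((S.faceTrace (c i)).bubbleE (c i).triangle) curl2
  rw [FES.bubbleE_inf_ker_curl (triangle_ne c i) (h.compat.face i).exact] at h1
  exact ⟨by rw [faceCurls]; infer_instance, h1.symm⟩

lemma finrank_cellGrads (h : S.HasExactBubbles c) :
    FiniteDimensional ℝ (S.cellGrads c) ∧
      Module.finrank ℝ (S.cellGrads c) = Module.finrank ℝ (S.bubbleH c) := by
  have := h.compat.finH
  have hf : FiniteDimensional ℝ (S.bubbleH c) := Submodule.finiteDimensional_of_le inf_le_left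
  exact ⟨by rw [cellGrads]; infer_instance, finrank_grad_bubbleH⟩

lemma finrank_cellCurls (h : S.HasExactBubbles c) :
    FiniteDimensional ℝ (S.cellCurls c) ∧ Module.finrank ℝ (S.bubbleE c) =
      Module.finrank ℝ (S.cellCurls c) + Module.finrank ℝ (S.cellGrads c) := by
  have := h.compat.finE
  have hf : FiniteDimensional ℝ (S.bubbleE c) := Submodule.finiteDimensional_of_le inf_le_left
  have h1 := finrank_map_add_inf_ker (S.bubbleE c) curl3
  rw [Seq3.bubbleE_inf_ker_curl h.compat.exact] at h1
  exact ⟨by rw [cellCurls]; infer_instance, h1.symm⟩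

lemma finrank_cellDivs (h : S.HasExactBubbles c) :
    FiniteDimensional ℝ (S.cellDivs c) ∧ Module.finrank ℝ (S.bubbleV c) =
      Module.finrank ℝ (S.cellDivs c) + Module.finrank ℝ (S.cellCurls c) := by
  have := h.compat.finV
  have hf : FiniteDimensional ℝ (S.bubbleV c) := Submodule.finiteDimensional_of_le inf_le_left
  have h1 := finrank_map_add_inf_ker (S.bubbleV c) div3
  rw [← h.map_curl] at h1
  exact ⟨by rw [cellDivs]; infer_instance, h1.symm⟩

end Seq3.HasExactBubbles

end FES

namespace FES

open MvPolynomial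

/-! ### Interpolation -/

/-- Values of a smooth function at the vertices. -/
def vertexValues : SmoothScalar →ₗ[ℝ] (Fin 4 → ℝ) where
  toFun u v := u.1 (vertex v)
  map_add' _ _ := rfl
  map_smul' _ _ := rfl

namespace Seq3

variable (S : Seq3) (c : ∀ i, FaceChart i)

/-- Degrees of freedom of scalar fields. -/
def dofH : SmoothScalar →ₗ[ℝ] (Fin 4 → ℝ) × (∀ e, S.edgeGrads e) × (∀ i, S.faceGrads c i) ×
    S.cellGrads c :=
  vertexValues.prod ((LinearMap.pi fun e => S.edgeMoment e ∘ₗ gradOf smoothD).prod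
    ((LinearMap.pi fun i => S.faceGradMoment c i ∘ₗ gradOf smoothD).prod
      (S.cellGradMoment c ∘ₗ gradOf smoothD)))

/-- Degrees of freedom of fields with tangential traces. -/
def dofE : SmoothVec →ₗ[ℝ] ((Edge → ℝ) × (∀ e, S.edgeGrads e)) ×
    ((∀ i, S.faceCurls c i) × (∀ i, S.faceGrads c i)) × S.cellCurls c × S.cellGrads c :=
  ((LinearMap.pi fun e => edgeInt e.p e.q).prod (LinearMap.pi S.edgeMoment)).prod
    (((LinearMap.pi fun i => S.faceCurlMoment c i ∘ₗ curl3Of smoothD).prod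
      (LinearMap.pi (S.faceGradMoment c))).prod
        ((S.cellCurlMoment c ∘ₗ curl3Of smoothD).prod (S.cellGradMoment c)))

/-- Degrees of freedom of fields with normal traces. -/
def dofV : SmoothVec →ₗ[ℝ] ((Fin 4 → ℝ) × (∀ i, S.faceCurls c i)) ×
    S.cellDivs c × S.cellCurls c :=
  ((LinearMap.pi faceInt).prod (LinearMap.pi (S.faceCurlMoment c))).prod
    ((S.cellDivMoment c ∘ₗ div3Of smoothD).prod (S.cellCurlMoment c))

/-- Degrees of freedom of scalar fields without traces. -/
def dofW : SmoothScalar →ₗ[ℝ] ℝ × S.cellDivs c := cellInt.prod (S.cellDivMoment c)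

variable {S c}

lemma dofH_eq_zero {u : SmoothScalar} : S.dofH c u = 0 ↔ (∀ v, u.1 (vertex v) = 0) ∧
    (∀ e, S.edgeMoment e (gradOf smoothD u) = 0) ∧
    (∀ i, S.faceGradMoment c i (gradOf smoothD u) = 0) ∧
    S.cellGradMoment c (gradOf smoothD u) = 0 := by
  simp only [Prod.ext_iff, funext_iff]
  rfl

lemma dofE_eq_zero {u : SmoothVec} : S.dofE c u = 0 ↔
    ((∀ e : Edge, edgeInt e.p e.q u = 0) ∧ ∀ e, S.edgeMoment e u = 0) ∧
    ((∀ i, S.faceCurlMoment c i (curl3Of smoothD u) = 0) ∧ ∀ i, S.faceGradMoment c i u = 0) ∧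
    S.cellCurlMoment c (curl3Of smoothD u) = 0 ∧ S.cellGradMoment c u = 0 := by
  simp only [Prod.ext_iff, funext_iff]
  rfl

lemma dofV_eq_zero {u : SmoothVec} : S.dofV c u = 0 ↔
    ((∀ i, faceInt i u = 0) ∧ ∀ i, S.faceCurlMoment c i u = 0) ∧
    S.cellDivMoment c (div3Of smoothD u) = 0 ∧ S.cellCurlMoment c u = 0 := by
  simp only [Prod.ext_iff, funext_iff]
  rfl

lemma dofW_eq_zero {u : SmoothScalar} : S.dofW c u = 0 ↔
    cellInt u = 0 ∧ S.cellDivMoment c u = 0 := by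
  simp only [Prod.ext_iff]
  rfl

/-- Circulations of a gradient are differences of vertex values, curl moments vanish because `curl
grad = 0`, and the gradient moments are already degrees of freedom of `u`. The analogues for curl
and divergence use Stokes and the divergence theorem. -/
lemma dofE_gradOf {u : SmoothScalar} (hu : S.dofH c u = 0) : S.dofE c (gradOf smoothD u) = 0 := by
  obtain ⟨h1, h2, h3, h4⟩ := dofH_eq_zero.1 hu
  refine dofE_eq_zero.2 ⟨⟨fun e => ?_, h2⟩, ⟨fun i => ?_, h3⟩, ?_, h4⟩
  · rw [edgeInt_grad, Edge.p, Edge.q, h1, h1, sub_zero]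
  · rw [curl3Of_gradOf, map_zero]
  · rw [curl3Of_gradOf, map_zero]

lemma faceInt_curl_eq_zero {u : SmoothVec} {i : Fin 4}
    (hu : ∀ e : Edge, e.1.1 ≠ i → e.1.2 ≠ i → edgeInt e.p e.q u = 0) :
    faceInt i (curl3Of smoothD u) = 0 := by
  have h (a b : Fin 3) (hab : a < b) :
      edgeInt (vertex (i.succAbove a)) (vertex (i.succAbove b)) u = 0 :=
    hu ⟨(i.succAbove a, i.succAbove b), Fin.succAbove_lt_succAbove_iff.2 hab⟩
      (Fin.succAbove_ne i a) (Fin.succAbove_ne i b)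
  rw [faceInt_curl, h 0 1 (by decide), h 1 2 (by decide), h 0 2 (by decide)]
  simp

lemma dofV_curl3Of {u : SmoothVec} (hu : S.dofE c u = 0) : S.dofV c (curl3Of smoothD u) = 0 := by
  obtain ⟨⟨h1, h2⟩, ⟨h3, h4⟩, h5, h6⟩ := dofE_eq_zero.1 hu
  refine dofV_eq_zero.2 ⟨⟨fun i => faceInt_curl_eq_zero fun e _ _ => h1 e, h3⟩, ?_, h5⟩
  rw [div3Of_curl3Of, map_zero]

lemma dofW_div3Of {u : SmoothVec} (hu : S.dofV c u = 0) : S.dofW c (div3Of smoothD u) = 0 := by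
  obtain ⟨⟨h1, h2⟩, h3, h4⟩ := dofV_eq_zero.1 hu
  refine dofW_eq_zero.2 ⟨?_, h3⟩
  rw [cellInt_div, h1, h1, h1, h1]
  simp

/-! ### Unisolvence and the interpolation operators -/

namespace HasExactBubbles

lemma dofE_injective (h : S.HasExactBubbles c) {v : PolyVec 3} (hv : v ∈ S.E)
    (h0 : S.dofE c (toSmoothVec v) = 0) : v = 0 := by
  obtain ⟨⟨h1, h2⟩, ⟨h3, h4⟩, h5, h6⟩ := dofE_eq_zero.1 h0
  exact h.E_eq_zero hv (fun i => h.trE_eq_zero i hv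
    (fun e _ _ => h.edgeTrE_eq_zero e hv (h1 e) (h2 e)) (h3 i) (h4 i)) h5 h6

lemma dofV_injective (h : S.HasExactBubbles c) {v : PolyVec 3} (hv : v ∈ S.V)
    (h0 : S.dofV c (toSmoothVec v) = 0) : v = 0 := by
  obtain ⟨⟨h1, h2⟩, h3, h4⟩ := dofV_eq_zero.1 h0
  exact h.V_eq_zero hv (fun i => h.trV_eq_zero i hv (h1 i) (h2 i)) h3 h4

lemma dofW_injective (h : S.HasExactBubbles c) {f : Poly 3} (hf : f ∈ S.W)
    (h0 : S.dofW c (toSmooth f) = 0) : f = 0 :=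
  h.W_eq_zero hf (dofW_eq_zero.1 h0).1 (dofW_eq_zero.1 h0).2

lemma grad_mem (h : S.HasExactBubbles c) {f : Poly 3} (hf : f ∈ S.H) : grad 3 f ∈ S.E := by
  have : grad 3 f ∈ S.E ⊓ LinearMap.ker curl3 := by
    rw [← h.compat.exact.range_grad]; exact ⟨f, hf, rfl⟩
  exact this.1

lemma curl_mem (h : S.HasExactBubbles c) {v : PolyVec 3} (hv : v ∈ S.E) : curl3 v ∈ S.V := by
  have : curl3 v ∈ S.V ⊓ LinearMap.ker div3 := by
    rw [← h.compat.exact.range_curl]; exact ⟨v, hv, rfl⟩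
  exact this.1

lemma div_mem (h : S.HasExactBubbles c) {v : PolyVec 3} (hv : v ∈ S.V) : div3 v ∈ S.W := by
  rw [← h.compat.exact.range_div]; exact ⟨v, hv, rfl⟩

lemma dofH_injective (h : S.HasExactBubbles c) {f : Poly 3} (hf : f ∈ S.H)
    (h0 : S.dofH c (toSmooth f) = 0) : f = 0 := by
  have h1 := dofE_gradOf h0
  rw [gradOf_toSmooth] at h1
  exact grad_injOn_of_eval (h.dofE_injective (h.grad_mem hf) h1) ((dofH_eq_zero.1 h0).1 0)

/-- The dimension formula for the boundary trace matches the degrees of freedom term by term: vertex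
values, edge bubbles, face bubbles, interior bubbles, each space of bubbles having the dimension of
its gradients. -/
lemma exists_piH (h : S.HasExactBubbles c) : ∃ Q : SmoothScalar →ₗ[ℝ] S.H,
    (∀ f : S.H, Q (toSmooth f) = f) ∧ ∀ u, S.dofH c (toSmooth (Q u)) = S.dofH c u := by
  have := h.compat.finH
  have f1 := fun e => (h.finrank_edgeGrads e).1
  have f2 := fun i => (h.finrank_faceGrads i).1
  have f3 := h.finrank_cellGrads.1
  refine exists_interpolation S.H toSmooth (S.dofH c) (fun f hf => h.dofH_injective hf) ?_
  have e1 := finrank_map_add_inf_ker S.H (bdryTrH c)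
  have e2 : Module.finrank ℝ (S.bubbleH c) = Module.finrank ℝ
    (S.H ⊓ LinearMap.ker (bdryTrH c) : Submodule ℝ _) := rfl
  rw [h.compat.dim_trH, ← e2, ← h.finrank_cellGrads.2,
    ← Finset.sum_congr rfl fun e _ => (h.finrank_edgeGrads e).2.1,
    ← Finset.sum_congr rfl fun i _ => (h.finrank_faceGrads i).2] at e1
  rw [← e1]
  simp [Module.finrank_prod, Module.finrank_pi_fintype]
  ring

lemma exists_piE (h : S.HasExactBubbles c) : ∃ Q : SmoothVec →ₗ[ℝ] S.E,
    (∀ v : S.E, Q (toSmoothVec v) = v) ∧ ∀ u, S.dofE c (toSmoothVec (Q u)) = S.dofE c u := by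
  have := h.compat.finE
  have f1 := fun e => (h.finrank_edgeGrads e).1
  have f2 := fun i => (h.finrank_faceGrads i).1
  have f3 := h.finrank_cellGrads.1
  have f4 := fun i => (h.finrank_faceCurls i).1
  have f5 := h.finrank_cellCurls.1
  refine exists_interpolation S.E toSmoothVec (S.dofE c) (fun f hf => h.dofE_injective hf) ?_
  have e1 := finrank_map_add_inf_ker S.E (bdryTrE c)
  have e2 : Module.finrank ℝ (S.bubbleE c) = Module.finrank ℝ
    (S.E ⊓ LinearMap.ker (bdryTrE c) : Submodule ℝ _) := rfl
  rw [h.compat.dim_trE, ← e2, h.finrank_cellCurls.2,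
    Finset.sum_congr rfl fun e _ => (h.finrank_edgeGrads e).2.2,
    Finset.sum_congr rfl fun i _ => (h.finrank_faceCurls i).2, Finset.sum_add_distrib,
    Finset.sum_add_distrib] at e1
  rw [← e1]
  simp [Module.finrank_prod, Module.finrank_pi_fintype]
  ring

lemma exists_piV (h : S.HasExactBubbles c) : ∃ Q : SmoothVec →ₗ[ℝ] S.V,
    (∀ v : S.V, Q (toSmoothVec v) = v) ∧ ∀ u, S.dofV c (toSmoothVec (Q u)) = S.dofV c u := by
  have := h.compat.finV
  have f4 := fun i => (h.finrank_faceCurls i).1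
  have f5 := h.finrank_cellCurls.1
  have f6 := h.finrank_cellDivs.1
  refine exists_interpolation S.V toSmoothVec (S.dofV c) (fun f hf => h.dofV_injective hf) ?_
  have e1 := finrank_map_add_inf_ker S.V (bdryTrV c)
  have e2 : Module.finrank ℝ (S.bubbleV c) = Module.finrank ℝ
    (S.V ⊓ LinearMap.ker (bdryTrV c) : Submodule ℝ _) := rfl
  have e3 (i : Fin 4) : Module.finrank ℝ (S.faceTrace (c i)).W =
    Module.finrank ℝ (S.faceCurls c i) + 1 := h.face_W i
  rw [h.compat.dim_trV, ← e2, h.finrank_cellDivs.2, Finset.sum_congr rfl fun i _ => e3 i,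
    Finset.sum_add_distrib] at e1
  rw [← e1]
  simp [Module.finrank_prod, Module.finrank_pi_fintype]
  ring

lemma exists_piW (h : S.HasExactBubbles c) : ∃ Q : SmoothScalar →ₗ[ℝ] S.W,
    (∀ f : S.W, Q (toSmooth f) = f) ∧ ∀ u, S.dofW c (toSmooth (Q u)) = S.dofW c u := by
  have := h.compat.finW
  have f6 := h.finrank_cellDivs.1
  refine exists_interpolation S.W toSmooth (S.dofW c) (fun f hf => h.dofW_injective hf) ?_
  have e1 : Module.finrank ℝ S.W ≤ Module.finrank ℝ (S.cellDivs c) + 1 := h.finrank_W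
  -- The codimension is at most one by `e1` and at least one because divergences of bubbles have
  -- zero integral.
  have e2 := finrank_lt_of_functional (φ := cellIntPoly) h.cellDivs_le
    (fun _ => cellIntPoly_cellDivs) ⟨1, h.one_mem, cellInt_one_ne⟩
  rw [Module.finrank_prod, Module.finrank_self]
  omega

end HasExactBubbles

end Seq3

end FES

namespace FES

open MvPolynomial MeasureTheory

/-! ### Fields with vanishing traces -/

lemma face_subset_closure (i : Fin 4) : face i ⊆ closure refTet := by
  have hconv : Convex ℝ {x : Fin 3 → ℝ | (∀ i, 0 ≤ x i) ∧ ∑ i, x i ≤ 1} := by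
    rintro x ⟨hx, hx1⟩ y ⟨hy, hy1⟩ a b ha hb hab
    refine ⟨fun m => add_nonneg (mul_nonneg ha (hx m)) (mul_nonneg hb (hy m)), ?_⟩
    have : ∑ m, (a • x + b • y) m = a * ∑ m, x m + b * ∑ m, y m := by
      simp [Finset.sum_add_distrib, Finset.mul_sum]
    rw [this, ← hab]
    nlinarith
  refine (convexHull_min ?_ hconv).trans ?_
  · rintro _ ⟨j, -, rfl⟩
    fin_cases j <;>
      simp [vertex_zero, vertex_one, vertex_two, vertex_three, Fin.forall_fin_succ,
        Fin.sum_univ_three]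
  · rintro x ⟨hx, hx1⟩
    have h0 : (0 : ℝ) ∈ closure (Set.Ioo (0 : ℝ) 1) := by
      rw [closure_Ioo (by norm_num)]
      exact ⟨le_rfl, zero_le_one⟩
    -- Points of the closed tetrahedron are approached along segments towards the interior point
    -- `(1/4, 1/4, 1/4)`.
    have hc : Continuous fun t : ℝ => fun m => x m + t * (1 / 4 - x m) := by fun_prop
    have := map_mem_closure (t := refTet) hc h0 fun t ht => by
      refine ⟨fun m => ?_, ?_⟩
      · have := hx m
        have := ht.1
        have := ht.2
        nlinarith
      · have := ht.1
        have := ht.2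
        rw [Fin.sum_univ_three] at hx1 ⊢
        nlinarith
    simpa using this

lemma eq_zero_of_mem_face {X : Type*} [TopologicalSpace X] [T2Space X] [Zero X]
    {g : (Fin 3 → ℝ) → X} (hg : Continuous g) (h : ∀ x ∈ refTet, g x = 0) {i : Fin 4}
    {x : Fin 3 → ℝ} (hx : x ∈ face i) : g x = 0 :=
  Set.EqOn.closure (f := g) (g := fun _ => 0) h hg continuous_const (face_subset_closure i hx)

lemma smoothD_eq_zero_of_refTet {u : SmoothScalar} (h : ∀ x ∈ refTet, u.1 x = 0) (m : Fin 3)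
    {x : Fin 3 → ℝ} (hx : x ∈ refTet) : (smoothD m u).1 x = 0 := by
  have h1 : u.1 =ᶠ[nhds x] fun _ => 0 := Filter.eventually_of_mem (isOpen_refTet.mem_nhds hx) h
  rw [smoothD_apply, h1.fderiv_eq]
  simp

lemma edge_mem_segment (e : Edge) {s : ℝ} (hs : s ∈ Set.Ioo 0 (edgeLen e.p e.q)) :
    e.p + s • edgeDir e.p e.q ∈ segment ℝ e.p e.q := by
  rw [segment_eq_image']
  have hL := edgeLen_pos e.p_ne_q
  refine ⟨s / edgeLen e.p e.q, ⟨by have := hs.1; positivity, (div_le_one hL).2 hs.2.le⟩, ?_⟩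
  simp only [edgeDir, smul_smul, div_eq_mul_inv]

lemma edgeAgree_gradOf (e : Edge) {u : SmoothScalar} (h : ∀ x ∈ segment ℝ e.p e.q, u.1 x = 0) :
    EdgeAgree e (gradOf smoothD u) 0 := by
  intro s hs
  rw [Polynomial.eval_zero]
  refine (hasDerivAt_line u e.p (edgeDir e.p e.q) s).unique
    ((hasDerivAt_const s (0 : ℝ)).congr_of_eventuallyEq ?_)
  exact Filter.eventually_of_mem (isOpen_Ioo.mem_nhds hs) fun t ht => h _ (edge_mem_segment e ht)

lemma edge_subset_face {e : Edge} {i : Fin 4} (h1 : e.1.1 ≠ i) (h2 : e.1.2 ≠ i) :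
    segment ℝ e.p e.q ⊆ face i := segment_subset_face h1 h2

namespace FaceChart

variable {i : Fin 4} (c : FaceChart i)

lemma point_add (s : Fin 2 → ℝ) (t : ℝ) (j : Fin 2) :
    c.point (s + t • Pi.single j 1) = c.point s + t • (![c.t₁, c.t₂] j) := by
  fin_cases j <;> simp [point] <;> module

lemma edgeDir_dot_n {e : Edge} (h1 : e.1.1 ≠ i) (h2 : e.1.2 ≠ i) :
    edgeDir e.p e.q ⬝ᵥ c.n = 0 := by
  have e1 := c.in_plane _ h1
  have e2 := c.in_plane _ h2
  have : vertex e.1.2 - vertex e.1.1 =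
    (vertex e.1.2 - c.origin) - (vertex e.1.1 - c.origin) := by abel
  rw [edgeDir, smul_dotProduct, Edge.p, Edge.q, this, sub_dotProduct]
  change _ • ((vertex e.1.2 - c.origin) ⬝ᵥ (c.t₁ ⨯₃ c.t₂) -
    (vertex e.1.1 - c.origin) ⬝ᵥ (c.t₁ ⨯₃ c.t₂)) = 0
  rw [e1, e2, sub_zero, smul_zero]

lemma dot_edgeDir_eq_zero {e : Edge} (h1 : e.1.1 ≠ i) (h2 : e.1.2 ≠ i) {w : Fin 3 → ℝ}
    (hw1 : w ⬝ᵥ c.t₁ = 0) (hw2 : w ⬝ᵥ c.t₂ = 0) : w ⬝ᵥ edgeDir e.p e.q = 0 := by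
  rw [(c.dot_n_eq_zero_iff _).1 (c.edgeDir_dot_n h1 h2), dotProduct_add, dotProduct_smul,
    dotProduct_smul, hw1, hw2, smul_zero, smul_zero, add_zero]

lemma dot_eq_zero_of_cross {w : Fin 3 → ℝ} (h : c.n ⨯₃ (w ⨯₃ c.n) = 0) :
    w ⬝ᵥ c.t₁ = 0 ∧ w ⬝ᵥ c.t₂ = 0 := by
  have h1 : c.n ⨯₃ (w ⨯₃ c.n) = (c.n ⬝ᵥ c.n) • w - (w ⬝ᵥ c.n) • c.n := by
    funext m
    fin_cases m <;> simp [cross_apply, dotProduct, Fin.sum_univ_three] <;> ring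
  rw [h1, c.n_unit, one_smul, sub_eq_zero] at h
  constructor
  · rw [h, smul_dotProduct, dotProduct_comm c.n, c.t₁_n, smul_zero]
  · rw [h, smul_dotProduct, dotProduct_comm c.n, c.t₂_n, smul_zero]

end FaceChart

section Face

variable {c : ∀ i, FaceChart i} {i : Fin 4}

lemma faceAgreeE_gradOf {u : SmoothScalar} (h : ∀ x ∈ face i, u.1 x = 0) :
    FaceAgreeE c i (gradOf smoothD u) 0 := by
  have key (s : Fin 2 → ℝ) (hs : s ∈ faceRegion c i) (j : Fin 2) :
      SmoothVec.value (gradOf smoothD u) ((c i).point s) ⬝ᵥ (![(c i).t₁, (c i).t₂] j) = 0 := by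
    have h1 := hasDerivAt_line u ((c i).point s) (![(c i).t₁, (c i).t₂] j) 0
    rw [zero_smul, add_zero] at h1
    refine h1.unique ((hasDerivAt_const (0 : ℝ) (0 : ℝ)).congr_of_eventuallyEq ?_)
    have hc : Continuous fun t : ℝ => s + t • (Pi.single j 1 : Fin 2 → ℝ) := by fun_prop
    have hmem := ((isOpen_faceRegion c i).preimage hc).mem_nhds
      (show (0 : ℝ) ∈ _ by simpa using hs)
    refine Filter.eventually_of_mem hmem fun t ht => ?_
    simp only [← (c i).point_add]
    exact h _ (point_mem_face c ht)
  exact fun s hs => ⟨by simpa using key s hs 0, by simpa using key s hs 1⟩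

/-- The normal component of the curl involves only derivatives along the face of tangential
components, and these vanish on an open region of its plane. -/
lemma faceAgreeV_curl3Of {u : SmoothVec} (h : FaceAgreeE c i u 0) :
    FaceAgreeV c i (curl3Of smoothD u) 0 := by
  intro s hs
  -- The chart of the face is itself an affine parametrization of a triangle, so
  -- `fderiv_comp_triPoint` applies.
  have hpoint (y : Fin 2 → ℝ) : triPoint (c i).origin ((c i).origin + (c i).t₁)
      ((c i).origin + (c i).t₂) y = (c i).point y := by
    simp only [triPoint, FaceChart.point, add_sub_cancel_left]
  have key (w : Fin 3 → ℝ) (hw : ∀ y ∈ faceRegion c i, u.value ((c i).point y) ⬝ᵥ w = 0)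
      (j : Fin 2) : ∑ m, (∑ l, (smoothD l (u m)).1 ((c i).point s) *
        (![(c i).t₁, (c i).t₂] j) l) * w m = 0 := by
    have h1 := (fderiv_comp_triPoint (c i).origin ((c i).origin + (c i).t₁)
      ((c i).origin + (c i).t₂) w u s).2 j
    simp only [hpoint, add_sub_cancel_left] at h1
    rw [← h1]
    have h2 : (fun y => u.value ((c i).point y) ⬝ᵥ w) =ᶠ[nhds s] fun _ => 0 :=
      Filter.eventually_of_mem ((isOpen_faceRegion c i).mem_nhds hs) hw
    rw [h2.fderiv_eq]
    simp
  have h1 := key (c i).t₁ (fun y hy => (h y hy).1) 1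
  have h2 := key (c i).t₂ (fun y hy => (h y hy).2) 0
  rw [map_zero, value_curl3Of, FaceChart.n_apply]
  simp only [Fin.sum_univ_three, Matrix.cons_val_one, Matrix.cons_val_zero, dotProduct,
    Matrix.cons_val] at h1 h2 ⊢
  linear_combination h2 - h1

end Face

/-! ### Commuting projections -/

namespace Seq3

variable {S : Seq3} {c : ∀ i, FaceChart i}

/-- Values on faces and edges vanish by continuity up to the boundary. The curl is only needed on
the open cell and, through `faceAgreeV_curl3Of`, in its normal component on the faces. -/
lemma dofE_eq_zero_of_refTet {u : SmoothVec} (h : ∀ x ∈ refTet, u.value x = 0) :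
    S.dofE c u = 0 := by
  have hf {i : Fin 4} {x : Fin 3 → ℝ} (hx : x ∈ face i) : u.value x = 0 :=
    eq_zero_of_mem_face u.continuous_value h hx
  have hc {x : Fin 3 → ℝ} (hx : x ∈ refTet) : SmoothVec.value (curl3Of smoothD u) x = 0 := by
    have (a b : Fin 3) := smoothD_eq_zero_of_refTet (u := u b) (fun x hx => congrFun (h x hx) b) a hx
    rw [value_curl3Of]
    simp [this]
  have he (e : Edge) {x : Fin 3 → ℝ} (hx : x ∈ segment ℝ e.p e.q) : u.value x = 0 := by
    obtain ⟨i, h1, h2⟩ := exists_ne_edge e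
    exact hf (edge_subset_face h1 h2 hx)
  have hE (i : Fin 4) : FaceAgreeE c i u 0 := fun s hs => by
    rw [hf (point_mem_face c hs)]
    simp
  refine dofE_eq_zero.2 ⟨⟨fun e => edgeInt_eq_zero fun x hx => ?_, fun e =>
    (S.edgeMoment_spec e).eq_zero fun s hs => ?_⟩, ⟨fun i => (S.faceCurlMoment_spec c i).eq_zero
      (faceAgreeV_curl3Of (hE i)), fun i => (S.faceGradMoment_spec c i).eq_zero (hE i)⟩,
    (S.cellCurlMoment_spec c).eq_zero fun x hx => ?_,
    (S.cellGradMoment_spec c).eq_zero fun x hx => ?_⟩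
  · rw [he e hx, zero_dotProduct]
  · rw [he e (edge_mem_segment e hs), zero_dotProduct, Polynomial.eval_zero]
  · rw [hc hx, map_zero]; rfl
  · rw [h x hx, map_zero]; rfl

lemma dofH_eq_zero_of_refTet {u : SmoothScalar} (h : ∀ x ∈ refTet, u.1 x = 0) :
    S.dofH c u = 0 := by
  have h1 := dofE_eq_zero_of_refTet (S := S) (c := c) (u := gradOf smoothD u) fun x hx =>
    funext fun m => smoothD_eq_zero_of_refTet h m hx
  obtain ⟨⟨-, h2⟩, ⟨-, h3⟩, -, h4⟩ := dofE_eq_zero.1 h1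
  refine dofH_eq_zero.2 ⟨fun v => ?_, h2, h3, h4⟩
  obtain ⟨i, hi⟩ : ∃ i : Fin 4, v ≠ i := by fin_cases v <;> decide
  exact eq_zero_of_mem_face (smooth_continuous u) h (vertex_mem_face hi)

lemma dofV_eq_zero_of_refTet {u : SmoothVec} (h : ∀ x ∈ refTet, u.value x = 0) :
    S.dofV c u = 0 := by
  have hf {i : Fin 4} {x : Fin 3 → ℝ} (hx : x ∈ face i) : u.value x = 0 :=
    eq_zero_of_mem_face u.continuous_value h hx
  refine dofV_eq_zero.2 ⟨⟨fun i => (c i).faceInt_eq_zero fun x hx => ?_, fun i =>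
    (S.faceCurlMoment_spec c i).eq_zero fun s hs => ?_⟩,
    (S.cellDivMoment_spec c).eq_zero fun x hx => ?_,
    (S.cellCurlMoment_spec c).eq_zero fun x hx => ?_⟩
  · rw [hf hx, zero_dotProduct]
  · rw [hf (point_mem_face c hs), zero_dotProduct, map_zero]
  · have (a : Fin 3) := smoothD_eq_zero_of_refTet (u := u a) (fun x hx => congrFun (h x hx) a) a hx
    rw [value_div3Of, this, this, this, map_zero, add_zero, add_zero]
  · rw [h x hx, map_zero]; rfl

lemma dofW_eq_zero_of_refTet {u : SmoothScalar} (h : ∀ x ∈ refTet, u.1 x = 0) :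
    S.dofW c u = 0 := by
  refine dofW_eq_zero.2 ⟨?_, (S.cellDivMoment_spec c).eq_zero fun x hx => ?_⟩
  · change ∫ x in refTet, u.1 x = 0
    rw [setIntegral_congr_fun isOpen_refTet.measurableSet (g := fun _ => (0 : ℝ)) h]
    simp
  · rw [h x hx, map_zero]

namespace HasExactBubbles

/-- Trace of the interpolant on an edge. -/
lemma edgeTrE_interpolant (h : S.HasExactBubbles c) (e : Edge) {u : SmoothVec} {v : PolyVec 3}
    (hv : v ∈ S.E) (huv : S.dofE c (toSmoothVec v) = S.dofE c u)
    (h1 : edgeInt e.p e.q u = 0) (h2 : EdgeAgree e u 0) : edgeTrE e.p e.q v = 0 := by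
  rw [← sub_eq_zero, ← map_sub, dofE_eq_zero] at huv
  have e1 := huv.1.1 e
  have e2 := huv.1.2 e
  rw [map_sub, h1, sub_zero] at e1
  rw [map_sub, (S.edgeMoment_spec e).eq_zero h2, sub_zero] at e2
  exact h.edgeTrE_eq_zero e hv e1 e2

/-- Tangential trace of the interpolant on a face. -/
lemma trE_interpolant (h : S.HasExactBubbles c) (i : Fin 4) {u : SmoothVec} {v : PolyVec 3}
    (hv : v ∈ S.E) (huv : S.dofE c (toSmoothVec v) = S.dofE c u)
    (h1 : ∀ e : Edge, e.1.1 ≠ i → e.1.2 ≠ i → edgeInt e.p e.q u = 0 ∧ EdgeAgree e u 0)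
    (h2 : FaceAgreeE c i u 0) : (c i).trE v = 0 := by
  have h0 (e : Edge) (ha : e.1.1 ≠ i) (hb : e.1.2 ≠ i) : edgeTrE e.p e.q v = 0 :=
    h.edgeTrE_interpolant e hv huv (h1 e ha hb).1 (h1 e ha hb).2
  rw [← sub_eq_zero, ← map_sub, dofE_eq_zero] at huv
  have e1 := huv.2.1.1 i
  have e2 := huv.2.1.2 i
  rw [map_sub, map_sub, (S.faceCurlMoment_spec c i).eq_zero (faceAgreeV_curl3Of h2), sub_zero] at e1
  rw [map_sub, (S.faceGradMoment_spec c i).eq_zero h2, sub_zero] at e2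
  exact h.trE_eq_zero i hv h0 e1 e2

lemma trV_interpolant (h : S.HasExactBubbles c) (i : Fin 4) {u : SmoothVec} {v : PolyVec 3}
    (hv : v ∈ S.V) (huv : S.dofV c (toSmoothVec v) = S.dofV c u)
    (hu : ∀ x ∈ face i, u.value x ⬝ᵥ (c i).n = 0) : (c i).trV v = 0 := by
  rw [← sub_eq_zero, ← map_sub, dofV_eq_zero] at huv
  have e1 := huv.1.1 i
  have e2 := huv.1.2 i
  rw [map_sub, (c i).faceInt_eq_zero hu, sub_zero] at e1
  have hF : FaceAgreeV c i u 0 := fun s hs => by rw [hu _ (point_mem_face c hs), map_zero]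
  rw [map_sub, (S.faceCurlMoment_spec c i).eq_zero hF, sub_zero] at e2
  exact h.trV_eq_zero i hv e1 e2

lemma eval_interpolant {u : SmoothScalar} {f : Poly 3}
    (huf : S.dofH c (toSmooth f) = S.dofH c u) (v : Fin 4) : eval (vertex v) f = u.1 (vertex v) :=
  congrFun (congrArg Prod.fst huf) v

/-- For commutation, both sides lie in the target space and have the same degrees of freedom, so
unisolvence identifies them. For the traces, each functional attached to a face or edge depends only
on the trace there, and unisolvence holds on every face and edge separately. -/
theorem admitsCommutingDiagram (h : S.HasExactBubbles c) : AdmitsCommutingDiagram S c := by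
  obtain ⟨piH, projH, dofpiH⟩ := h.exists_piH
  obtain ⟨piE, projE, dofpiE⟩ := h.exists_piE
  obtain ⟨piV, projV, dofpiV⟩ := h.exists_piV
  obtain ⟨piW, projW, dofpiW⟩ := h.exists_piW
  have comm_grad (u : SmoothScalar) : grad 3 (piH u) = piE (gradOf smoothD u) := by
    rw [← sub_eq_zero]
    refine h.dofE_injective (S.E.sub_mem (h.grad_mem (piH u).2) (piE _).2) ?_
    rw [map_sub, map_sub, dofpiE, ← gradOf_toSmooth, ← map_sub, ← map_sub]
    exact dofE_gradOf (by rw [map_sub, dofpiH, sub_self])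
  have comm_curl (u : SmoothVec) : curl3 (piE u) = piV (curl3Of smoothD u) := by
    rw [← sub_eq_zero]
    refine h.dofV_injective (S.V.sub_mem (h.curl_mem (piE u).2) (piV _).2) ?_
    rw [map_sub, map_sub, dofpiV, ← curl3Of_toSmoothVec, ← map_sub, ← map_sub]
    exact dofV_curl3Of (by rw [map_sub, dofpiE, sub_self])
  have comm_div (u : SmoothVec) : div3 (piV u) = piW (div3Of smoothD u) := by
    rw [← sub_eq_zero]
    refine h.dofW_injective (S.W.sub_mem (h.div_mem (piV u).2) (piW _).2) ?_
    rw [map_sub, map_sub, dofpiW, ← div3Of_toSmoothVec, ← map_sub, ← map_sub]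
    exact dofW_div3Of (by rw [map_sub, dofpiV, sub_self])
  refine ⟨piH, piE, piV, piW,
    { projH := projH
      projE := projE
      projV := projV
      projW := projW
      comm_grad := comm_grad
      comm_curl := comm_curl
      comm_div := comm_div
      cellH := fun u hu => Subtype.ext (h.dofH_injective (piH u).2 ?_)
      cellE := fun u hu => Subtype.ext (h.dofE_injective (piE u).2 ?_)
      cellV := fun u hu => Subtype.ext (h.dofV_injective (piV u).2 ?_)
      cellW := fun u hu => Subtype.ext (h.dofW_injective (piW u).2 ?_)
      faceH := fun i u hu => ?_
      faceE := fun i u hu => ?_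
      faceV := fun i u hu => h.trV_interpolant i (piV u).2 (dofpiV u) hu
      edgeH := fun e u hu => ?_
      edgeE := fun e u hu => ?_
      vertexH := fun v u => eval_interpolant (dofpiH u) v }⟩
  · rw [dofpiH, dofH_eq_zero_of_refTet hu]
  · rw [dofpiE, dofE_eq_zero_of_refTet hu]
  · rw [dofpiV, dofV_eq_zero_of_refTet hu]
  · rw [dofpiW, dofW_eq_zero_of_refTet hu]
  -- The scalar trace is handled through its gradient, which by commutation is the tangential trace
  -- of the interpolant of `∇u`; one vertex value fixes the constant.
  · refine grad_injOn_of_eval (p := (c i).triangle 0) ?_ ?_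
    · rw [FaceChart.grad_trH, comm_grad]
      refine h.trE_interpolant i (piE _).2 (dofpiE _) (fun e h1 h2 => ⟨?_, ?_⟩)
        (faceAgreeE_gradOf hu)
      · rw [edgeInt_grad, Edge.p, Edge.q, hu _ (vertex_mem_face h1), hu _ (vertex_mem_face h2), sub_zero]
      · exact edgeAgree_gradOf e fun x hx => hu x (edge_subset_face h1 h2 hx)
    · rw [FaceChart.trH_apply, FaceChart.eval_trAlg, FaceChart.triangle,
        FaceChart.point_coord_vertex _ (Fin.succAbove_ne i 0), eval_interpolant (dofpiH u),
        hu _ (vertex_mem_face (Fin.succAbove_ne i 0))]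
  · have hT (x : Fin 3 → ℝ) (hx : x ∈ face i) := (c i).dot_eq_zero_of_cross (hu x hx)
    have he (e : Edge) (h1 : e.1.1 ≠ i) (h2 : e.1.2 ≠ i) (x) (hx : x ∈ segment ℝ e.p e.q) :
        u.value x ⬝ᵥ edgeDir e.p e.q = 0 :=
      (c i).dot_edgeDir_eq_zero h1 h2 (hT x (edge_subset_face h1 h2 hx)).1
        (hT x (edge_subset_face h1 h2 hx)).2
    refine h.trE_interpolant i (piE u).2 (dofpiE u) (fun e h1 h2 =>
      ⟨edgeInt_eq_zero (he e h1 h2), fun s hs => ?_⟩) fun s hs => ?_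
    · rw [he e h1 h2 _ (edge_mem_segment e hs), Polynomial.eval_zero]
    · simpa using hT _ (point_mem_face c hs)
  -- As on faces: zero tangential derivative together with the value at one end point.
  · have h1 : edgeTrE e.p e.q (grad 3 (piH u)) = 0 := by
      rw [comm_grad]
      refine h.edgeTrE_interpolant e (piE _).2 (dofpiE _) ?_ (edgeAgree_gradOf e hu)
      rw [edgeInt_grad, hu _ (left_mem_segment _ _ _), hu _ (right_mem_segment _ _ _), sub_zero]
    have h2 : eval e.p (piH u : Poly 3) = 0 := by
      have := eval_interpolant (dofpiH u) e.1.1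
      rw [Edge.p, this]
      exact hu _ (left_mem_segment _ _ _)
    rw [(edgeTrH_const e.p_ne_q h1).1, h2, Polynomial.C_0]
  · refine h.edgeTrE_interpolant e (piE u).2 (dofpiE u) (edgeInt_eq_zero hu) fun s hs => ?_
    rw [hu _ (edge_mem_segment e hs), Polynomial.eval_zero]

end HasExactBubbles

end Seq3

end FES

end

theorem theorem4p5 (k : ℕ) (c : ∀ i : Fin 4, FES.FaceChart i) :
    -- the second kind sequence
    ((FES.S1tet k).IsExact ∧
      (FES.S1tet k).IsCompatible c ∧
      FES.AdmitsCommutingDiagram (FES.S1tet k) c ∧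
      ∀ i, (FES.S1tet k).faceTrace (c i) = FES.S1tri (k + 1)) ∧
    -- the first kind sequence; the sums defining its spaces are direct
    (Disjoint (FES.PVec 3 k) ((FES.PhomVec 3 k).map FES.xCross3) ∧
      Disjoint (FES.PVec 3 k) ((FES.Phom 3 k).map FES.xMul3) ∧
      Disjoint (FES.PVec 2 k) ((FES.Phom 2 k).map FES.xCross2) ∧
      (FES.S2tet k).IsExact ∧
      (FES.S2tet k).IsCompatible c ∧
      FES.AdmitsCommutingDiagram (FES.S2tet k) c ∧
      ∀ i, (FES.S2tet k).faceTrace (c i) = FES.S2tri k) := by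
  have h1 := FES.S1tet_hasExactBubbles k c
  have h2 := FES.S2tet_hasExactBubbles k c
  exact ⟨⟨FES.S1tet_isExact k, h1.compat, h1.admitsCommutingDiagram,
      fun i => FES.S1tet_faceTrace k (c i)⟩,
    FES.disjoint_of_degrees fun _ hv => FES.xCross3_mem_PhomVec hv,
    FES.disjoint_of_degrees fun _ hv => FES.xMul3_mem_PhomVec hv,
    FES.disjoint_of_degrees fun _ hv => FES.xCross2_mem_PhomVec hv,
    FES.S2tet_isExact k, h2.compat, h2.admitsCommutingDiagram,
    fun i => FES.S2tet_faceTrace k (c i)⟩
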